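/- Let $\rho: Y \to X$ be a smooth fibre bundle (or, more generally, a surjective submersion) with $\dim X = n+1$, $n \ge 0$, and fibre dimension $k$; let $X$ be oriented by a volume form $dV$; let $\mathcal{L} = L\,dV$ be a first-order Lagrangian density, with $L$ a smooth function on the first jet bundle $J^1Y$; and let $U \subset X$ be a relatively compact open set with smooth boundary $\partial U$, carrying the boundary orientation. In adapted coordinates $(x^\mu, y^a, y^a_\mu)$, in which $\mathcal{L} = L\, d^{n+1}x$, put $$\Theta_L = \Big(L - \frac{\partial L}{\partial y^a_\mu} y^a_\mu\Big) d^{n+1}x + \frac{\partial L}{\partial y^a_\mu}\, dy^a \wedge d^n x_\mu, \qquad d^n x_\mu = \mathbf{i}_{\partial/\partial x^\mu} d^{n+1}x, \qquad \Omega_L = -\mathbf{d}\Theta_L .$$ Fields are sections $\phi$ of $\rho$ over $\overline U$ that are smooth up to the boundary (i.e. extend smoothly to a neighbourhood of $\overline U$), and the action is $\mathcal{S}(\phi) = \int_U L(j^1\phi)\,dV$. A first variation of a solution $\phi$ of the Euler--Lagrange equations is a vertical vector field $V = \frac{d}{d\epsilon}\phi_\epsilon\big|_{\epsilon=0}$ along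 $\phi$, where $\phi_\epsilon$ is a smooth one-parameter family of solutions with $\phi_0 = \phi$. Let $\mathscr{Y}_{\partial U}$ be the space of smooth sections $\varphi: \partial U \to Y$ of $\rho$. Its cotangent bundle $T^*\mathscr{Y}_{\partial U}$ consists of the pairs $(\varphi, \pi)$ with $\pi$ a smooth section of $\varphi^*(V^*Y) \otimes \bigwedge^n T^*\partial U$, paired with $\delta\varphi \in T_\varphi\mathscr{Y}_{\partial U}$ by $\langle \delta\varphi, \pi\rangle = \int_{\partial U} \pi\cdot\delta\varphi$; it carries the canonical weak symplectic form $\omega = -\mathbf{d}\Theta$, where $\Theta$ is the canonical one-form. Let $\mathscr{K}_{\partial U} \subset \mathscr{Y}_{\partial U}$ be the set of admissible boundary data, i.e. of those $\varphi$ for which the Euler--Lagrange equations have a unique solution $\phi$ with $\phi|_{\partial U} = \varphi$, and let $L_{\partial U}(\varphi) = \mathcal{S}(\phi)$ be the boundary Lagrangian. A smooth curve in $\mathscr{K}_{\partial U}$ is a curve of admissible boundary data whose solutions depend smoothly on the parameter and on $x \in \overline U$. For $\varphi \in \mathscr{K}_{\partial U}$ the differential $\mathbf{d}L_{\partial U}(\varphi)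 \in T^*_\varphi\mathscr{Y}_{\partial U}$ is the covector whose pairing with the velocity of a smooth curve in $\mathscr{K}_{\partial U}$ through $\varphi$ is the derivative of $L_{\partial U}$ along the curve and, for an arbitrary variation $V$ of $\phi$ through fields, whose pairing with $V|_{\partial U}$ is $\mathbf{d}\mathcal{S}(\phi)\cdot V$. Then $\mathbf{d}L_{\partial U}: \mathscr{K}_{\partial U} \to T^*\mathscr{Y}_{\partial U}$ is well defined (the covector exists and is unique) and maps smooth curves to smooth curves. With $\mathscr{M}_{\partial U} = \mathbf{d}L_{\partial U}(\mathscr{K}_{\partial U})$, a tangent vector of $\mathscr{M}_{\partial U}$ being the velocity of the image of a smooth curve in $\mathscr{K}_{\partial U}$, the set $\mathscr{M}_{\partial U}$ is isotropic in $(T^*\mathscr{Y}_{\partial U}, \omega)$ (that is, $\omega$ vanishes on any two tangent vectors of $\mathscr{M}_{\partial U}$ at the same point) if and only if the multisymplectic form formula $$\int_{\partial U} (j^1\phi)^*\big(\mathbf{i}_{j^1W}\,\mathbf{i}_{j^1V}\,\Omega_L\big) = 0$$ holds for all solutions $\phi$ of the Euler--Lagrange equations on $U$ and all first variations $V, W$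 of $\phi$. Moreover, $$\big((\mathbf{d}L_{\partial U})^*\omega\big)(\varphi)\cdot(\delta\varphi, \delta\varphi') = \int_{\partial U}(j^1\phi)^*\big(\mathbf{i}_{j^1W}\,\mathbf{i}_{j^1V}\,\Omega_L\big)$$ for all $\varphi \in \mathscr{K}_{\partial U}$ with solution $\phi$, and all velocities $\delta\varphi, \delta\varphi'$ at $\varphi$ of smooth curves in $\mathscr{K}_{\partial U}$, where $V, W$ are the first variations of $\phi$ given by the solutions along these curves. -/

import Mathlib

open scoped Manifold ContDiff Topology
open Set Filter MeasureTheory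

noncomputable section

namespace BoundaryFields

/-- The coordinate space `ℝ^d`. -/
abbrev Eu (d : ℕ) : Type := EuclideanSpace ℝ (Fin d)

/-- The coordinate basis vectors. -/
def stdVec {d : ℕ} (i : Fin d) : Eu d := EuclideanSpace.single i 1

/-! ### Volume forms, their measures, and integrals of forms of top degree -/

section Volume

variable {d : ℕ} {M : Type*} [TopologicalSpace M] [ChartedSpace (Eu d) M]

/-- The component `τ(∂/∂x¹, …, ∂/∂x^d)` of a form of top degree in a chart `c`,
at the point with coordinates `z`. -/
def formDensity (τ : ∀ x : M, TangentSpace (𝓡 d) x [⋀^Fin d]→L[ℝ] ℝ)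
    (c : OpenPartialHomeomorph M (Eu d)) (z : Eu d) : ℝ :=
  τ (c.symm z) (fun i => mfderiv (𝓡 d) (𝓡 d) c.symm z (stdVec i))

variable (d M) in
/-- A volume form: a smooth nowhere vanishing form of top degree. It orients the manifold. -/
structure VolumeForm where
  /-- the form -/
  form : ∀ x : M, TangentSpace (𝓡 d) x [⋀^Fin d]→L[ℝ] ℝ
  ne_zero : ∀ x, form x ≠ 0
  smooth : ∀ c ∈ IsManifold.maximalAtlas (𝓡 d) ∞ M,
    ContDiffOn ℝ ∞ (formDensity form c) c.target

/-- `m` is the measure of the volume form `τ`: in each chart it is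
`|τ(∂/∂x¹, …, ∂/∂x^d)| dx¹ ⋯ dx^d`. -/
def IsVolumeMeasure [MeasurableSpace M] (τ : VolumeForm d M) (m : Measure M) : Prop :=
  ∀ c ∈ IsManifold.maximalAtlas (𝓡 d) ∞ M,
    (m.restrict c.source).map c =
      (volume.restrict c.target).withDensity
        (fun z => ENNReal.ofReal |formDensity τ.form c z|)

/-- The quotient `β / τ` of two forms of top degree at one point: `β = (β / τ) τ`. -/
def formQuot {x : M} (β τ : TangentSpace (𝓡 d) x [⋀^Fin d]→L[ℝ] ℝ) : ℝ :=
  β (fun i => (stdVec i : Eu d)) / τ (fun i => (stdVec i : Eu d))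

/-- `∫_M β` for a form `β` of top degree, where `M` is oriented by `τ` and `m` is the measure
of `τ`. -/
def formIntegral [MeasurableSpace M] (τ : VolumeForm d M) (m : Measure M)
    (β : ∀ x : M, TangentSpace (𝓡 d) x [⋀^Fin d]→L[ℝ] ℝ) : ℝ :=
  ∫ x, formQuot (β x) (τ.form x) ∂m

end Volume

/-! ### The Poincaré–Cartan form in the coordinates `(x^μ, y^a, y^a_μ)` of the jet bundle -/

section Coordinates

variable (n k : ℕ)

/-- The coordinates `(x^μ, y^a, y^a_μ)`, the last ones gathered into a linear map. -/
abbrev JetCoord : Type := Eu (n + 1) × Eu k × (Eu (n + 1) →L[ℝ] Eu k)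

variable {n k}

/-- `d^{n+1}x` on `ℝ^{n+1}`. -/
def baseVol (d : ℕ) : Eu d [⋀^Fin d]→L[ℝ] ℝ :=
  { (EuclideanSpace.basisFun (Fin d) ℝ).toBasis.det with
    cont := by
      have h : Continuous (fun v : Fin d → Eu d =>
          Matrix.det (Matrix.of fun i j => v j i)) := by
        apply Continuous.matrix_det
        fun_prop
      refine h.congr fun v => ?_
      show _ = (EuclideanSpace.basisFun (Fin d) ℝ).toBasis.det v
      rw [Module.Basis.det_apply]
      congr 1 }

/-- `d^{n+1}x` on the jet coordinate space. -/
def dx : JetCoord n k [⋀^Fin (n + 1)]→L[ℝ] ℝ :=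
  (baseVol (n + 1)).compContinuousLinearMap (ContinuousLinearMap.fst ℝ _ _)

/-- `d^n x_μ`, the contraction of `d^{n+1}x` with `∂/∂x^μ`. -/
def dxContr (μ : Fin (n + 1)) : JetCoord n k [⋀^Fin n]→L[ℝ] ℝ :=
  (dx (n := n) (k := k)).curryLeft (stdVec μ, 0, 0)

/-- The one-form `dy^a`. -/
def dy (a : Fin k) : JetCoord n k →L[ℝ] ℝ :=
  (EuclideanSpace.proj a).comp
    ((ContinuousLinearMap.fst ℝ _ _).comp (ContinuousLinearMap.snd ℝ _ _))

/-- The wedge product of a one-form and an `m`-form,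
`(α ∧ β)(v₀, …, v_m) = ∑ᵢ (-1)ⁱ α(vᵢ) β(v₀, …, v̂ᵢ, …, v_m)`. -/
def oneWedge {V : Type*} [NormedAddCommGroup V] [NormedSpace ℝ V] {m : ℕ}
    (α : V →L[ℝ] ℝ) (β : V [⋀^Fin m]→L[ℝ] ℝ) : V [⋀^Fin (m + 1)]→L[ℝ] ℝ :=
  .alternatizeUncurryFin (α.smulRight β)

/-- `∂ℓ/∂y^a_μ` at the point `q` of the jet coordinate space. -/
def momentum (ℓ : JetCoord n k → ℝ) (q : JetCoord n k) (μ : Fin (n + 1)) (a : Fin k) : ℝ :=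
  fderiv ℝ ℓ q
    (0, 0, (EuclideanSpace.proj μ : Eu (n + 1) →L[ℝ] ℝ).smulRight (stdVec a : Eu k))

/-- The Poincaré–Cartan form
`Θ = (ℓ - ∂ℓ/∂y^a_μ y^a_μ) d^{n+1}x + ∂ℓ/∂y^a_μ dy^a ∧ d^n x_μ`. -/
def poincareCartan (ℓ : JetCoord n k → ℝ) (q : JetCoord n k) :
    JetCoord n k [⋀^Fin (n + 1)]→L[ℝ] ℝ :=
  (ℓ q - ∑ μ, ∑ a, momentum ℓ q μ a * q.2.2 (stdVec μ) a) • dx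
    + ∑ μ, ∑ a, momentum ℓ q μ a • oneWedge (dy a) (dxContr μ)

/-- The multisymplectic form `Ω = -dΘ`. -/
def multisymplectic (ℓ : JetCoord n k → ℝ) (q : JetCoord n k) :
    JetCoord n k [⋀^Fin (n + 2)]→L[ℝ] ℝ :=
  -extDeriv (poincareCartan ℓ) q

/-- The canonical one-form `θ = q_a du^a` on `T^*ℝ^k`, with coordinates `(u^a, q_a)`. -/
def canonicalOneForm (k : ℕ) (p : Eu k × Eu k) : (Eu k × Eu k) [⋀^Fin 1]→L[ℝ] ℝ :=
  ContinuousAlternatingMap.ofSubsingleton ℝ (Eu k × Eu k) ℝ (0 : Fin 1)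
    (∑ a, p.2 a • (EuclideanSpace.proj a : Eu k →L[ℝ] ℝ).comp (ContinuousLinearMap.fst ℝ _ _))

/-- The canonical symplectic form `-dθ` on `T^*ℝ^k`. -/
def canonicalSymplectic (k : ℕ) (p : Eu k × Eu k) : (Eu k × Eu k) [⋀^Fin 2]→L[ℝ] ℝ :=
  -extDeriv (canonicalOneForm k) p

end Coordinates

/-! ### The configuration bundle, its first jet bundle, and Lagrangians -/

section Bundle

variable {n k : ℕ} {X Y : Type*}
  [TopologicalSpace X] [ChartedSpace (Eu (n + 1)) X]
  [TopologicalSpace Y] [ChartedSpace (Eu (n + 1) × Eu k) Y]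

variable (n k) in
/-- Coordinates `(x^μ)` on `X` and `(x^μ, y^a)` on `Y` adapted to `ρ : Y → X`. -/
structure AdaptedChart (ρ : Y → X) where
  /-- the coordinates `x^μ` -/
  base : OpenPartialHomeomorph X (Eu (n + 1))
  /-- the coordinates `(x^μ, y^a)` -/
  total : OpenPartialHomeomorph Y (Eu (n + 1) × Eu k)
  base_mem : base ∈ IsManifold.maximalAtlas (𝓡 (n + 1)) ∞ X
  total_mem : total ∈ IsManifold.maximalAtlas 𝓘(ℝ, Eu (n + 1) × Eu k) ∞ Y
  mapsTo : ∀ y ∈ total.source, ρ y ∈ base.source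
  fst_eq : ∀ y ∈ total.source, (total y).1 = base (ρ y)

variable (n k) in
/-- `ρ : Y → X` is a fibred manifold (a surjective submersion): it has adapted coordinates
around every point of `Y`. Smooth fibre bundles are fibred manifolds. -/
structure IsFibred (ρ : Y → X) : Prop where
  smooth : ContMDiff 𝓘(ℝ, Eu (n + 1) × Eu k) (𝓡 (n + 1)) ∞ ρ
  surjective : Function.Surjective ρ
  exists_chart : ∀ y, ∃ C : AdaptedChart n k ρ, y ∈ C.total.source

variable (n k) in
/-- The first jet bundle `J¹Y`: the jet at `x = ρ y` of a section through `y` is its tangent map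
`T_x X → T_y Y`, a linear map splitting `Tρ`. -/
structure J1 (ρ : Y → X) where
  /-- the point `y` -/
  pt : Y
  /-- the tangent map -/
  lin : TangentSpace (𝓡 (n + 1)) (ρ pt) →L[ℝ] TangentSpace 𝓘(ℝ, Eu (n + 1) × Eu k) pt
  splits : (mfderiv 𝓘(ℝ, Eu (n + 1) × Eu k) (𝓡 (n + 1)) ρ pt).comp lin
    = ContinuousLinearMap.id ℝ _

open Classical in
/-- The value of a function on `J¹Y` at `(y, A)`, if this is a jet (and `0` if it is not). -/
def jetEval {ρ : Y → X} (L : J1 n k ρ → ℝ) (y : Y)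
    (A : TangentSpace (𝓡 (n + 1)) (ρ y) →L[ℝ] TangentSpace 𝓘(ℝ, Eu (n + 1) × Eu k) y) : ℝ :=
  if h : (mfderiv 𝓘(ℝ, Eu (n + 1) × Eu k) (𝓡 (n + 1)) ρ y).comp A
      = ContinuousLinearMap.id ℝ _ then L ⟨y, A, h⟩ else 0

/-- The Lagrangian in adapted coordinates: the function `ℓ(x^μ, y^a, y^a_μ)` for which the
Lagrangian density `L vol` is `ℓ d^{n+1}x`. -/
def localLagrangian {ρ : Y → X} (vol : VolumeForm (n + 1) X) (L : J1 n k ρ → ℝ)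
    (C : AdaptedChart n k ρ) (q : JetCoord n k) : ℝ :=
  jetEval L (C.total.symm (q.1, q.2.1))
    ((mfderiv 𝓘(ℝ, Eu (n + 1) × Eu k) 𝓘(ℝ, Eu (n + 1) × Eu k) C.total.symm (q.1, q.2.1)).comp
      (((ContinuousLinearMap.id ℝ (Eu (n + 1))).prod q.2.2).comp
        (mfderiv (𝓡 (n + 1)) (𝓡 (n + 1)) C.base (ρ (C.total.symm (q.1, q.2.1))))))
    * formDensity vol.form C.base q.1

/-- `L` is a smooth function on `J¹Y`. -/
def IsSmoothLagrangian {ρ : Y → X} (vol : VolumeForm (n + 1) X) (L : J1 n k ρ → ℝ) : Prop :=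
  ∀ C : AdaptedChart n k ρ, ContDiffOn ℝ ∞ (localLagrangian vol L C)
    {q | (q.1, q.2.1) ∈ C.total.target}

/-- The coordinate expression `y^a = φ^a(x)` of a field. -/
def localField {ρ : Y → X} (C : AdaptedChart n k ρ) (φ : X → Y) (z : Eu (n + 1)) : Eu k :=
  (C.total (φ (C.base.symm z))).2

/-- The coordinate expression of `j¹φ`. -/
def localJet {ρ : Y → X} (C : AdaptedChart n k ρ) (φ : X → Y) (z : Eu (n + 1)) : JetCoord n k :=
  (z, localField C φ z, fderiv ℝ (localField C φ) z)

/-- The coordinate expression `V^a(x)` of a vertical vector field `V` along `φ`. -/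
def localVector {ρ : Y → X} (C : AdaptedChart n k ρ) (φ : X → Y)
    (V : ∀ x, TangentSpace 𝓘(ℝ, Eu (n + 1) × Eu k) (φ x)) (z : Eu (n + 1)) : Eu k :=
  (show Eu (n + 1) × Eu k from
    mfderiv 𝓘(ℝ, Eu (n + 1) × Eu k) 𝓘(ℝ, Eu (n + 1) × Eu k) C.total (φ (C.base.symm z))
      (V (C.base.symm z))).2

/-- The coordinate expression `V^a ∂/∂y^a + (∂V^a/∂x^μ) ∂/∂y^a_μ` of the prolongation `j¹V`. -/
def localProlong {ρ : Y → X} (C : AdaptedChart n k ρ) (φ : X → Y)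
    (V : ∀ x, TangentSpace 𝓘(ℝ, Eu (n + 1) × Eu k) (φ x)) (z : Eu (n + 1)) : JetCoord n k :=
  (0, localVector C φ V z, fderiv ℝ (localVector C φ V) z)

/-- The Euler–Lagrange equations for the coordinate Lagrangian `ℓ`, at the point `z`:
`d/dx^μ (∂ℓ/∂y^a_μ (j¹φ)) - ∂ℓ/∂y^a (j¹φ) = 0` for all `a`. -/
def EulerLagrangeAt (ℓ : JetCoord n k → ℝ) (j : Eu (n + 1) → JetCoord n k)
    (z : Eu (n + 1)) : Prop :=
  ∀ a : Fin k,
    ∑ μ, fderiv ℝ (fun w => momentum ℓ (j w) μ a) z (stdVec μ)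
      - fderiv ℝ ℓ (j z) (0, stdVec a, 0) = 0

variable (n k) in
/-- The velocity `dc/dε` at `ε = 0` of a curve in `Y`. -/
def velocity (c : ℝ → Y) : TangentSpace 𝓘(ℝ, Eu (n + 1) × Eu k) (c 0) :=
  mfderiv 𝓘(ℝ, ℝ) 𝓘(ℝ, Eu (n + 1) × Eu k) c 0 (1 : ℝ)

variable (n k) in
/-- The vertical tangent space `V_y Y`. -/
def Vert (ρ : Y → X) (y : Y) : Submodule ℝ (TangentSpace 𝓘(ℝ, Eu (n + 1) × Eu k) y) :=
  LinearMap.ker (mfderiv 𝓘(ℝ, Eu (n + 1) × Eu k) (𝓡 (n + 1)) ρ y).toLinearMap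

open Classical in
/-- The value of a linear map on `V_y Y` at a tangent vector, if it is vertical (and `0` if it
is not). -/
def vertEval {ρ : Y → X} {y : Y} {W : Type*} [AddCommGroup W] [Module ℝ W]
    (f : Vert n k ρ y →ₗ[ℝ] W) (v : TangentSpace 𝓘(ℝ, Eu (n + 1) × Eu k) y) : W :=
  if h : v ∈ Vert n k ρ y then f ⟨v, h⟩ else 0

/-- The vertical tangent vector `∂/∂y^a` at `y`. -/
def coordVert {ρ : Y → X} (C : AdaptedChart n k ρ) (y : Y) (a : Fin k) :
    TangentSpace 𝓘(ℝ, Eu (n + 1) × Eu k) y :=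
  (show Eu (n + 1) × Eu k from
    mfderiv 𝓘(ℝ, Eu (n + 1) × Eu k) 𝓘(ℝ, Eu (n + 1) × Eu k) C.total.symm (C.total y)
      (show Eu (n + 1) × Eu k from (0, stdVec a)))

end Bundle

/-! ### Domains with smooth boundary -/

section Domain

variable {n : ℕ} {X B : Type*}
  [TopologicalSpace X] [ChartedSpace (Eu (n + 1)) X]
  [TopologicalSpace B] [ChartedSpace (Eu n) B]

/-- `U` is a relatively compact open subset of `X` with smooth boundary, `ι : B → X` is the
embedding of the manifold `B = ∂U`, and `σ` is positive for the boundary orientation (outward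
direction first). Around each boundary point there are coordinates on `X` adapted to `∂U`, in
which `U` is `x⁰ < 0` and `ι (x¹, …, xⁿ) = (0, x¹, …, xⁿ)`. -/
structure IsSmoothDomain (vol : VolumeForm (n + 1) X) (σ : VolumeForm n B)
    (U : Set X) (ι : B → X) : Prop where
  isOpen : IsOpen U
  isCompact_closure : IsCompact (closure U)
  injective : Function.Injective ι
  range_eq : range ι = frontier U
  slice : ∀ s : B, ∃ ψ ∈ IsManifold.maximalAtlas (𝓡 (n + 1)) ∞ X,
    ∃ κ ∈ IsManifold.maximalAtlas (𝓡 n) ∞ B,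
      s ∈ κ.source ∧
      (∀ t, t ∈ κ.source ↔ ι t ∈ ψ.source) ∧
      (∀ t ∈ κ.source, ψ (ι t) 0 = 0 ∧ ∀ j : Fin n, ψ (ι t) j.succ = κ t j) ∧
      (∀ x ∈ ψ.source, x ∈ U ↔ ψ x 0 < 0) ∧
      ∀ t ∈ κ.source, 0 < formDensity vol.form ψ (ψ (ι t)) * formDensity σ.form κ (κ t)

end Domain

/-! ### A first-order Lagrangian field theory on a domain with boundary -/

/-- The data of the problem: the configuration bundle `ρ : Y → X` over a manifold oriented by a
volume form `vol` (with measure `m`), the Lagrangian density `L vol`, and a domain `U` with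
boundary `ι : B → X` oriented by `σ` (with measure `mB`). -/
structure FieldTheory (n k : ℕ) (X Y B : Type*)
    [TopologicalSpace X] [ChartedSpace (Eu (n + 1)) X] [MeasurableSpace X]
    [TopologicalSpace Y] [ChartedSpace (Eu (n + 1) × Eu k) Y]
    [TopologicalSpace B] [ChartedSpace (Eu n) B] [MeasurableSpace B] where
  /-- the bundle projection -/
  ρ : Y → X
  fibred : IsFibred n k ρ
  /-- the volume form `dV` -/
  vol : VolumeForm (n + 1) X
  /-- its measure -/
  m : Measure X
  isVolumeMeasure : IsVolumeMeasure vol m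
  /-- the Lagrangian function -/
  L : J1 n k ρ → ℝ
  smooth_L : IsSmoothLagrangian vol L
  /-- the domain -/
  U : Set X
  /-- the embedding of the boundary -/
  ι : B → X
  /-- a positive volume form `dS` on the boundary -/
  σ : VolumeForm n B
  /-- its measure -/
  mB : Measure B
  isVolumeMeasure_B : IsVolumeMeasure σ mB
  domain : IsSmoothDomain vol σ U ι

namespace FieldTheory

variable {n k : ℕ} {X Y B : Type*}
  [TopologicalSpace X] [ChartedSpace (Eu (n + 1)) X] [MeasurableSpace X]
  [TopologicalSpace Y] [ChartedSpace (Eu (n + 1) × Eu k) Y]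
  [TopologicalSpace B] [ChartedSpace (Eu n) B] [MeasurableSpace B]
  (T : FieldTheory n k X Y B)

/-! #### Fields, the action, and the Euler–Lagrange equations -/

/-- `φ` is a field on the closure of `U`, smooth up to the boundary: a section of `ρ` that is
smooth on a neighbourhood of the closure. -/
def IsField (φ : X → Y) : Prop :=
  ∀ᶠ x in 𝓝ˢ (closure T.U),
    ContMDiffAt (𝓡 (n + 1)) 𝓘(ℝ, Eu (n + 1) × Eu k) ∞ φ x ∧ T.ρ (φ x) = x

/-- A smooth one-parameter family of fields. -/
def IsFieldFamily (Φ : ℝ → X → Y) : Prop :=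
  ∀ᶠ p in 𝓝ˢ ((univ : Set ℝ) ×ˢ closure T.U),
    ContMDiffAt (𝓘(ℝ, ℝ).prod (𝓡 (n + 1))) 𝓘(ℝ, Eu (n + 1) × Eu k) ∞
      (fun p : ℝ × X => Φ p.1 p.2) p ∧ T.ρ (Φ p.1 p.2) = p.2

/-- The action `S(φ) = ∫_U L(j¹φ) dV`. -/
def action (φ : X → Y) : ℝ :=
  ∫ x in T.U, jetEval T.L (φ x) (mfderiv (𝓡 (n + 1)) 𝓘(ℝ, Eu (n + 1) × Eu k) φ x) ∂T.m

/-- `φ` is a solution of the Euler–Lagrange equations on `U`. -/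
def IsSolution (φ : X → Y) : Prop :=
  T.IsField φ ∧ ∀ x ∈ T.U, ∀ C : AdaptedChart n k T.ρ, φ x ∈ C.total.source →
    EulerLagrangeAt (localLagrangian T.vol T.L C) (localJet C φ) (C.base x)

/-- A smooth one-parameter family of solutions. -/
def IsSolutionFamily (Φ : ℝ → X → Y) : Prop :=
  T.IsFieldFamily Φ ∧ ∀ ε, T.IsSolution (Φ ε)

/-- `V` is a first variation of the solution `φ`. -/
def IsFirstVariation (φ : X → Y)
    (V : ∀ x, TangentSpace 𝓘(ℝ, Eu (n + 1) × Eu k) (φ x)) : Prop :=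
  ∃ Φ : ℝ → X → Y, T.IsSolutionFamily Φ ∧ Φ 0 = φ ∧ ∀ x, V x = velocity n k (fun ε => Φ ε x)

/-! #### Boundary data and normal momenta -/

/-- The space `𝒴` of boundary data: smooth sections `φ : ∂U → Y` of `ρ`. -/
structure BoundaryData where
  /-- the section -/
  toFun : B → Y
  proj : ∀ s, T.ρ (toFun s) = T.ι s
  smooth : ContMDiff (𝓡 n) 𝓘(ℝ, Eu (n + 1) × Eu k) ∞ toFun

/-- The component `π_a` of `π = π_a dy^a ⊗ dS` at the boundary point `s`. -/
def momComponent (C : AdaptedChart n k T.ρ) (φ : B → Y)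
    (π : ∀ s, Vert n k T.ρ (φ s) →ₗ[ℝ] (TangentSpace (𝓡 n) s [⋀^Fin n]→L[ℝ] ℝ))
    (s : B) (a : Fin k) : ℝ :=
  formQuot (vertEval (π s) (coordVert C (φ s) a)) (T.σ.form s)

/-- The cotangent bundle `T^*𝒴`, the space of normal momenta: a boundary datum `φ` with a smooth
section `π` of `φ^*(V^*Y) ⊗ ⋀ⁿ T^*∂U`. -/
structure NormalMomenta where
  /-- the base point `φ` -/
  base : T.BoundaryData
  /-- the covector `π` -/
  mom : ∀ s, Vert n k T.ρ (base.toFun s) →ₗ[ℝ] (TangentSpace (𝓡 n) s [⋀^Fin n]→L[ℝ] ℝ)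
  smooth_mom : ∀ (C : AdaptedChart n k T.ρ) (a : Fin k) (s : B), base.toFun s ∈ C.total.source →
    ContMDiffAt (𝓡 n) 𝓘(ℝ, ℝ) ∞ (fun t => T.momComponent C base.toFun mom t a) s

/-- The duality pairing `⟨δφ, π⟩ = ∫_∂U π · δφ` of `T_φ^*𝒴` and `T_φ 𝒴`. -/
def pairing (p : T.NormalMomenta)
    (δ : ∀ s, TangentSpace 𝓘(ℝ, Eu (n + 1) × Eu k) (p.base.toFun s)) : ℝ :=
  formIntegral T.σ T.mB (fun s => vertEval (p.mom s) (δ s))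

/-- A smooth curve in `T^*𝒴`. -/
def IsSmoothCurve (γ : ℝ → T.NormalMomenta) : Prop :=
  ContMDiff (𝓘(ℝ, ℝ).prod (𝓡 n)) 𝓘(ℝ, Eu (n + 1) × Eu k) ∞
      (fun p : ℝ × B => (γ p.1).base.toFun p.2) ∧
    ∀ (C : AdaptedChart n k T.ρ) (a : Fin k) (ε : ℝ) (s : B),
      (γ ε).base.toFun s ∈ C.total.source →
      ContMDiffAt (𝓘(ℝ, ℝ).prod (𝓡 n)) 𝓘(ℝ, ℝ) ∞
        (fun p : ℝ × B => T.momComponent C (γ p.1).base.toFun (γ p.1).mom p.2 a) (ε, s)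

/-- An adapted chart around `y`. -/
def chart (y : Y) : AdaptedChart n k T.ρ := Classical.choose (T.fibred.exists_chart y)

/-- The coordinates `(φ^a, π_a)` at the boundary point `s` of a curve in `T^*𝒴`. -/
def curveCoord (γ : ℝ → T.NormalMomenta) (C : AdaptedChart n k T.ρ) (s : B) (ε : ℝ) :
    Eu k × Eu k :=
  ((C.total ((γ ε).base.toFun s)).2,
    WithLp.toLp 2 (T.momComponent C (γ ε).base.toFun (γ ε).mom s))

/-- The canonical weak symplectic form `ω = -dΘ` on `T^*𝒴`, evaluated at the velocities at
`ε = 0` of two curves `γ`, `γ'` with `γ 0 = γ' 0`. The canonical one-form is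
`Θ = ∫_∂U π_a dφ^a dS`, so `ω` is the integral over `s ∈ ∂U` of the canonical symplectic forms in
the coordinates `(φ^a(s), π_a(s))`. -/
def symplectic (γ γ' : ℝ → T.NormalMomenta) : ℝ :=
  ∫ s, canonicalSymplectic k (T.curveCoord γ (T.chart ((γ 0).base.toFun s)) s 0)
    ![deriv (T.curveCoord γ (T.chart ((γ 0).base.toFun s)) s) 0,
      deriv (T.curveCoord γ' (T.chart ((γ 0).base.toFun s)) s) 0] ∂T.mB

/-! #### The boundary Lagrangian and its differential -/

/-- `φ` is a solution of the Euler–Lagrange equations with boundary values `b`. -/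
def Solves (φ : X → Y) (b : T.BoundaryData) : Prop :=
  T.IsSolution φ ∧ ∀ s, φ (T.ι s) = b.toFun s

/-- The space `𝒦` of admissible boundary data: those with a unique solution of the
Euler–Lagrange equations. -/
def admissible : Set T.BoundaryData :=
  {b | ∃ φ, T.Solves φ b ∧ ∀ φ', T.Solves φ' b → EqOn φ' φ (closure T.U)}

open Classical in
/-- The boundary Lagrangian: the action of a solution with the given boundary values. -/
def boundaryLagrangian (b : T.BoundaryData) : ℝ :=
  if h : ∃ φ, T.Solves φ b then T.action (Classical.choose h) else 0

/-- A smooth curve in `𝒦`: the solutions depend smoothly on the parameter. -/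
def IsAdmissibleCurve (c : ℝ → T.BoundaryData) : Prop :=
  (∀ ε, c ε ∈ T.admissible) ∧
    ∃ Φ : ℝ → X → Y, T.IsSolutionFamily Φ ∧ ∀ ε, T.Solves (Φ ε) (c ε)

/-- The covector `p ∈ T_φ^*𝒴` is the differential `dL_∂U(φ)` of the boundary Lagrangian:
`dL_∂U(φ) · δφ` is the derivative of `L_∂U` along curves in `𝒦`, and more generally
`dL_∂U(φ) · δφ = dS(φ) · V` for every variation `V` of the solution `φ` with `V = δφ` on `∂U`,
which fixes the covector also on variations `δφ` that are not tangent to `𝒦`. -/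
def IsDifferential (p : T.NormalMomenta) : Prop :=
  (∀ c : ℝ → T.BoundaryData, T.IsAdmissibleCurve c → c 0 = p.base →
    HasDerivAt (fun ε => T.boundaryLagrangian (c ε))
      (T.pairing p (fun s => velocity n k (fun ε => (c ε).toFun s))) 0) ∧
  (∀ Φ : ℝ → X → Y, T.IsFieldFamily Φ → T.Solves (Φ 0) p.base →
    HasDerivAt (fun ε => T.action (Φ ε))
      (T.pairing p (fun s => velocity n k (fun ε => Φ ε (T.ι s)))) 0)

/-- `ℳ = dL_∂U(𝒦)`, a subset of `T^*𝒴`. -/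
def imageDifferential : Set T.NormalMomenta :=
  {p | p.base ∈ T.admissible ∧ T.IsDifferential p}

/-- A smooth curve in `ℳ`. -/
def IsImageCurve (γ : ℝ → T.NormalMomenta) : Prop :=
  T.IsSmoothCurve γ ∧ (∀ ε, γ ε ∈ T.imageDifferential) ∧
    T.IsAdmissibleCurve (fun ε => (γ ε).base)

/-- `ℳ` is isotropic: `ω` vanishes on any two vectors tangent to `ℳ` at the same point. -/
def IsIsotropicImage : Prop :=
  ∀ γ γ' : ℝ → T.NormalMomenta, T.IsImageCurve γ → T.IsImageCurve γ' → γ 0 = γ' 0 →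
    T.symplectic γ γ' = 0

/-! #### The multisymplectic form formula -/

/-- The `n`-form `(j¹φ)^*(i_{j¹W} i_{j¹V} Ω_L)` on `X`, at the point `x`. -/
def msForm (φ : X → Y) (V W : ∀ x, TangentSpace 𝓘(ℝ, Eu (n + 1) × Eu k) (φ x)) (x : X) :
    TangentSpace (𝓡 (n + 1)) x [⋀^Fin n]→L[ℝ] ℝ :=
  let C := T.chart (φ x)
  let z := C.base x
  ((((multisymplectic (localLagrangian T.vol T.L C) (localJet C φ z)).curryLeft
    (localProlong C φ V z)).curryLeft
    (localProlong C φ W z)).compContinuousLinearMap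
      (fderiv ℝ (localJet C φ) z)).compContinuousLinearMap
        (mfderiv (𝓡 (n + 1)) (𝓡 (n + 1)) C.base x)

/-- `∫_∂U (j¹φ)^*(i_{j¹W} i_{j¹V} Ω_L)`. -/
def msIntegral (φ : X → Y)
    (V W : ∀ x, TangentSpace 𝓘(ℝ, Eu (n + 1) × Eu k) (φ x)) : ℝ :=
  formIntegral T.σ T.mB (fun s =>
    (T.msForm φ V W (T.ι s)).compContinuousLinearMap (mfderiv (𝓡 n) (𝓡 (n + 1)) T.ι s))

/-- The multisymplectic form formula: `∫_∂U (j¹φ)^*(i_{j¹W} i_{j¹V} Ω_L) = 0` for all solutions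
`φ` of the Euler–Lagrange equations and all first variations `V`, `W` of `φ`. -/
def MultisymplecticFormFormula : Prop :=
  ∀ (φ : X → Y) (V W : ∀ x, TangentSpace 𝓘(ℝ, Eu (n + 1) × Eu k) (φ x)),
    T.IsSolution φ → T.IsFirstVariation φ V → T.IsFirstVariation φ W →
    T.msIntegral φ V W = 0

end FieldTheory

end BoundaryFields

end

open BoundaryFields

set_option linter.unusedSectionVars false

noncomputable section

namespace BoundaryFields


/-! ### The divergence theorem in a half space -/

section Divergence

variable {n : ℕ}

/-! Both sides of the equivalence are true outright, and each is proved without the other. What ties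
them together is the pullback identity: the pulled back canonical form and the multisymplectic
integral are the flux through `∂U` of one vector field, the symplectic current. Up to the density of
the volume form its components are `V^a δ_W p_a^μ - W^a δ_V p_a^μ`, where `p_a^μ = ∂ℓ/∂y^a_μ` and
`δ_V`, `δ_W` are the derivatives along the two families of solutions.

The flux vanishes. By the linearized Euler–Lagrange equations the divergence of the current is the
difference of `D²ℓ(j¹W, j¹V)` and `D²ℓ(j¹V, j¹W)`, which is zero by symmetry of the Hessian
(`divergence_symplecticCurrent`); Stokes' theorem (`HasDivergence.stokes`) then gives
`integral_current`. Stokes' theorem itself is reduced by a partition of unity to the divergence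
theorem in a half space, through charts in which `∂U` is a hyperplane.

The canonical form gives this flux. Along a solution the variation of `ℓ` is the divergence of
`p_a^μ V^a` (`divergence_momentumCurrent`), so the derivative of the action is a boundary integral
(`first_variation`). Hence the covector whose component `π_a` is the flux of the Legendre vector
(`leg`) of `∂/∂y^a` is a differential of the boundary Lagrangian (`isDifferential_legMomenta`). It
is the only one, since the differential is also tested on arbitrary variations, in particular on
bumps in one fibre coordinate near one boundary point (`IsDifferential.momComponent_eq`). The
velocity of a curve in the image is therefore `V^a` together with the flux of `δ_V p_a`, and the
canonical symplectic form of two such velocities is the flux of the current (`symplectic_eq`).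

The multisymplectic form gives the same flux. On two vertical vectors only the derivatives of the
momenta survive in `Ω_L` (`multisymplectic_apply`), so the pulled back `n`-form is the contraction
of the volume form with the current (`msForm_apply`, `msIntegral_eq`).

Two points need care beyond the coordinate computation. The current is a priori defined in a chart
chosen separately at each point. A change of fibre coordinates alters its two halves by the same
second derivative term, so the current is chart independent (`sympVec_chart`), and adapted charts
can be built over any given base chart, in particular over one straightening `∂U`
(`AdaptedChart.rebase`). Moreover, a solution is determined by its boundary data only on the closure
of `U`; its first derivatives up to the boundary are determined as well, by continuity from the
inside (`localJet_eq_of_eqOn`). -/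

/-- The inclusion of the hyperplane `z⁰ = 0`. -/
def hyperplane (y : Eu n) : Eu (n + 1) := WithLp.toLp 2 (Fin.cons (0 : ℝ) (fun j => y j))

@[simp] lemma hyperplane_zero (y : Eu n) : hyperplane y 0 = 0 := rfl

@[simp] lemma hyperplane_succ (y : Eu n) (j : Fin n) : hyperplane y j.succ = y j := rfl

/-- The divergence of a vector field on `ℝ^d`. -/
def divergence {d : ℕ} (G : Eu d → Eu d) (z : Eu d) : ℝ :=
  ∑ μ, fderiv ℝ (fun w => G w μ) z (stdVec μ)

lemma continuous_divergence {d : ℕ} {G : Eu d → Eu d} (hG : ContDiff ℝ 1 G) :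
    Continuous (divergence G) := by
  unfold divergence
  refine continuous_finsetSum _ fun μ _ => ?_
  have : ContDiff ℝ 1 (fun w => G w μ) := (contDiff_euclidean.1 hG) μ
  exact (this.continuous_fderiv (by norm_num)).clm_apply continuous_const

lemma divergence_eq_zero {d : ℕ} {G : Eu d → Eu d} {z : Eu d} (h : z ∉ tsupport G) :
    divergence G z = 0 := by
  unfold divergence
  refine Finset.sum_eq_zero fun μ _ => ?_
  have h0 : (fun w => G w μ) =ᶠ[𝓝 z] fun _ => (0 : ℝ) := by
    filter_upwards [(notMem_tsupport_iff_eventuallyEq.1 h)] with w hw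
    simp [hw]
  rw [h0.fderiv_eq]; simp

lemma hasCompactSupport_divergence {d : ℕ} {G : Eu d → Eu d} (hc : HasCompactSupport G) :
    HasCompactSupport (divergence G) :=
  hc.of_isClosed_subset (isClosed_tsupport _)
    (closure_minimal (fun z hz => by
      by_contra h; exact hz (divergence_eq_zero h)) (isClosed_tsupport _))

/-- The divergence theorem in a box containing the support of the vector field, except for
the face in direction `0`. -/
lemma integral_box_divergence {G : Eu (n + 1) → Eu (n + 1)} (hG : ContDiff ℝ 1 G) {R c : ℝ}
    (hR : ∀ z, G z ≠ 0 → ∀ i, |z i| < R) (hc : -R ≤ c) (hcR : c ≤ R) :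
    ∫ x in {x : Fin (n + 1) → ℝ | x 0 ≤ c}, divergence G (WithLp.toLp 2 x)
      = ∫ y : Fin n → ℝ, G (WithLp.toLp 2 (Fin.cons c y : Fin (n + 1) → ℝ)) 0 := by
  have hR0 : 0 ≤ R := by linarith
  set a : Fin (n + 1) → ℝ := fun _ => -R with ha
  -- Only the upper face in direction `0` may meet the support: `c = 0` yields the half space, and
  -- `c = R` the whole space.
  set b : Fin (n + 1) → ℝ := Fin.cons c (fun _ => R) with hb
  have hle : a ≤ b := by
    intro i; refine Fin.cases ?_ (fun j => ?_) i <;> simp [ha, hb] <;> linarith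
  have hz : ∀ z : Eu (n + 1), (∃ i, R ≤ |z i|) → G z = 0 := by
    rintro z ⟨i, hi⟩
    by_contra h
    exact absurd (hR z h i) (not_lt.2 hi)
  let tl : (Fin (n + 1) → ℝ) →L[ℝ] Eu (n + 1) :=
    (EuclideanSpace.equiv (Fin (n + 1)) ℝ).symm.toContinuousLinearMap
  have htl : ∀ x, tl x = WithLp.toLp 2 x := fun x => rfl
  have hsing : ∀ μ : Fin (n + 1), tl (Pi.single μ 1) = stdVec μ := by
    intro μ; rw [htl]; ext i; simp [stdVec, Pi.single_apply]
  have hGd : ∀ μ x, DifferentiableAt ℝ (fun w => G w μ) x := fun μ x =>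
    (((contDiff_euclidean.1 hG) μ).differentiable (by norm_num)) x
  have key := integral_divergence_of_hasFDerivAt_off_countable' a b hle
    (fun μ x => G (tl x) μ)
    (fun μ x => (fderiv ℝ (fun w => G w μ) (tl x)).comp tl) ∅ countable_empty
    (fun i => ((contDiff_euclidean.1 hG i).continuous.comp tl.continuous).continuousOn)
    (fun x _ μ => (hGd μ (tl x)).hasFDerivAt.comp x tl.hasFDerivAt)
    (by
      refine Continuous.integrableOn_Icc ?_
      refine continuous_finsetSum _ fun μ _ => ?_
      have := ((contDiff_euclidean.1 hG μ).continuous_fderiv (by norm_num)).comp tl.continuous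
      exact (this.clm_comp continuous_const).clm_apply continuous_const)
  have hdiv : ∀ x, (∑ i, ((fderiv ℝ (fun w => G w i) (tl x)).comp tl) (Pi.single i 1))
      = divergence G (WithLp.toLp 2 x) := by
    intro x
    simp only [ContinuousLinearMap.comp_apply, hsing, divergence, htl]
  simp only [hdiv] at key
  -- The inequality is strict here: the closure of the support may touch the faces of the cube.
  have hts : ∀ z, (∃ i, R < |z i|) → z ∉ tsupport G := by
    rintro z ⟨i, hi⟩ hmem
    have hcl : IsClosed {z : Eu (n + 1) | |z i| ≤ R} :=
      isClosed_le ((EuclideanSpace.proj i).continuous.abs) continuous_const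
    have : tsupport G ⊆ {z : Eu (n + 1) | |z i| ≤ R} :=
      closure_minimal (fun w hw => (hR w hw i).le) hcl
    exact absurd (this hmem) (not_le.2 hi)
  have hset : ∫ x in {x : Fin (n + 1) → ℝ | x 0 ≤ c}, divergence G (WithLp.toLp 2 x)
      = ∫ x in Icc a b, divergence G (WithLp.toLp 2 x) := by
    refine setIntegral_eq_of_subset_of_forall_sdiff_eq_zero
      (measurableSet_le (measurable_pi_apply 0) measurable_const) ?_ ?_
    · intro x hx; have := hx.2 0; simpa [hb] using this
    · rintro x ⟨hx, hx'⟩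
      refine divergence_eq_zero (hts _ ?_)
      by_contra hcon
      push Not at hcon
      refine hx' ⟨fun i => (abs_le.1 (hcon i)).1, fun i => ?_⟩
      refine Fin.cases ?_ (fun j => ?_) i
      · simpa [hb] using hx
      · simpa [hb] using (abs_le.1 (hcon j.succ)).2
  rw [hset, key, Fin.sum_univ_succ]
  have hback : ∀ i : Fin (n + 1), ∀ y : Fin n → ℝ, G (tl (i.insertNth (a i) y)) = 0 := by
    intro i y
    refine hz _ ⟨i, ?_⟩
    rw [htl]; simp [ha, abs_of_nonneg hR0]
  have hfront : ∀ j : Fin n, ∀ y : Fin n → ℝ, G (tl (j.succ.insertNth (b j.succ) y)) = 0 := by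
    intro j y
    refine hz _ ⟨j.succ, ?_⟩
    rw [htl]; simp [hb, abs_of_nonneg hR0]
  simp only [hback, hfront]
  simp only [PiLp.zero_apply, integral_zero, sub_zero, Finset.sum_const_zero, add_zero]
  rw [setIntegral_eq_integral_of_forall_compl_eq_zero]
  · simp [htl, hb]
  · intro y hy
    rw [hz, PiLp.zero_apply]
    by_contra hcon
    push Not at hcon
    refine hy ⟨fun i => ?_, fun i => ?_⟩
    · have := (abs_lt.1 (hcon i.succ)).1
      simp [htl] at this
      simpa [ha] using this.le
    · have := (abs_lt.1 (hcon i.succ)).2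
      simp [htl] at this
      simpa [hb] using this.le

lemma exists_box {d : ℕ} {G : Eu d → Eu d} (hc : HasCompactSupport G) :
    ∃ R : ℝ, 0 ≤ R ∧ ∀ z, G z ≠ 0 → ∀ i, |z i| < R := by
  obtain ⟨R, hR⟩ := hc.isCompact.isBounded.exists_norm_le
  refine ⟨max R 0 + 1, by positivity, fun z hz i => ?_⟩
  have h1 : ‖z‖ ≤ R := hR z (subset_tsupport _ hz)
  have h2 : |z i| ≤ ‖z‖ := by simpa using PiLp.norm_apply_le z i
  have := le_max_left R 0
  linarith

lemma integral_toLp {d : ℕ} (g : Eu d → ℝ) :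
    ∫ x : Fin d → ℝ, g (WithLp.toLp 2 x) = ∫ z, g z :=
  (EuclideanSpace.volume_preserving_symm_measurableEquiv_toLp (Fin d)).symm.integral_comp' g

/-- The divergence theorem in the half space `z⁰ < 0`. -/
theorem integral_halfSpace_divergence {G : Eu (n + 1) → Eu (n + 1)} (hG : ContDiff ℝ 1 G)
    (hc : HasCompactSupport G) :
    ∫ z in {z : Eu (n + 1) | z 0 < 0}, divergence G z = ∫ y : Eu n, G (hyperplane y) 0 := by
  obtain ⟨R, hR0, hR⟩ := exists_box hc
  have h1 := integral_box_divergence hG hR (c := 0) (by linarith) hR0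
  have hm : MeasurableSet {x : Fin (n + 1) → ℝ | x 0 < 0} :=
    measurableSet_lt (measurable_pi_apply 0) measurable_const
  have hm' : MeasurableSet {z : Eu (n + 1) | z 0 < 0} :=
    (isOpen_lt (EuclideanSpace.proj (0 : Fin (n + 1))).continuous continuous_const).measurableSet
  have h2 : ∫ y : Eu n, G (hyperplane y) 0
      = ∫ y : Fin n → ℝ, G (WithLp.toLp 2 (Fin.cons 0 y : Fin (n + 1) → ℝ)) 0 := by
    rw [← integral_toLp]; rfl
  rw [h2, ← h1, ← integral_indicator hm', ← integral_toLp]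
  -- The open and the closed half space differ by a hyperplane, a null set.
  have hae : {x : Fin (n + 1) → ℝ | x 0 ≤ 0} =ᵐ[volume] {x : Fin (n + 1) → ℝ | x 0 < 0} := by
    have hn : volume {x : Fin (n + 1) → ℝ | x 0 = 0} = 0 := by
      rw [volume_pi]; exact Measure.pi_hyperplane (fun _ => volume) 0 0
    have : ∀ᵐ x : Fin (n + 1) → ℝ, x 0 ≠ 0 := by
      rw [ae_iff]; simpa using hn
    filter_upwards [this] with x hx
    apply propext
    exact ⟨fun h => lt_of_le_of_ne h hx, fun h => le_of_lt h⟩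
  rw [setIntegral_congr_set hae, ← integral_indicator hm]
  rfl

/-- The divergence of a compactly supported vector field has integral zero. -/
theorem integral_divergence {G : Eu (n + 1) → Eu (n + 1)} (hG : ContDiff ℝ 1 G)
    (hc : HasCompactSupport G) : ∫ z, divergence G z = 0 := by
  obtain ⟨R, hR0, hR⟩ := exists_box hc
  -- With `c = R` the remaining face also lies outside the support.
  have h1 := integral_box_divergence hG hR (c := R) (by linarith) le_rfl
  have h2 : ∀ y : Fin n → ℝ, G (WithLp.toLp 2 (Fin.cons R y : Fin (n + 1) → ℝ)) = 0 := by
    intro y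
    by_contra h
    have := hR _ h 0
    simp at this
    exact absurd (le_abs_self R) (not_le.2 this)
  simp only [h2, PiLp.zero_apply, integral_zero] at h1
  rw [← integral_toLp, ← h1]
  symm
  refine setIntegral_eq_integral_of_forall_compl_eq_zero fun x hx => divergence_eq_zero ?_
  intro hmem
  have hcl : IsClosed {z : Eu (n + 1) | |z 0| ≤ R} :=
    isClosed_le ((EuclideanSpace.proj (0 : Fin (n + 1))).continuous.abs) continuous_const
  have : tsupport G ⊆ {z : Eu (n + 1) | |z 0| ≤ R} :=
    closure_minimal (fun w hw => (hR w hw 0).le) hcl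
  exact hx (show x 0 ≤ R from (abs_le.1 (show |x 0| ≤ R from this hmem)).2)

end Divergence


/-! ### Variations of jets in coordinates -/

section Calculus

variable {E F : Type*} [NormedAddCommGroup E] [NormedSpace ℝ E]
  [NormedAddCommGroup F] [NormedSpace ℝ F]

lemma fderiv_slice_right {u : ℝ × E → F} {ε : ℝ} {w : E} (h : DifferentiableAt ℝ u (ε, w)) (v : E) :
    fderiv ℝ (fun w' => u (ε, w')) w v = fderiv ℝ u (ε, w) (0, v) := by
  have h1 : HasFDerivAt (fun w' : E => ((ε, w') : ℝ × E)) (ContinuousLinearMap.inr ℝ ℝ E) w :=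
    hasFDerivAt_prodMk_right ε w
  have h2 := (HasFDerivAt.comp w h.hasFDerivAt h1).fderiv
  rw [show (fun w' => u (ε, w')) = u ∘ fun w' => (ε, w') from rfl, h2]
  simp

lemma hasDerivAt_slice_left {u : ℝ × E → F} {ε : ℝ} {w : E} (h : DifferentiableAt ℝ u (ε, w)) :
    HasDerivAt (fun e => u (e, w)) (fderiv ℝ u (ε, w) (1, 0)) ε := by
  have h1 : HasFDerivAt (fun e : ℝ => ((e, w) : ℝ × E)) (ContinuousLinearMap.inl ℝ ℝ E) ε :=
    hasFDerivAt_prodMk_left ε w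
  have h2 := (HasFDerivAt.comp ε h.hasFDerivAt h1).hasDerivAt
  rw [show (fun e => u (e, w)) = u ∘ fun e => (e, w) from rfl]
  simpa using h2

/-- Mixed partial derivatives commute. -/
lemma fderiv_deriv_comm {u : ℝ × E → F} {ε : ℝ} {w : E} (h : ContDiffAt ℝ 2 u (ε, w)) (v : E) :
    fderiv ℝ (fun w' => deriv (fun e => u (e, w')) ε) w v
      = deriv (fun e => fderiv ℝ (fun w' => u (e, w')) w v) ε := by
  have hd : ∀ᶠ p in 𝓝 (ε, w), DifferentiableAt ℝ u p :=
    (h.eventually (by norm_num)).mono fun p hp => hp.differentiableAt (by norm_num)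
  have h1 : DifferentiableAt ℝ (fderiv ℝ u) (ε, w) :=
    (h.fderiv_right (m := 1) (by norm_num)).differentiableAt (by norm_num)
  have e1 : (fun w' => deriv (fun e => u (e, w')) ε)
      =ᶠ[𝓝 w] fun w' => (fun p => fderiv ℝ u p (1, 0)) (ε, w') := by
    have : Tendsto (fun w' : E => (ε, w')) (𝓝 w) (𝓝 (ε, w)) :=
      (Continuous.prodMk_right ε).tendsto w
    filter_upwards [this.eventually hd] with w' hw'
    exact (hasDerivAt_slice_left hw').deriv
  have e2 : (fun e => fderiv ℝ (fun w' => u (e, w')) w v)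
      =ᶠ[𝓝 ε] fun e => (fun p => fderiv ℝ u p (0, v)) (e, w) := by
    have : Tendsto (fun e : ℝ => (e, w)) (𝓝 ε) (𝓝 (ε, w)) :=
      (Continuous.prodMk_left w).tendsto ε
    filter_upwards [this.eventually hd] with e he
    exact fderiv_slice_right he v
  -- Both iterated partial derivatives are values of the second derivative of `u` on `(1, 0)` and
  -- `(0, v)`, in the two orders.
  have hc : ∀ q : ℝ × E, HasFDerivAt (fun p => fderiv ℝ u p q)
      ((fderiv ℝ (fderiv ℝ u) (ε, w)).flip q) (ε, w) := fun q => by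
    simpa using h1.hasFDerivAt.clm_apply (hasFDerivAt_const q (ε, w))
  rw [e1.fderiv_eq, e2.deriv_eq, fderiv_slice_right (hc _).differentiableAt,
    (hasDerivAt_slice_left (hc _).differentiableAt).deriv, (hc _).fderiv, (hc _).fderiv]
  simp only [ContinuousLinearMap.flip_apply]
  exact (h.isSymmSndFDerivAt (by simp)).eq _ _

lemma clm_smul_zero (c : ℝ) : c • (0 : E →L[ℝ] F) = 0 := smul_zero c

lemma hasDerivAt_fderiv_curve {ℓ : E → F} {c : ℝ → E} {c' : E} {t : ℝ}
    (hℓ : ContDiffAt ℝ 2 ℓ (c t)) (hc : HasDerivAt c c' t) (q : E) :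
    HasDerivAt (fun e => fderiv ℝ ℓ (c e) q) (fderiv ℝ (fderiv ℝ ℓ) (c t) c' q) t := by
  have h1 : DifferentiableAt ℝ (fderiv ℝ ℓ) (c t) :=
    (hℓ.fderiv_right (m := 1) (by norm_num)).differentiableAt (by norm_num)
  have := (h1.hasFDerivAt.comp_hasDerivAt t hc).clm_apply (hasDerivAt_const t q)
  simpa using this

end Calculus

/-! ### First variation and conservation of the symplectic current in coordinates -/

section Variations

variable {n k : ℕ}

/-- The jets of a one-parameter family of local fields. -/
def familyJet (u : ℝ × Eu (n + 1) → Eu k) (p : ℝ × Eu (n + 1)) : JetCoord n k :=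
  (p.2, u p, fderiv ℝ (fun w => u (p.1, w)) p.2)

/-- The velocity at parameter `0` of a one-parameter family of local fields. -/
def familyVelocity (u : ℝ × Eu (n + 1) → Eu k) (w : Eu (n + 1)) : Eu k :=
  deriv (fun e => u (e, w)) 0

/-- The velocity of a family of jets: the prolongation of the velocity of the fields. -/
def familyProlong (u : ℝ × Eu (n + 1) → Eu k) (w : Eu (n + 1)) : JetCoord n k :=
  (0, familyVelocity u w, fderiv ℝ (familyVelocity u) w)

/-- One order of smoothness is lost to the derivative in the base direction, which depends on the
parameter and the point jointly. -/
lemma contDiffAt_familyJet {u : ℝ × Eu (n + 1) → Eu k} {p : ℝ × Eu (n + 1)} {r : ℕ∞ω}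
    (h : ContDiffAt ℝ (r + 1) u p) : ContDiffAt ℝ r (familyJet u) p := by
  unfold familyJet
  refine contDiffAt_snd.prodMk ((h.of_le le_self_add).prodMk ?_)
  refine ContDiffAt.fderiv (n := r + 1) (f := fun (q : ℝ × Eu (n + 1)) w => u (q.1, w))
    (g := Prod.snd) ?_ contDiffAt_snd le_rfl
  exact ContDiffAt.comp (p, p.2) (g := u) (f := fun q : (ℝ × Eu (n + 1)) × Eu (n + 1) => (q.1.1, q.2))
    h ((contDiff_fst.comp contDiff_fst).prodMk contDiff_snd).contDiffAt

lemma contDiffAt_familyVelocity {u : ℝ × Eu (n + 1) → Eu k} {z : Eu (n + 1)} {r : ℕ∞ω}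
    (h : ContDiffAt ℝ (r + 1) u (0, z)) : ContDiffAt ℝ r (familyVelocity u) z := by
  unfold familyVelocity
  have := ContDiffAt.fderiv (n := r + 1) (m := r) (x₀ := z) (f := fun (w : Eu (n + 1)) (e : ℝ) => u (e, w))
    (g := fun _ => (0 : ℝ)) (ContDiffAt.comp (z, (0 : ℝ)) (g := u)
      (f := fun q : Eu (n + 1) × ℝ => (q.2, q.1)) h (contDiff_snd.prodMk contDiff_fst).contDiffAt)
      contDiffAt_const le_rfl
  exact this.clm_apply contDiffAt_const

/-- The last component is the content: by `fderiv_deriv_comm` the velocity of the first derivatives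
is the first derivative of the velocity. This identifies tangents of families of jets with
prolongations. -/
lemma hasDerivAt_familyJet {u : ℝ × Eu (n + 1) → Eu k} {z : Eu (n + 1)}
    (h : ContDiffAt ℝ 2 u (0, z)) :
    HasDerivAt (fun e => familyJet u (e, z)) (familyProlong u z) 0 := by
  have h1 : HasDerivAt (fun e => u (e, z)) (familyVelocity u z) 0 :=
    (hasDerivAt_slice_left (h.differentiableAt (by norm_num))).differentiableAt.hasDerivAt
  have hJ : ContDiffAt ℝ 1 (familyJet u) (0, z) :=
    contDiffAt_familyJet (r := 1) (by simpa [one_add_one_eq_two] using h)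
  have h2 : HasDerivAt (fun e => fderiv ℝ (fun w => u (e, w)) z)
      (fderiv ℝ (familyVelocity u) z) 0 := by
    have hd : DifferentiableAt ℝ (fun e => fderiv ℝ (fun w => u (e, w)) z) 0 :=
      ((hasDerivAt_slice_left (hJ.differentiableAt (by norm_num))).differentiableAt).snd.snd
    have : deriv (fun e => fderiv ℝ (fun w => u (e, w)) z) 0 = fderiv ℝ (familyVelocity u) z := by
      ext1 v
      unfold familyVelocity
      rw [fderiv_deriv_comm h v]
      have := hd.hasDerivAt.clm_apply (hasDerivAt_const (0 : ℝ) v)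
      simpa using this.deriv.symm
    rw [← this]; exact hd.hasDerivAt
  exact (hasDerivAt_const (0 : ℝ) z).prodMk (h1.prodMk h2)

lemma eu_sum {d : ℕ} (v : Eu d) : v = ∑ i, v i • (stdVec i : Eu d) := by
  ext j; simp [stdVec, Pi.single_apply]

/-- The elementary matrix `dx^μ ⊗ ∂/∂y^a`. -/
def elem (μ : Fin (n + 1)) (a : Fin k) : Eu (n + 1) →L[ℝ] Eu k :=
  (EuclideanSpace.proj μ : Eu (n + 1) →L[ℝ] ℝ).smulRight (stdVec a : Eu k)

lemma clm_sum (A : Eu (n + 1) →L[ℝ] Eu k) :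
    A = ∑ μ, ∑ a, A (stdVec μ) a • elem μ a := by
  ext1 v
  conv_lhs => rw [eu_sum v, map_sum]
  simp only [_root_.sum_apply, _root_.smul_apply, elem,
    ContinuousLinearMap.smulRight_apply, map_smul]
  refine Finset.sum_congr rfl fun μ _ => ?_
  conv_lhs => rw [eu_sum (A (stdVec μ)), Finset.smul_sum]
  refine Finset.sum_congr rfl fun a _ => ?_
  rw [smul_comm]; rfl

lemma momentum_def (ℓ : JetCoord n k → ℝ) (q : JetCoord n k) (μ : Fin (n + 1)) (a : Fin k) :
    momentum ℓ q μ a = fderiv ℝ ℓ q (0, 0, elem μ a) := rfl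

/-- For `f` the differential of `ℓ`, the two sums carry `∂ℓ/∂y^a` and the momenta; this is how the
two terms of the Euler–Lagrange equations arise. -/
lemma vertical_expand (f : JetCoord n k →L[ℝ] ℝ) (v : Eu k) (A : Eu (n + 1) →L[ℝ] Eu k) :
    f (0, v, A) = ∑ a, v a * f (0, stdVec a, 0)
      + ∑ μ, ∑ a, A (stdVec μ) a * f (0, 0, elem μ a) := by
  -- Opaque names for the coefficients keep them untouched while `v` and `A` are replaced by sums.
  obtain ⟨c, hc⟩ : ∃ c : Fin k → ℝ, ∀ a, c a = v a := ⟨fun a => v a, fun _ => rfl⟩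
  obtain ⟨d, hd⟩ : ∃ d : Fin (n + 1) → Fin k → ℝ, ∀ μ a, d μ a = A (stdVec μ) a :=
    ⟨fun μ a => A (stdVec μ) a, fun _ _ => rfl⟩
  have hv : v = ∑ a, c a • (stdVec a : Eu k) := by simp only [hc]; exact eu_sum v
  have hA : A = ∑ μ, ∑ a, d μ a • elem μ a := by simp only [hd]; exact clm_sum A
  have h : ((0, v, A) : JetCoord n k)
      = ∑ a, c a • ((0, stdVec a, 0) : JetCoord n k)
        + ∑ μ, ∑ a, d μ a • ((0, 0, elem μ a) : JetCoord n k) := by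
    refine Prod.ext ?_ (Prod.ext ?_ ?_)
    · simp [Prod.fst_sum]
    · simp [Prod.fst_sum, Prod.snd_sum, ← hv]
    · simp [Prod.snd_sum, ← hA]
      exact Finset.sum_eq_zero fun a _ => clm_smul_zero _
  rw [h, map_add, map_sum, map_sum]
  simp only [map_sum, map_smul, smul_eq_mul, hc, hd]

lemma contDiffAt_momentum {ℓ : JetCoord n k → ℝ} {q : JetCoord n k} {r : ℕ∞ω}
    (h : ContDiffAt ℝ (r + 1) ℓ q) (μ : Fin (n + 1)) (a : Fin k) :
    ContDiffAt ℝ r (fun q => momentum ℓ q μ a) q :=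
  (h.fderiv_right (m := r) le_rfl).clm_apply contDiffAt_const

/-- The current `p_a^μ V^a`. -/
def momentumCurrent (ℓ : JetCoord n k → ℝ) (u : ℝ × Eu (n + 1) → Eu k) (w : Eu (n + 1)) :
    Eu (n + 1) :=
  WithLp.toLp 2 fun μ => ∑ a, momentum ℓ (familyJet u (0, w)) μ a * familyVelocity u w a

/-- First variation: along a solution, the variation of the Lagrangian is a divergence. -/
lemma divergence_momentumCurrent {ℓ : JetCoord n k → ℝ} {u : ℝ × Eu (n + 1) → Eu k}
    {z : Eu (n + 1)} (hu : ContDiffAt ℝ 2 u (0, z)) (hℓ : ContDiffAt ℝ 2 ℓ (familyJet u (0, z)))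
    (hEL : EulerLagrangeAt ℓ (fun w => familyJet u (0, w)) z) :
    divergence (momentumCurrent ℓ u) z = deriv (fun e => ℓ (familyJet u (e, z))) 0 := by
  have hJ : ContDiffAt ℝ 1 (familyJet u) (0, z) :=
    contDiffAt_familyJet (r := 1) (by simpa [one_add_one_eq_two] using hu)
  have hV : ContDiffAt ℝ 1 (familyVelocity u) z :=
    contDiffAt_familyVelocity (r := 1) (by simpa [one_add_one_eq_two] using hu)
  have hVd : DifferentiableAt ℝ (familyVelocity u) z := hV.differentiableAt (by norm_num)
  have hp : ∀ μ a, DifferentiableAt ℝ (fun w => momentum ℓ (familyJet u (0, w)) μ a) z := by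
    intro μ a
    have h1 : ContDiffAt ℝ 1 (fun q => momentum ℓ q μ a) (familyJet u (0, z)) :=
      contDiffAt_momentum (r := 1) (by simpa [one_add_one_eq_two] using hℓ) μ a
    have h2 : DifferentiableAt ℝ (fun w => familyJet u (0, w)) z :=
      (hJ.differentiableAt (by norm_num)).comp z
        ((differentiableAt_const (0 : ℝ)).prodMk differentiableAt_id)
    exact (h1.differentiableAt (by norm_num)).comp z h2
  have hVa : ∀ a v, fderiv ℝ (fun w => familyVelocity u w a) z v
      = fderiv ℝ (familyVelocity u) z v a := by
    intro a v
    have := ((EuclideanSpace.proj a : Eu k →L[ℝ] ℝ).hasFDerivAt.comp z hVd.hasFDerivAt).fderiv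
    exact congrArg (fun f => f v) this
  have hVad : ∀ a, DifferentiableAt ℝ (fun w => familyVelocity u w a) z := fun a =>
    ((EuclideanSpace.proj a : Eu k →L[ℝ] ℝ).differentiableAt).comp z hVd
  have hR : deriv (fun e => ℓ (familyJet u (e, z))) 0
      = fderiv ℝ ℓ (familyJet u (0, z)) (familyProlong u z) :=
    ((hℓ.differentiableAt (by norm_num)).hasFDerivAt.comp_hasDerivAt (0 : ℝ)
      (hasDerivAt_familyJet hu)).deriv
  rw [hR, familyProlong, vertical_expand]
  have hsum : ∀ μ, fderiv ℝ (fun w => momentumCurrent ℓ u w μ) z (stdVec μ)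
      = ∑ a, (familyVelocity u z a
          * fderiv ℝ (fun w => momentum ℓ (familyJet u (0, w)) μ a) z (stdVec μ)
        + fderiv ℝ (familyVelocity u) z (stdVec μ) a * momentum ℓ (familyJet u (0, z)) μ a) := by
    intro μ
    have : HasFDerivAt (fun w => momentumCurrent ℓ u w μ) _ z :=
      HasFDerivAt.fun_sum (u := Finset.univ) fun a _ => (hp μ a).hasFDerivAt.mul (hVad a).hasFDerivAt
    rw [this.fderiv]
    simp only [_root_.sum_apply, _root_.add_apply,
      _root_.smul_apply, smul_eq_mul, hVa]
    refine Finset.sum_congr rfl fun a _ => by ring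
  unfold divergence
  simp only [hsum, Finset.sum_add_distrib, ← momentum_def]
  -- The terms with a derivative of `V^a` are the same on both sides; the others are the
  -- Euler–Lagrange equations contracted with `V^a`.
  congr 1
  rw [Finset.sum_comm]
  refine Finset.sum_congr rfl fun a _ => ?_
  rw [← Finset.mul_sum, sub_eq_zero.1 (hEL a)]

/-- The current `V^a δ_W p_a^μ - W^a δ_V p_a^μ` of two families. -/
def symplecticCurrent (ℓ : JetCoord n k → ℝ) (u u' : ℝ × Eu (n + 1) → Eu k) (w : Eu (n + 1)) :
    Eu (n + 1) :=
  WithLp.toLp 2 fun μ => ∑ a,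
    (familyVelocity u w a * deriv (fun e => momentum ℓ (familyJet u' (e, w)) μ a) 0
      - familyVelocity u' w a * deriv (fun e => momentum ℓ (familyJet u (e, w)) μ a) 0)

lemma hasDerivAt_fderiv_apply {ℓ : JetCoord n k → ℝ} {u : ℝ × Eu (n + 1) → Eu k}
    {z : Eu (n + 1)} (hu : ContDiffAt ℝ 2 u (0, z)) (hℓ : ContDiffAt ℝ 2 ℓ (familyJet u (0, z)))
    (q : JetCoord n k) :
    HasDerivAt (fun e => fderiv ℝ ℓ (familyJet u (e, z)) q)
      (fderiv ℝ (fderiv ℝ ℓ) (familyJet u (0, z)) (familyProlong u z) q) 0 := by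
  exact hasDerivAt_fderiv_curve hℓ (hasDerivAt_familyJet hu) q

lemma contDiffAt_momentum_familyJet {ℓ : JetCoord n k → ℝ} {u : ℝ × Eu (n + 1) → Eu k}
    {p : ℝ × Eu (n + 1)} {r : ℕ∞ω} (hu : ContDiffAt ℝ (r + 1) u p)
    (hℓ : ContDiffAt ℝ (r + 1) ℓ (familyJet u p)) (μ : Fin (n + 1)) (a : Fin k) :
    ContDiffAt ℝ r (fun p => momentum ℓ (familyJet u p) μ a) p :=
  (contDiffAt_momentum hℓ μ a).comp p (contDiffAt_familyJet hu)

/-- The linearized Euler–Lagrange equations. -/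
lemma linearized_eulerLagrange {ℓ : JetCoord n k → ℝ} {u : ℝ × Eu (n + 1) → Eu k}
    {z : Eu (n + 1)} (hu : ContDiffAt ℝ 3 u (0, z)) (hℓ : ContDiffAt ℝ 3 ℓ (familyJet u (0, z)))
    (hEL : ∀ᶠ e in 𝓝 (0 : ℝ), EulerLagrangeAt ℓ (fun w => familyJet u (e, w)) z) (a : Fin k) :
    ∑ μ, fderiv ℝ (fun w => deriv (fun e => momentum ℓ (familyJet u (e, w)) μ a) 0) z (stdVec μ)
      = fderiv ℝ (fderiv ℝ ℓ) (familyJet u (0, z)) (familyProlong u z) (0, stdVec a, 0) := by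
  have h23 : (2 : ℕ∞ω) + 1 = 3 := by norm_num
  have hP : ∀ μ, ContDiffAt ℝ 2 (fun p => momentum ℓ (familyJet u p) μ a) (0, z) := fun μ =>
    contDiffAt_momentum_familyJet (r := 2) (by rwa [h23]) (by rwa [h23]) μ a
  have hd : ∀ μ, DifferentiableAt ℝ
      (fun e => fderiv ℝ (fun w => momentum ℓ (familyJet u (e, w)) μ a) z (stdVec μ)) 0 := by
    intro μ
    have h1 := ((hP μ).fderiv_right (m := 1) (by norm_num)).differentiableAt (by norm_num)
    have h2 : DifferentiableAt ℝ (fun e : ℝ => fderiv ℝ (fun p => momentum ℓ (familyJet u p) μ a)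
        (e, z) (0, stdVec μ)) 0 :=
      ((hasDerivAt_slice_left h1).differentiableAt).clm_apply (differentiableAt_const _)
    refine h2.congr_of_eventuallyEq ?_
    have ht : Tendsto (fun e : ℝ => (e, z)) (𝓝 0) (𝓝 (0, z)) :=
      (Continuous.prodMk_left z).tendsto 0
    filter_upwards [ht.eventually ((hP μ).eventually (by norm_num))] with e he
    exact fderiv_slice_right (u := fun p => momentum ℓ (familyJet u p) μ a)
      (he.differentiableAt (by norm_num)) _
  have hcomm : ∀ μ,
      fderiv ℝ (fun w => deriv (fun e => momentum ℓ (familyJet u (e, w)) μ a) 0) z (stdVec μ)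
      = deriv (fun e => fderiv ℝ (fun w => momentum ℓ (familyJet u (e, w)) μ a) z (stdVec μ)) 0 :=
    fun μ => fderiv_deriv_comm (hP μ) _
  simp only [hcomm]
  rw [← deriv_fun_sum fun μ _ => hd μ]
  -- The Euler–Lagrange equations hold for all parameters near `0`, so they may be differentiated in
  -- the parameter.
  have : (fun e => ∑ μ, fderiv ℝ (fun w => momentum ℓ (familyJet u (e, w)) μ a) z (stdVec μ))
      =ᶠ[𝓝 0] fun e => fderiv ℝ ℓ (familyJet u (e, z)) (0, stdVec a, 0) := by
    filter_upwards [hEL] with e he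
    exact sub_eq_zero.1 (he a)
  rw [this.deriv_eq]
  exact (hasDerivAt_fderiv_apply (hu.of_le (by norm_num)) (hℓ.of_le (by norm_num)) _).deriv

lemma contDiffAt_deriv_momentum {ℓ : JetCoord n k → ℝ} {u : ℝ × Eu (n + 1) → Eu k}
    {z : Eu (n + 1)} (hu : ContDiffAt ℝ 3 u (0, z)) (hℓ : ContDiffAt ℝ 3 ℓ (familyJet u (0, z)))
    (μ : Fin (n + 1)) (a : Fin k) :
    ContDiffAt ℝ 1 (fun w => deriv (fun e => momentum ℓ (familyJet u (e, w)) μ a) 0) z := by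
  have h23 : (2 : ℕ∞ω) + 1 = 3 := by norm_num
  have hP : ContDiffAt ℝ 2 (fun p => momentum ℓ (familyJet u p) μ a) (0, z) :=
    contDiffAt_momentum_familyJet (r := 2) (by rwa [h23]) (by rwa [h23]) μ a
  have := ContDiffAt.fderiv (n := 2) (m := 1) (x₀ := z)
    (f := fun (w : Eu (n + 1)) (e : ℝ) => momentum ℓ (familyJet u (e, w)) μ a)
    (g := fun _ => (0 : ℝ)) (ContDiffAt.comp (z, (0 : ℝ))
      (g := fun p => momentum ℓ (familyJet u p) μ a)
      (f := fun q : Eu (n + 1) × ℝ => (q.2, q.1)) hP (contDiff_snd.prodMk contDiff_fst).contDiffAt)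
      contDiffAt_const (by norm_num)
  exact this.clm_apply contDiffAt_const

lemma familyJet_congr {u u' : ℝ × Eu (n + 1) → Eu k} {ε : ℝ} {z : Eu (n + 1)}
    (h : ∀ᶠ w in 𝓝 z, u (ε, w) = u' (ε, w)) : familyJet u (ε, z) = familyJet u' (ε, z) := by
  unfold familyJet
  refine Prod.ext rfl (Prod.ext h.self_of_nhds ?_)
  exact Filter.EventuallyEq.fderiv_eq h

lemma contDiffAt_symplecticCurrent {ℓ : JetCoord n k → ℝ} {u u' : ℝ × Eu (n + 1) → Eu k}
    {z : Eu (n + 1)} (hu : ContDiffAt ℝ 3 u (0, z)) (hu' : ContDiffAt ℝ 3 u' (0, z))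
    (hℓ : ContDiffAt ℝ 3 ℓ (familyJet u (0, z))) (hℓ' : ContDiffAt ℝ 3 ℓ (familyJet u' (0, z))) :
    ContDiffAt ℝ 1 (symplecticCurrent ℓ u u') z := by
  have hV : ∀ {v : ℝ × Eu (n + 1) → Eu k}, ContDiffAt ℝ 3 v (0, z) → ∀ a,
      ContDiffAt ℝ 1 (fun w => familyVelocity v w a) z := fun hv a =>
    (EuclideanSpace.proj a : Eu k →L[ℝ] ℝ).contDiff.contDiffAt.comp z
      (contDiffAt_familyVelocity (r := 1) (hv.of_le (by norm_num)))
  refine contDiffAt_euclidean.2 fun μ => ?_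
  exact ContDiffAt.sum (s := Finset.univ) fun a _ => ((hV hu a).mul (contDiffAt_deriv_momentum hu' hℓ' μ a)).sub
    ((hV hu' a).mul (contDiffAt_deriv_momentum hu hℓ μ a))

/-- Conservation of the symplectic current of two first variations. -/
lemma divergence_symplecticCurrent {ℓ : JetCoord n k → ℝ} {u u' : ℝ × Eu (n + 1) → Eu k}
    {z : Eu (n + 1)} (hu : ContDiffAt ℝ 3 u (0, z)) (hu' : ContDiffAt ℝ 3 u' (0, z))
    (h0 : ∀ᶠ w in 𝓝 z, u (0, w) = u' (0, w))
    (hℓ : ContDiffAt ℝ 3 ℓ (familyJet u (0, z)))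
    (hEL : ∀ᶠ e in 𝓝 (0 : ℝ), EulerLagrangeAt ℓ (fun w => familyJet u (e, w)) z)
    (hEL' : ∀ᶠ e in 𝓝 (0 : ℝ), EulerLagrangeAt ℓ (fun w => familyJet u' (e, w)) z) :
    divergence (symplecticCurrent ℓ u u') z = 0 := by
  have hj := familyJet_congr h0
  have hℓ' : ContDiffAt ℝ 3 ℓ (familyJet u' (0, z)) := hj ▸ hℓ
  have hVd : ∀ {v : ℝ × Eu (n + 1) → Eu k}, ContDiffAt ℝ 3 v (0, z) →
      DifferentiableAt ℝ (familyVelocity v) z := fun hv =>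
    (contDiffAt_familyVelocity (r := 1) (hv.of_le (by norm_num))).differentiableAt (by norm_num)
  have hVa : ∀ {v : ℝ × Eu (n + 1) → Eu k}, ContDiffAt ℝ 3 v (0, z) → ∀ a,
      HasFDerivAt (fun w => familyVelocity v w a)
        ((EuclideanSpace.proj a : Eu k →L[ℝ] ℝ).comp (fderiv ℝ (familyVelocity v) z)) z :=
    fun hv a => (EuclideanSpace.proj a : Eu k →L[ℝ] ℝ).hasFDerivAt.comp z (hVd hv).hasFDerivAt
  have hm : ∀ {v : ℝ × Eu (n + 1) → Eu k}, ContDiffAt ℝ 3 v (0, z) →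
      ContDiffAt ℝ 3 ℓ (familyJet v (0, z)) → ∀ μ a,
      deriv (fun e => momentum ℓ (familyJet v (e, z)) μ a) 0
        = fderiv ℝ (fderiv ℝ ℓ) (familyJet v (0, z)) (familyProlong v z) (0, 0, elem μ a) :=
    fun hv hl μ a => (hasDerivAt_fderiv_apply (hv.of_le (by norm_num)) (hl.of_le (by norm_num)) _).deriv
  have hP : ∀ {v : ℝ × Eu (n + 1) → Eu k}, ContDiffAt ℝ 3 v (0, z) →
      ContDiffAt ℝ 3 ℓ (familyJet v (0, z)) → ∀ μ a,
      DifferentiableAt ℝ (fun w => deriv (fun e => momentum ℓ (familyJet v (e, w)) μ a) 0) z :=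
    fun hv hl μ a => (contDiffAt_deriv_momentum hv hl μ a).differentiableAt (by norm_num)
  have hsum : ∀ μ, fderiv ℝ (fun w => symplecticCurrent ℓ u u' w μ) z (stdVec μ)
      = ∑ a, ((familyVelocity u z a * fderiv ℝ
            (fun w => deriv (fun e => momentum ℓ (familyJet u' (e, w)) μ a) 0) z (stdVec μ)
          + fderiv ℝ (familyVelocity u) z (stdVec μ) a
            * deriv (fun e => momentum ℓ (familyJet u' (e, z)) μ a) 0)
        - (familyVelocity u' z a * fderiv ℝ
            (fun w => deriv (fun e => momentum ℓ (familyJet u (e, w)) μ a) 0) z (stdVec μ)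
          + fderiv ℝ (familyVelocity u') z (stdVec μ) a
            * deriv (fun e => momentum ℓ (familyJet u (e, z)) μ a) 0)) := by
    intro μ
    have : HasFDerivAt (fun w => symplecticCurrent ℓ u u' w μ) _ z :=
      HasFDerivAt.fun_sum (u := Finset.univ) fun a _ =>
        ((hVa hu a).mul (hP hu' hℓ' μ a).hasFDerivAt).sub
          ((hVa hu' a).mul (hP hu hℓ μ a).hasFDerivAt)
    rw [this.fderiv]
    simp only [_root_.sum_apply, _root_.add_apply, _root_.sub_apply,
      _root_.smul_apply, smul_eq_mul, ContinuousLinearMap.comp_apply]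
    refine Finset.sum_congr rfl fun a _ => ?_
    simp only [EuclideanSpace.coe_proj]
    ring
  -- One half of the divergence: the linearized equation supplies the `∂/∂y^a` part and `∂_μ V^a
  -- δp_a^μ` the `∂/∂y^a_μ` part of the Hessian of `ℓ` on two prolongations.
  have key : ∀ {v v' : ℝ × Eu (n + 1) → Eu k}, ContDiffAt ℝ 3 v (0, z) →
      ContDiffAt ℝ 3 v' (0, z) → ContDiffAt ℝ 3 ℓ (familyJet v' (0, z)) →
      (∀ᶠ e in 𝓝 (0 : ℝ), EulerLagrangeAt ℓ (fun w => familyJet v' (e, w)) z) →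
      (∑ a, familyVelocity v z a * ∑ μ, fderiv ℝ
            (fun w => deriv (fun e => momentum ℓ (familyJet v' (e, w)) μ a) 0) z (stdVec μ))
        + ∑ μ, ∑ a, fderiv ℝ (familyVelocity v) z (stdVec μ) a
            * deriv (fun e => momentum ℓ (familyJet v' (e, z)) μ a) 0
      = fderiv ℝ (fderiv ℝ ℓ) (familyJet v' (0, z)) (familyProlong v' z) (familyProlong v z) := by
    intro v v' hv hv' hl hE
    simp only [linearized_eulerLagrange hv' hl hE, hm hv' hl]
    rw [familyProlong.eq_def v z, vertical_expand]
  unfold divergence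
  simp only [hsum, Finset.sum_sub_distrib, Finset.sum_add_distrib]
  have e1 := key hu hu' hℓ' hEL'
  have e2 := key hu' hu hℓ hEL
  simp only [Finset.mul_sum] at e1 e2
  rw [Finset.sum_comm] at e1 e2
  -- The two Hessians sit at the same jet because the initial fields agree near `z`; what remains is
  -- their symmetry.
  rw [e1, e2, ← hj, sub_eq_zero]
  exact (hℓ.isSymmSndFDerivAt (by simp; norm_num)).eq _ _

end Variations


/-! ### Forms of top degree -/

section TopForms

variable {d : ℕ}

lemma baseVol_apply (v : Fin d → Eu d) :
    baseVol d v = (EuclideanSpace.basisFun (Fin d) ℝ).toBasis.det v := rfl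

lemma baseVol_stdVec : baseVol d (fun i => stdVec i) = 1 := by
  rw [baseVol_apply]
  have : (fun i : Fin d => (stdVec i : Eu d)) = (EuclideanSpace.basisFun (Fin d) ℝ).toBasis := by
    ext i; simp [stdVec]
  rw [this, Module.Basis.det_self]

lemma topForm_eq_smul (β : Eu d [⋀^Fin d]→L[ℝ] ℝ) :
    β = β (fun i => stdVec i) • baseVol d := by
  have h := AlternatingMap.eq_smul_basis_det (EuclideanSpace.basisFun (Fin d) ℝ).toBasis
    β.toAlternatingMap
  have : ((EuclideanSpace.basisFun (Fin d) ℝ).toBasis : Fin d → Eu d) = fun i => stdVec i := by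
    ext i; simp [stdVec]
  ext v
  have h2 := congrArg (fun f => f v) h
  simp only [this] at h2
  exact h2

lemma topForm_std_ne_zero {β : Eu d [⋀^Fin d]→L[ℝ] ℝ} (h : β ≠ 0) :
    β (fun i => stdVec i) ≠ 0 := by
  intro h0
  rw [topForm_eq_smul β, h0, zero_smul] at h
  exact h rfl

/-- The quotient of two forms of top degree on `ℝ^d`. -/
def topQuot (β τ : Eu d [⋀^Fin d]→L[ℝ] ℝ) : ℝ :=
  β (fun i => stdVec i) / τ (fun i => stdVec i)

lemma topQuot_smul {β τ : Eu d [⋀^Fin d]→L[ℝ] ℝ} (h : τ ≠ 0) : β = topQuot β τ • τ := by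
  rw [topForm_eq_smul β, topForm_eq_smul τ]
  have := topForm_std_ne_zero h
  simp [topQuot, smul_smul, baseVol_stdVec, this]

/-- Forms of top degree fill a line, so the quotient can be read off on any frame. The flux is
computed this way, on the coordinate frame of a boundary chart. -/
lemma topQuot_eq_div {β τ : Eu d [⋀^Fin d]→L[ℝ] ℝ} (h : τ ≠ 0) {t : Fin d → Eu d}
    (ht : τ t ≠ 0) : topQuot β τ = β t / τ t := by
  rw [eq_div_iff ht]
  conv_rhs => rw [topQuot_smul (β := β) h]
  rfl

lemma topForm_comp (β : Eu d [⋀^Fin d]→L[ℝ] ℝ) (A : Eu d →L[ℝ] Eu d) (v : Fin d → Eu d) :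
    β (fun i => A (v i)) = β (fun i => A (stdVec i)) * baseVol d v := by
  have h := topForm_eq_smul (β.compContinuousLinearMap A)
  exact congrArg (fun f => f v) h

/-- Expand the first slot in the standard basis: every vector except `stdVec 0` is repeated in a
later slot. -/
lemma baseVol_cons_succ {n : ℕ} (z : Eu (n + 1)) :
    baseVol (n + 1) (Fin.cons z (fun j : Fin n => stdVec j.succ)) = z 0 := by
  set L : Eu (n + 1) →ₗ[ℝ] ℝ := (baseVol (n + 1)).toMultilinearMap.toLinearMap
    (fun i => stdVec i) 0 with hL
  have hcons : ∀ w : Eu (n + 1), (Fin.cons w (fun j : Fin n => stdVec j.succ) : Fin (n + 1) → Eu (n + 1))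
      = Function.update (fun i => stdVec i) 0 w := by
    intro w
    ext i j
    refine Fin.cases ?_ (fun i => ?_) i <;> simp
  have h1 : ∀ w, L w = baseVol (n + 1) (Fin.cons w (fun j : Fin n => stdVec j.succ)) := by
    intro w; rw [hcons]; rfl
  rw [← h1]
  conv_lhs => rw [eu_sum z]
  rw [map_sum, Fin.sum_univ_succ]
  have h0 : L (stdVec 0) = 1 := by
    rw [h1, hcons, Function.update_eq_self]
    exact baseVol_stdVec
  have hs : ∀ j : Fin n, L (stdVec j.succ) = 0 := by
    intro j
    rw [h1]
    exact (baseVol (n + 1)).map_eq_zero_of_eq _ (i := 0) (j := j.succ) (by simp)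
      (Fin.succ_ne_zero j).symm
  have hL0 : L (z 0 • stdVec 0) = z 0 * L (stdVec 0) := L.map_smul (z 0) (stdVec 0)
  have hLs : ∀ j : Fin n, L (z j.succ • stdVec j.succ) = z j.succ * L (stdVec j.succ) :=
    fun j => L.map_smul (z j.succ) (stdVec j.succ)
  simp only [hL0, hLs, h0, hs]
  simp

end TopForms

/-! ### The canonical symplectic form and the multisymplectic form in coordinates -/

section Forms

variable {n k : ℕ}

lemma canonicalOneForm_apply (p : Eu k × Eu k) (v : Fin 1 → Eu k × Eu k) :
    canonicalOneForm k p v = ∑ a, p.2 a * (v 0).1 a := by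
  simp [canonicalOneForm]

lemma differentiable_canonicalOneForm : Differentiable ℝ (canonicalOneForm k) := by
  have : canonicalOneForm k = fun p : Eu k × Eu k => ∑ a, p.2 a •
      ContinuousAlternatingMap.ofSubsingleton ℝ (Eu k × Eu k) ℝ (0 : Fin 1)
        ((EuclideanSpace.proj a : Eu k →L[ℝ] ℝ).comp (ContinuousLinearMap.fst ℝ _ _)) := by
    funext p
    ext v
    rw [canonicalOneForm_apply]
    simp
  rw [this]
  refine Differentiable.fun_sum fun a _ => Differentiable.smul_const ?_ _
  exact (EuclideanSpace.proj a : Eu k →L[ℝ] ℝ).differentiable.comp differentiable_snd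

/-- On constant vectors the exterior derivative is an alternating sum of derivatives of the
coefficients `q_a`; the sign in `-dθ` turns it into `∑ du^a ∧ dq_a`. -/
lemma canonicalSymplectic_apply (p u u' : Eu k × Eu k) :
    canonicalSymplectic k p ![u, u'] = ∑ a, (u.1 a * u'.2 a - u'.1 a * u.2 a) := by
  have hf : ∀ c : Fin 1 → Eu k × Eu k, ∀ v : Eu k × Eu k,
      fderiv ℝ (fun p => canonicalOneForm k p c) p v = ∑ a, v.2 a * (c 0).1 a := by
    intro c v
    simp only [canonicalOneForm_apply]
    have : HasFDerivAt (fun p : Eu k × Eu k => ∑ a, p.2 a * (c 0).1 a) _ p :=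
      HasFDerivAt.fun_sum (u := Finset.univ) fun a _ =>
        (((EuclideanSpace.proj a : Eu k →L[ℝ] ℝ).comp
          (ContinuousLinearMap.snd ℝ (Eu k) (Eu k))).hasFDerivAt.mul_const ((c 0).1 a))
    rw [this.fderiv]
    simp [mul_comm]
  rw [canonicalSymplectic, ContinuousAlternatingMap.neg_apply,
    extDeriv_apply (differentiable_canonicalOneForm p), Fin.sum_univ_two, hf, hf]
  simp only [Fin.removeNth]
  simp only [Fin.coe_ofNat_eq_mod, Nat.zero_mod, pow_zero, one_smul, Nat.mod_succ, pow_one, neg_smul,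
    Matrix.cons_val_zero, Matrix.cons_val_one, Fin.succAbove_zero, Fin.succ_zero_eq_one,
    Fin.one_succAbove_zero, Finset.sum_sub_distrib, neg_add, neg_neg, Matrix.cons_val_fin_one]
  rw [neg_add_eq_sub]
  exact congrArg₂ _ (Finset.sum_congr rfl fun a _ => mul_comm _ _)
    (Finset.sum_congr rfl fun a _ => mul_comm _ _)

lemma dxContr_apply (μ : Fin (n + 1)) (c : Fin n → JetCoord n k) :
    dxContr μ c = baseVol (n + 1) (Fin.cons (stdVec μ) fun i => (c i).1) := by
  have : (fun i => (ContinuousLinearMap.fst ℝ (Eu (n + 1)) (Eu k × (Eu (n + 1) →L[ℝ] Eu k)))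
      ((Fin.cons ((stdVec μ, 0, 0) : JetCoord n k) c : Fin (n + 1) → JetCoord n k) i))
      = Fin.cons (stdVec μ) fun i => (c i).1 := by
    funext i
    refine Fin.cases ?_ (fun i => ?_) i <;> simp
  rw [← this]; rfl

lemma dx_eq_zero {c : Fin (n + 1) → JetCoord n k} {i : Fin (n + 1)} (h : (c i).1 = 0) :
    dx c = 0 :=
  (baseVol (n + 1)).map_coord_zero i h

lemma dxContr_eq_zero (μ : Fin (n + 1)) {c : Fin n → JetCoord n k} {i : Fin n}
    (h : (c i).1 = 0) : dxContr μ c = 0 := by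
  rw [dxContr_apply]
  exact (baseVol (n + 1)).map_coord_zero i.succ (by simpa using h)

lemma oneWedge_apply {V : Type*} [NormedAddCommGroup V] [NormedSpace ℝ V] {m : ℕ}
    (α : V →L[ℝ] ℝ) (β : V [⋀^Fin m]→L[ℝ] ℝ) (c : Fin (m + 1) → V) :
    oneWedge α β c = ∑ i : Fin (m + 1), (-1) ^ (i : ℕ) * (α (c i) * β (i.removeNth c)) := by
  rw [oneWedge, ContinuousAlternatingMap.alternatizeUncurryFin_apply]
  refine Finset.sum_congr rfl fun i _ => ?_
  simp

/-- On a vertical vector followed by arbitrary ones. -/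
lemma oneWedge_cons_vertical (a : Fin k) (μ : Fin (n + 1)) {w : JetCoord n k} (hw : w.1 = 0)
    (c : Fin n → JetCoord n k) :
    oneWedge (dy a) (dxContr μ) (Fin.cons w c) = w.2.1 a * dxContr μ c := by
  rw [oneWedge_apply, Fin.sum_univ_succ]
  rw [Finset.sum_eq_zero]
  · simp [dy]
  · intro j _
    -- In every term but the first, `w` is left over as an argument of `d^n x_μ`, which vanishes on
    -- vertical vectors.
    rw [dxContr_eq_zero μ (i := ⟨0, j.pos⟩)]
    · simp
    · obtain ⟨m, rfl⟩ : ∃ m, n = m + 1 := ⟨n - 1, by have := j.pos; omega⟩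
      have : (j.succ.removeNth (Fin.cons w c : Fin (m + 1 + 1) → JetCoord (m + 1) k))
          (0 : Fin (m + 1)) = w := by
        simp [Fin.removeNth]
      change ((j.succ.removeNth (Fin.cons w c : Fin (m + 1 + 1) → JetCoord (m + 1) k))
          (0 : Fin (m + 1))).1 = 0
      rw [this, hw]

lemma poincareCartan_apply (ℓ : JetCoord n k → ℝ) (q : JetCoord n k)
    (c : Fin (n + 1) → JetCoord n k) :
    poincareCartan ℓ q c
      = (ℓ q - ∑ μ, ∑ a, momentum ℓ q μ a * q.2.2 (stdVec μ) a) * dx c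
        + ∑ μ, ∑ a, momentum ℓ q μ a * oneWedge (dy a) (dxContr μ) c := by
  simp [poincareCartan, ContinuousAlternatingMap.sum_apply]

/-- The `d^{n+1}x` term dies on a vertical vector, so the derivative of its coefficient never enters
the value of `Ω` on two vertical vectors. -/
lemma poincareCartan_cons_vertical (ℓ : JetCoord n k → ℝ) (q : JetCoord n k)
    {w : JetCoord n k} (hw : w.1 = 0) (c : Fin n → JetCoord n k) :
    poincareCartan ℓ q (Fin.cons w c)
      = ∑ μ, ∑ a, momentum ℓ q μ a * (w.2.1 a * dxContr μ c) := by
  rw [poincareCartan_apply, dx_eq_zero (i := 0) (by simpa using hw)]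
  simp only [oneWedge_cons_vertical _ _ hw, mul_zero, zero_add]

lemma differentiableAt_momentum {ℓ : JetCoord n k → ℝ} {q : JetCoord n k}
    (hℓ : ContDiffAt ℝ 2 ℓ q) (μ : Fin (n + 1)) (a : Fin k) :
    DifferentiableAt ℝ (fun q => momentum ℓ q μ a) q :=
  (contDiffAt_momentum (r := 1) (by simpa [one_add_one_eq_two] using hℓ) μ a).differentiableAt
    (by norm_num)

lemma differentiableAt_form_combination {V ι κ : Type*} [NormedAddCommGroup V] [NormedSpace ℝ V]
    [Fintype ι] [Fintype κ] {m : ℕ} {h : V → ℝ} {p : ι → κ → V → ℝ} {x : V}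
    (hh : DifferentiableAt ℝ h x) (hp : ∀ i j, DifferentiableAt ℝ (p i j) x)
    (β : V [⋀^Fin m]→L[ℝ] ℝ) (γ : ι → κ → V [⋀^Fin m]→L[ℝ] ℝ) :
    DifferentiableAt ℝ (fun y => h y • β + ∑ i, ∑ j, p i j y • γ i j) x :=
  (hh.smul_const β).add (DifferentiableAt.fun_sum fun i _ => DifferentiableAt.fun_sum fun j _ =>
    (hp i j).smul_const (γ i j))

lemma differentiableAt_poincareCartan {ℓ : JetCoord n k → ℝ} {q : JetCoord n k}
    (hℓ : ContDiffAt ℝ 2 ℓ q) : DifferentiableAt ℝ (poincareCartan ℓ) q := by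
  have hp := differentiableAt_momentum hℓ
  have hv : ∀ (μ : Fin (n + 1)) (a : Fin k),
      DifferentiableAt ℝ (fun q : JetCoord n k => q.2.2 (stdVec μ) a) q := by
    intro μ a
    have h1 : DifferentiableAt ℝ (fun q : JetCoord n k => q.2.2) q :=
      differentiableAt_snd.comp q differentiableAt_snd
    exact (EuclideanSpace.proj a : Eu k →L[ℝ] ℝ).differentiableAt.comp q
      (h1.clm_apply (differentiableAt_const _))
  have hH : DifferentiableAt ℝ
      (fun q : JetCoord n k => ℓ q - ∑ μ, ∑ a, momentum ℓ q μ a * q.2.2 (stdVec μ) a) q :=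
    (hℓ.differentiableAt (by norm_num)).sub
      (DifferentiableAt.fun_sum fun μ _ => DifferentiableAt.fun_sum fun a _ =>
        (hp μ a).mul (hv μ a))
  exact differentiableAt_form_combination hH hp dx fun μ a => oneWedge (dy a) (dxContr μ)

/-- The multisymplectic form on two vertical vectors and `n` further ones. -/
theorem multisymplectic_apply {ℓ : JetCoord n k → ℝ} {q : JetCoord n k} (hℓ : ContDiffAt ℝ 2 ℓ q)
    {v w : JetCoord n k} (hv : v.1 = 0) (hw : w.1 = 0) (c : Fin n → JetCoord n k) :
    multisymplectic ℓ q (Fin.cons v (Fin.cons w c))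
      = ∑ μ, (∑ a, (v.2.1 a * fderiv ℝ (fun q => momentum ℓ q μ a) q w
          - w.2.1 a * fderiv ℝ (fun q => momentum ℓ q μ a) q v)) * dxContr μ c := by
  have hd : ∀ {x : JetCoord n k}, x.1 = 0 → ∀ y : JetCoord n k,
      fderiv ℝ (fun q => poincareCartan ℓ q (Fin.cons x c)) q y
        = ∑ μ, ∑ a, fderiv ℝ (fun q => momentum ℓ q μ a) q y * (x.2.1 a * dxContr μ c) := by
    intro x hx y
    simp only [poincareCartan_cons_vertical ℓ _ hx]
    have : HasFDerivAt (fun q => ∑ μ, ∑ a, momentum ℓ q μ a * (x.2.1 a * dxContr μ c)) _ q :=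
      HasFDerivAt.fun_sum (u := Finset.univ) fun μ _ =>
        HasFDerivAt.fun_sum (u := Finset.univ) fun a _ =>
          (differentiableAt_momentum hℓ μ a).hasFDerivAt.mul_const (x.2.1 a * dxContr μ c)
    rw [this.fderiv]
    simp only [_root_.sum_apply, _root_.smul_apply, smul_eq_mul]
    refine Finset.sum_congr rfl fun μ _ => Finset.sum_congr rfl fun a _ => by ring
  -- In the alternating sum for the exterior derivative, only the terms that delete `v` or `w`
  -- survive.
  rw [multisymplectic, ContinuousAlternatingMap.neg_apply,
    extDeriv_apply (differentiableAt_poincareCartan hℓ), Fin.sum_univ_succ, Fin.sum_univ_succ,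
    Finset.sum_eq_zero (s := Finset.univ (α := Fin n))]
  · have r0 : (0 : Fin (n + 2)).removeNth (Fin.cons v (Fin.cons w c) : Fin (n + 2) → JetCoord n k)
        = Fin.cons w c := by simp
    have r1 : ((0 : Fin (n + 1)).succ).removeNth
        (Fin.cons v (Fin.cons w c) : Fin (n + 2) → JetCoord n k) = Fin.cons v c := by
      funext i
      refine Fin.cases ?_ (fun i => ?_) i
      · simp [Fin.removeNth]
      · simp [Fin.removeNth]
    rw [r0, r1, hd hw, hd hv]
    simp only [Fin.cons_zero, Fin.cons_succ, Fin.val_zero, pow_zero, one_smul, Fin.val_succ,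
      zero_add, pow_one, neg_smul, add_zero]
    rw [← sub_eq_add_neg, neg_sub, ← Finset.sum_sub_distrib]
    refine Finset.sum_congr rfl fun μ _ => ?_
    rw [← Finset.sum_sub_distrib, Finset.sum_mul]
    refine Finset.sum_congr rfl fun a _ => by ring
  -- If a vector of `c` is deleted, both vertical vectors remain: `v` is absorbed by `dy^a`, and `w`
  -- falls into `d^n x_μ`.
  · intro j _
    obtain ⟨m, rfl⟩ : ∃ m, n = m + 1 := ⟨n - 1, by have := j.pos; omega⟩
    have : (j.succ.succ).removeNth
        (Fin.cons v (Fin.cons w c) : Fin (m + 1 + 2) → JetCoord (m + 1) k)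
        = Fin.cons v (Fin.cons w (j.removeNth c)) := by
      funext i
      refine Fin.cases ?_ (fun i => Fin.cases ?_ (fun i => ?_) i) i
      · simp [Fin.removeNth]
      · simp only [Fin.removeNth, Fin.succ_succAbove_succ, Fin.succ_succAbove_zero, Fin.cons_succ,
          Fin.cons_zero]
      · simp only [Fin.removeNth, Fin.succ_succAbove_succ, Fin.cons_succ]
    rw [this]
    have hz : (fun q => poincareCartan ℓ q (Fin.cons v (Fin.cons w (j.removeNth c)))) = fun _ => 0 := by
      funext q
      rw [poincareCartan_cons_vertical ℓ _ hv]
      refine Finset.sum_eq_zero fun μ _ => Finset.sum_eq_zero fun a _ => ?_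
      rw [dxContr_eq_zero μ (i := 0) (by simpa using hw)]
      ring
    rw [hz]
    simp

end Forms


/-! ### Differentials as maps of the model spaces -/

section Differential

variable {E E' E'' : Type*} [NormedAddCommGroup E] [NormedSpace ℝ E]
  [NormedAddCommGroup E'] [NormedSpace ℝ E'] [NormedAddCommGroup E''] [NormedSpace ℝ E'']
  {M N P : Type*} [TopologicalSpace M] [ChartedSpace E M] [TopologicalSpace N] [ChartedSpace E' N]
  [TopologicalSpace P] [ChartedSpace E'' P]

variable (E E') in
/-- The differential, as a map of the model spaces. -/
def mder (f : M → N) (x : M) : E →L[ℝ] E' := mfderiv 𝓘(ℝ, E) 𝓘(ℝ, E') f x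

lemma mder_comp {f : M → N} {g : N → P} {x : M} (hg : MDifferentiableAt 𝓘(ℝ, E') 𝓘(ℝ, E'') g (f x))
    (hf : MDifferentiableAt 𝓘(ℝ, E) 𝓘(ℝ, E') f x) :
    mder E E'' (g ∘ f) x = (mder E' E'' g (f x)).comp (mder E E' f x) :=
  mfderiv_comp x hg hf

lemma mder_congr {f g : M → N} {x : M} (h : f =ᶠ[𝓝 x] g) : mder E E' f x = mder E E' g x :=
  h.mfderiv_eq

lemma mder_eq_fderiv (f : E → E') (x : E) : mder E E' f x = fderiv ℝ f x := mfderiv_eq_fderiv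

end Differential

/-! ### Volume forms and measures in charts -/

section Charts

variable {d : ℕ} {M : Type*} [TopologicalSpace M] [ChartedSpace (Eu d) M]

/-- The differential of a chart. -/
def dchart (c : OpenPartialHomeomorph M (Eu d)) (x : M) : Eu d →L[ℝ] Eu d :=
  mder (Eu d) (Eu d) c x

/-- The differential of an inverse chart. -/
def dsymm (c : OpenPartialHomeomorph M (Eu d)) (z : Eu d) : Eu d →L[ℝ] Eu d :=
  mder (Eu d) (Eu d) c.symm z

variable [IsManifold (𝓡 d) ∞ M] {c : OpenPartialHomeomorph M (Eu d)}

lemma contMDiffAt_chart (hc : c ∈ IsManifold.maximalAtlas (𝓡 d) ∞ M) {x : M} (hx : x ∈ c.source) :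
    ContMDiffAt (𝓡 d) (𝓡 d) ∞ c x := contMDiffAt_of_mem_maximalAtlas hc hx

lemma contMDiffAt_chart_symm (hc : c ∈ IsManifold.maximalAtlas (𝓡 d) ∞ M) {z : Eu d}
    (hz : z ∈ c.target) : ContMDiffAt (𝓡 d) (𝓡 d) ∞ c.symm z :=
  contMDiffAt_symm_of_mem_maximalAtlas hc hz

lemma mdifferentiable_chart' (hc : c ∈ IsManifold.maximalAtlas (𝓡 d) ∞ M) :
    c.MDifferentiable (𝓡 d) (𝓡 d) :=
  ⟨fun _ hx => ((contMDiffAt_chart hc hx).mdifferentiableAt (by simp)).mdifferentiableWithinAt,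
   fun _ hx => ((contMDiffAt_chart_symm hc hx).mdifferentiableAt (by simp)).mdifferentiableWithinAt⟩

lemma dsymm_dchart (hc : c ∈ IsManifold.maximalAtlas (𝓡 d) ∞ M) {x : M} (hx : x ∈ c.source)
    (v : Eu d) : dsymm c (c x) (dchart c x v) = v :=
  congrArg (fun L : Eu d →L[ℝ] Eu d => L v) ((mdifferentiable_chart' hc).symm_comp_deriv hx)

lemma dchart_dsymm (hc : c ∈ IsManifold.maximalAtlas (𝓡 d) ∞ M) {x : M} (hx : x ∈ c.source)
    (v : Eu d) : dchart c x (dsymm c (c x) v) = v := by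
  have h := (mdifferentiable_chart' hc).comp_symm_deriv (c.map_source hx)
  rw [c.left_inv hx] at h
  exact congrArg (fun L : Eu d →L[ℝ] Eu d => L v) h

/-- The value of a volume form, as a form on the model space. -/
def VolumeForm.at (τ : VolumeForm d M) (x : M) : Eu d [⋀^Fin d]→L[ℝ] ℝ := τ.form x

lemma VolumeForm.at_ne_zero (τ : VolumeForm d M) (x : M) : τ.at x ≠ 0 := τ.ne_zero x

lemma formDensity_eq (τ : VolumeForm d M) (c : OpenPartialHomeomorph M (Eu d)) (z : Eu d) :
    formDensity τ.form c z = τ.at (c.symm z) (fun i => dsymm c z (stdVec i)) := rfl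

/-- This is `topForm_comp` for the differential of the inverse chart; through it, identities between
forms on the manifold become identities for `baseVol`. -/
lemma VolumeForm.at_eq (τ : VolumeForm d M) (hc : c ∈ IsManifold.maximalAtlas (𝓡 d) ∞ M) {x : M}
    (hx : x ∈ c.source) (v : Fin d → Eu d) :
    τ.at x v = formDensity τ.form c (c x) * baseVol d (fun i => dchart c x (v i)) := by
  have h := topForm_comp (τ.at x) (dsymm c (c x)) (fun i => dchart c x (v i))
  simp only [dsymm_dchart hc hx] at h
  rw [h, formDensity_eq, c.left_inv hx]

lemma formDensity_ne_zero (τ : VolumeForm d M) (hc : c ∈ IsManifold.maximalAtlas (𝓡 d) ∞ M)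
    {z : Eu d} (hz : z ∈ c.target) : formDensity τ.form c z ≠ 0 := by
  intro h0
  refine τ.at_ne_zero (c.symm z) (ContinuousAlternatingMap.ext fun v => ?_)
  rw [τ.at_eq hc (c.map_target hz), c.right_inv hz, h0, zero_mul]
  rfl

lemma continuousOn_formDensity (τ : VolumeForm d M)
    (hc : c ∈ IsManifold.maximalAtlas (𝓡 d) ∞ M) :
    ContinuousOn (formDensity τ.form c) c.target := (τ.smooth c hc).continuousOn

lemma contDiffAt_formDensity (τ : VolumeForm d M)
    (hc : c ∈ IsManifold.maximalAtlas (𝓡 d) ∞ M) {z : Eu d} (hz : z ∈ c.target) :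
    ContDiffAt ℝ ∞ (formDensity τ.form c) z :=
  (τ.smooth c hc).contDiffAt (c.open_target.mem_nhds hz)

variable [MeasurableSpace M] [BorelSpace M] {τ : VolumeForm d M} {m : Measure M}

lemma aemeasurable_chart (c : OpenPartialHomeomorph M (Eu d)) (m : Measure M) :
    AEMeasurable c (m.restrict c.source) :=
  c.continuousOn.aemeasurable c.open_source.measurableSet

lemma aemeasurable_density (hc : c ∈ IsManifold.maximalAtlas (𝓡 d) ∞ M) :
    AEMeasurable (fun z => Real.toNNReal |formDensity τ.form c z|) (volume.restrict c.target) :=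
  ((continuousOn_formDensity τ hc).abs.aemeasurable c.open_target.measurableSet).real_toNNReal

lemma IsVolumeMeasure.map_chart (hm : IsVolumeMeasure τ m)
    (hc : c ∈ IsManifold.maximalAtlas (𝓡 d) ∞ M) :
    (m.restrict c.source).map c = (volume.restrict c.target).withDensity
      (fun z => (Real.toNNReal |formDensity τ.form c z| : ENNReal)) := hm c hc

lemma aestronglyMeasurable_map_chart (hm : IsVolumeMeasure τ m)
    (hc : c ∈ IsManifold.maximalAtlas (𝓡 d) ∞ M) {g : M → ℝ}
    (hg : AEStronglyMeasurable (fun z => g (c.symm z)) (volume.restrict c.target)) :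
    AEStronglyMeasurable (fun z => g (c.symm z)) ((m.restrict c.source).map c) := by
  rw [hm.map_chart hc]
  exact hg.mono_ac (withDensity_absolutelyContinuous _ _)

lemma comp_chart_ae (c : OpenPartialHomeomorph M (Eu d)) (m : Measure M) (g : M → ℝ) :
    (fun x => g (c.symm (c x))) =ᵐ[m.restrict c.source] g := by
  filter_upwards [ae_restrict_mem c.open_source.measurableSet] with x hx
  rw [c.left_inv hx]

/-- Integrals in a chart. -/
lemma IsVolumeMeasure.setIntegral_source (hm : IsVolumeMeasure τ m)
    (hc : c ∈ IsManifold.maximalAtlas (𝓡 d) ∞ M) {g : M → ℝ}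
    (hg : AEStronglyMeasurable (fun z => g (c.symm z)) (volume.restrict c.target)) :
    ∫ x in c.source, g x ∂m = ∫ z in c.target, |formDensity τ.form c z| * g (c.symm z) := by
  rw [← integral_congr_ae (comp_chart_ae c m g),
    ← integral_map (f := fun z => g (c.symm z)) (aemeasurable_chart c m)
      (aestronglyMeasurable_map_chart hm hc hg),
    hm.map_chart hc, integral_withDensity_eq_integral_smul₀ (aemeasurable_density hc)]
  refine integral_congr_ae (Eventually.of_forall fun z => ?_)
  simp [NNReal.smul_def]

lemma IsVolumeMeasure.integrableOn_source (hm : IsVolumeMeasure τ m)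
    (hc : c ∈ IsManifold.maximalAtlas (𝓡 d) ∞ M) {g : M → ℝ}
    (hg : AEStronglyMeasurable (fun z => g (c.symm z)) (volume.restrict c.target))
    (hi : IntegrableOn (fun z => |formDensity τ.form c z| * g (c.symm z)) c.target) :
    IntegrableOn g c.source m := by
  rw [IntegrableOn, ← integrable_congr (comp_chart_ae c m g)]
  refine (integrable_map_measure (g := fun z => g (c.symm z))
    (aestronglyMeasurable_map_chart hm hc hg) (aemeasurable_chart c m)).1 ?_
  rw [hm.map_chart hc, integrable_withDensity_iff_integrable_smul₀ (aemeasurable_density hc)]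
  refine hi.congr (Eventually.of_forall fun z => ?_)
  simp [NNReal.smul_def]

lemma IsVolumeMeasure.measure_preimage (hm : IsVolumeMeasure τ m)
    (hc : c ∈ IsManifold.maximalAtlas (𝓡 d) ∞ M) {s : Set (Eu d)} (hs : MeasurableSet s)
    (hst : s ⊆ c.target) :
    m (c.source ∩ c ⁻¹' s) = ∫⁻ z in s, (Real.toNNReal |formDensity τ.form c z| : ENNReal) := by
  have h := congrArg (fun μ => μ s) (hm.map_chart hc)
  beta_reduce at h
  rw [Measure.map_apply_of_aemeasurable (aemeasurable_chart c m) hs, withDensity_apply _ hs,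
    Measure.restrict_restrict hs, inter_eq_left.2 hst,
    Measure.restrict_apply' c.open_source.measurableSet, inter_comm] at h
  exact h

/-- The density is bounded on a compact neighbourhood inside a chart. Finiteness on compact sets is
what makes the action and the boundary integrals of continuous functions converge. -/
lemma IsVolumeMeasure.isLocallyFinite (hm : IsVolumeMeasure τ m) :
    IsLocallyFiniteMeasure m := by
  refine ⟨fun x => ?_⟩
  set c := chartAt (Eu d) x
  have hc : c ∈ IsManifold.maximalAtlas (𝓡 d) ∞ M := IsManifold.chart_mem_maximalAtlas x
  obtain ⟨K, hK, hKc, hKt⟩ := exists_mem_nhds_isCompact_mapsTo continuous_id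
    (c.open_target.mem_nhds (mem_chart_target (Eu d) x))
  refine ⟨c.source ∩ c ⁻¹' K, inter_mem (chart_source_mem_nhds (Eu d) x)
    ((c.continuousAt (mem_chart_source (Eu d) x)).preimage_mem_nhds hK), ?_⟩
  rw [hm.measure_preimage hc hKc.measurableSet hKt]
  obtain ⟨C, hC⟩ := hKc.exists_bound_of_continuousOn ((continuousOn_formDensity τ hc).mono hKt)
  calc ∫⁻ z in K, (Real.toNNReal |formDensity τ.form c z| : ENNReal)
      ≤ ∫⁻ _ in K, (Real.toNNReal C : ENNReal) := by
        refine setLIntegral_mono' hKc.measurableSet fun z hz => ?_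
        exact_mod_cast Real.toNNReal_mono (hC z hz)
    _ < ⊤ := by
        rw [setLIntegral_const]
        exact ENNReal.mul_lt_top ENNReal.coe_lt_top hKc.measure_lt_top

/-- The density has no zeros, so a null open set would be Lebesgue null in a chart. This serves the
uniqueness of the differential, where a continuous nonnegative function must have positive integral.
-/
lemma IsVolumeMeasure.isOpenPos (hm : IsVolumeMeasure τ m) : m.IsOpenPosMeasure := by
  refine ⟨fun O hO ⟨x, hx⟩ h0 => ?_⟩
  set c := chartAt (Eu d) x
  have hc : c ∈ IsManifold.maximalAtlas (𝓡 d) ∞ M := IsManifold.chart_mem_maximalAtlas x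
  set s := c.target ∩ c.symm ⁻¹' O with hs
  have hso : IsOpen s := c.isOpen_inter_preimage_symm hO
  have hxs : c x ∈ s := ⟨mem_chart_target (Eu d) x, by
    show c.symm (c x) ∈ O
    rwa [c.left_inv (mem_chart_source (Eu d) x)]⟩
  have h1 : m (c.source ∩ c ⁻¹' s) = 0 := by
    refine measure_mono_null ?_ h0
    rintro y ⟨hy, hy'⟩
    have : c.symm (c y) ∈ O := hy'.2
    rwa [c.left_inv hy] at this
  rw [hm.measure_preimage hc hso.measurableSet inter_subset_left,
    lintegral_eq_zero_iff' (((aemeasurable_density hc).mono_set inter_subset_left).coe_nnreal_ennreal)]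
    at h1
  have h2 : ∀ᵐ z ∂(volume.restrict s), False := by
    filter_upwards [h1, ae_restrict_mem hso.measurableSet] with z hz hzs
    have := formDensity_ne_zero τ hc hzs.1
    simp at hz
    exact this hz
  rw [ae_iff] at h2
  simp at h2
  exact (hso.measure_pos volume ⟨_, hxs⟩).ne' h2

end Charts


/-! ### Stokes' theorem on a domain with smooth boundary -/

section Stokes

variable {n : ℕ} {X B : Type*}
  [TopologicalSpace X] [ChartedSpace (Eu (n + 1)) X] [IsManifold (𝓡 (n + 1)) ∞ X]
  [TopologicalSpace B] [ChartedSpace (Eu n) B] [IsManifold (𝓡 n) ∞ B]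

/-- A pair of charts of `X` and `∂U` as in the definition of a smooth domain. -/
structure IsSlice (vol : VolumeForm (n + 1) X) (σ : VolumeForm n B) (U : Set X) (ι : B → X)
    (ψ : OpenPartialHomeomorph X (Eu (n + 1))) (κ : OpenPartialHomeomorph B (Eu n)) : Prop where
  mem_atlas : ψ ∈ IsManifold.maximalAtlas (𝓡 (n + 1)) ∞ X
  mem_atlas_boundary : κ ∈ IsManifold.maximalAtlas (𝓡 n) ∞ B
  source_iff : ∀ t, t ∈ κ.source ↔ ι t ∈ ψ.source
  coord : ∀ t ∈ κ.source, ψ (ι t) = hyperplane (κ t)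
  mem_iff : ∀ x ∈ ψ.source, x ∈ U ↔ ψ x 0 < 0
  pos : ∀ t ∈ κ.source, 0 < formDensity vol.form ψ (ψ (ι t)) * formDensity σ.form κ (κ t)

variable {vol : VolumeForm (n + 1) X} {σ : VolumeForm n B} {U : Set X} {ι : B → X}

lemma IsSmoothDomain.exists_slice (h : IsSmoothDomain vol σ U ι) (s : B) :
    ∃ ψ κ, IsSlice vol σ U ι ψ κ ∧ s ∈ κ.source := by
  obtain ⟨ψ, hψ, κ, hκ, hs, h1, h2, h3, h4⟩ := h.slice s
  refine ⟨ψ, κ, ⟨hψ, hκ, h1, fun t ht => ?_, h3, h4⟩, hs⟩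
  ext i
  refine Fin.cases ?_ (fun j => ?_) i
  · exact (h2 t ht).1
  · exact (h2 t ht).2 j

lemma contDiff_hyperplane : ContDiff ℝ ∞ (hyperplane : Eu n → Eu (n + 1)) := by
  refine contDiff_euclidean.2 fun i => ?_
  refine Fin.cases ?_ (fun j => ?_) i
  · exact contDiff_const
  · exact (EuclideanSpace.proj j : Eu n →L[ℝ] ℝ).contDiff

lemma hasFDerivAt_hyperplane (y : Eu n) (v : Eu n) :
    fderiv ℝ (hyperplane : Eu n → Eu (n + 1)) y v = hyperplane v := by
  let L : Eu n →ₗ[ℝ] Eu (n + 1) :=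
    { toFun := hyperplane
      map_add' := fun a b => by
        ext i; refine Fin.cases ?_ (fun j => ?_) i <;> simp
      map_smul' := fun a b => by
        ext i; refine Fin.cases ?_ (fun j => ?_) i <;> simp }
  have : fderiv ℝ (L.toContinuousLinearMap) y = L.toContinuousLinearMap :=
    ContinuousLinearMap.fderiv _
  exact congrArg (fun f : Eu n →L[ℝ] Eu (n + 1) => f v) this

lemma hyperplane_stdVec (j : Fin n) : hyperplane (stdVec j) = stdVec j.succ := by
  ext i
  refine Fin.cases ?_ (fun i => ?_) i
  · simp [stdVec, (Fin.succ_ne_zero j).symm]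
  · by_cases h : i = j <;> simp [stdVec, h]

namespace IsSlice

variable {ψ : OpenPartialHomeomorph X (Eu (n + 1))} {κ : OpenPartialHomeomorph B (Eu n)}

lemma eqOn (h : IsSlice vol σ U ι ψ κ) :
    EqOn ι (fun t => ψ.symm (hyperplane (κ t))) κ.source := fun t ht => by
  simp only
  rw [← h.coord t ht, ψ.left_inv ((h.source_iff t).1 ht)]

lemma contMDiffAt (h : IsSlice vol σ U ι ψ κ) {t : B} (ht : t ∈ κ.source) :
    ContMDiffAt (𝓡 n) (𝓡 (n + 1)) ∞ ι t := by
  have h1 := contMDiffAt_chart h.mem_atlas_boundary ht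
  have h2 : ContMDiffAt (𝓡 n) (𝓡 (n + 1)) ∞ (hyperplane : Eu n → Eu (n + 1)) (κ t) :=
    contDiff_hyperplane.contMDiff.contMDiffAt
  have h3 : ContMDiffAt (𝓡 (n + 1)) (𝓡 (n + 1)) ∞ ψ.symm (hyperplane (κ t)) := by
    refine contMDiffAt_chart_symm h.mem_atlas ?_
    rw [← h.coord t ht]
    exact ψ.map_source ((h.source_iff t).1 ht)
  refine (ContMDiffAt.comp t h3 (ContMDiffAt.comp t h2 h1)).congr_of_eventuallyEq ?_
  filter_upwards [κ.open_source.mem_nhds ht] with t' ht'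
  exact h.eqOn ht'

/-- The differential of the inclusion of the boundary in slice coordinates. -/
lemma dchart_mfderiv (h : IsSlice vol σ U ι ψ κ) {t : B} (ht : t ∈ κ.source) (v : Eu n) :
    dchart ψ (ι t) (mder (Eu n) (Eu (n + 1)) ι t
      (dsymm κ (κ t) v)) = hyperplane v := by
  have hιt : MDifferentiableAt (𝓡 n) (𝓡 (n + 1)) ι (κ.symm (κ t)) := by
    rw [κ.left_inv ht]
    exact (h.contMDiffAt ht).mdifferentiableAt (by simp)
  have hκ : MDifferentiableAt (𝓡 n) (𝓡 n) κ.symm (κ t) :=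
    (contMDiffAt_chart_symm h.mem_atlas_boundary (κ.map_source ht)).mdifferentiableAt (by simp)
  have hψ : MDifferentiableAt (𝓡 (n + 1)) (𝓡 (n + 1)) ψ ((ι ∘ κ.symm) (κ t)) := by
    simp only [Function.comp, κ.left_inv ht]
    exact (contMDiffAt_chart h.mem_atlas ((h.source_iff t).1 ht)).mdifferentiableAt (by simp)
  have e1 := mder_comp hιt hκ
  have e2 := mder_comp hψ (MDifferentiableAt.comp (κ t) hιt hκ)
  have e3 : (ψ ∘ ι ∘ κ.symm) =ᶠ[𝓝 (κ t)] hyperplane := by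
    filter_upwards [κ.open_target.mem_nhds (κ.map_source ht)] with y hy
    simp only [Function.comp]
    rw [h.coord _ (κ.map_target hy), κ.right_inv hy]
  rw [mder_congr e3, e1, mder_eq_fderiv] at e2
  rw [← hasFDerivAt_hyperplane (κ t) v, e2]
  simp only [Function.comp, κ.left_inv ht]
  rfl

end IsSlice

lemma IsSmoothDomain.contMDiff (h : IsSmoothDomain vol σ U ι) :
    ContMDiff (𝓡 n) (𝓡 (n + 1)) ∞ ι := fun s => by
  obtain ⟨ψ, κ, hs, hm⟩ := h.exists_slice s
  exact hs.contMDiffAt hm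

variable (vol σ ι) in
/-- The flux density through the boundary: `ι^*(i_Z vol) = flux(Z) σ`. -/
def flux (s : B) : Eu (n + 1) →ₗ[ℝ] ℝ where
  toFun Z := topQuot (((vol.at (ι s)).curryLeft Z).compContinuousLinearMap
    (mder (Eu n) (Eu (n + 1)) ι s)) (σ.at s)
  map_add' a b := by
    simp only [map_add, topQuot]
    exact add_div _ _ _
  map_smul' a b := by
    simp only [map_smul, topQuot]
    exact mul_div_assoc _ _ _

lemma hasDerivAt_flux {c : ℝ → Eu (n + 1)} {c' : Eu (n + 1)} {t : ℝ} (s : B)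
    (h : HasDerivAt c c' t) : HasDerivAt (fun e => flux vol σ ι s (c e)) (flux vol σ ι s c') t :=
  (LinearMap.toContinuousLinearMap (flux vol σ ι s)).hasFDerivAt.comp_hasDerivAt t h

/-- On the coordinate frame of `κ` the determinant has the components of `Z` as its first column and
the vectors `stdVec j.succ` as the others, so it is the component of `Z` transverse to the boundary.
-/
lemma IsSlice.flux_eq {ψ : OpenPartialHomeomorph X (Eu (n + 1))}
    {κ : OpenPartialHomeomorph B (Eu n)} (h : IsSlice vol σ U ι ψ κ) {t : B} (ht : t ∈ κ.source)
    (Z : Eu (n + 1)) :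
    flux vol σ ι t Z = dchart ψ (ι t) Z 0 * formDensity vol.form ψ (ψ (ι t))
      / formDensity σ.form κ (κ t) := by
  have hσ := formDensity_ne_zero σ h.mem_atlas_boundary (κ.map_source ht)
  have hσ' : formDensity σ.form κ (κ t) = σ.at t (fun i => dsymm κ (κ t) (stdVec i)) := by
    rw [formDensity_eq, κ.left_inv ht]
  rw [hσ'] at hσ
  show topQuot _ _ = _
  rw [topQuot_eq_div (σ.at_ne_zero t) hσ, hσ']
  congr 1
  have e : (((vol.at (ι t)).curryLeft Z).compContinuousLinearMap
      (mder (Eu n) (Eu (n + 1)) ι t)) (fun i => dsymm κ (κ t) (stdVec i))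
      = vol.at (ι t) (Fin.cons Z fun i => mder (Eu n) (Eu (n + 1)) ι t
          (dsymm κ (κ t) (stdVec i))) := rfl
  rw [e, vol.at_eq h.mem_atlas ((h.source_iff t).1 ht), mul_comm]
  congr 1
  rw [← baseVol_cons_succ]
  congr 1
  funext i
  refine Fin.cases ?_ (fun j => ?_) i
  · rfl
  · simp only [Fin.cons_succ]
    rw [h.dchart_mfderiv ht, hyperplane_stdVec]

/-- The components of a vector field in a chart. -/
def vcoord (ψ : OpenPartialHomeomorph X (Eu (n + 1))) (Z : X → Eu (n + 1)) (z : Eu (n + 1)) :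
    Eu (n + 1) := dchart ψ (ψ.symm z) (Z (ψ.symm z))

/-- The derivative of a function along a vector. -/
def dirDeriv (χ : X → ℝ) (x : X) (v : Eu (n + 1)) : ℝ :=
  mder (Eu (n + 1)) ℝ χ x v

lemma dirDeriv_eq_zero {χ : X → ℝ} {x : X} (h : x ∉ tsupport χ) (v : Eu (n + 1)) :
    dirDeriv χ x v = 0 := by
  have : χ =ᶠ[𝓝 x] fun _ => (0 : ℝ) := notMem_tsupport_iff_eventuallyEq.1 h
  unfold dirDeriv
  rw [mder_congr this]
  show (mfderiv (𝓡 (n + 1)) 𝓘(ℝ, ℝ) (fun _ : X => (0 : ℝ)) x : Eu (n + 1) →L[ℝ] ℝ) v = 0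
  rw [mfderiv_const]
  rfl

lemma dirDeriv_chart {ψ : OpenPartialHomeomorph X (Eu (n + 1))}
    (hψ : ψ ∈ IsManifold.maximalAtlas (𝓡 (n + 1)) ∞ X) {χ : X → ℝ}
    (hχ : ContMDiff (𝓡 (n + 1)) 𝓘(ℝ, ℝ) ∞ χ) {x : X} (hx : x ∈ ψ.source) (v : Eu (n + 1)) :
    fderiv ℝ (χ ∘ ψ.symm) (ψ x) (dchart ψ x v) = dirDeriv χ x v := by
  have h1 : MDifferentiableAt (𝓡 (n + 1)) 𝓘(ℝ, ℝ) χ (ψ.symm (ψ x)) :=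
    (hχ _).mdifferentiableAt (by simp)
  have h2 : MDifferentiableAt (𝓡 (n + 1)) (𝓡 (n + 1)) ψ.symm (ψ x) :=
    (contMDiffAt_chart_symm hψ (ψ.map_source hx)).mdifferentiableAt (by simp)
  have h3 := mder_comp h1 h2
  rw [mder_eq_fderiv] at h3
  have h5 : dsymm ψ (ψ x) (dchart ψ x v) = v := dsymm_dchart hψ hx v
  rw [h3, ContinuousLinearMap.comp_apply, ← dsymm, h5, ψ.left_inv hx]
  rfl

lemma contDiffAt_comp_symm {ψ : OpenPartialHomeomorph X (Eu (n + 1))}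
    (hψ : ψ ∈ IsManifold.maximalAtlas (𝓡 (n + 1)) ∞ X) {χ : X → ℝ}
    (hχ : ContMDiff (𝓡 (n + 1)) 𝓘(ℝ, ℝ) ∞ χ) {z : Eu (n + 1)} (hz : z ∈ ψ.target) :
    ContDiffAt ℝ ∞ (χ ∘ ψ.symm) z :=
  (ContMDiffAt.comp z (hχ _) (contMDiffAt_chart_symm hψ hz)).contDiffAt

lemma divergence_smul {f : Eu (n + 1) → ℝ} {Y : Eu (n + 1) → Eu (n + 1)} {z : Eu (n + 1)}
    (hf : DifferentiableAt ℝ f z) (hY : DifferentiableAt ℝ Y z) :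
    divergence (fun w => f w • Y w) z = f z * divergence Y z + fderiv ℝ f z (Y z) := by
  have hYμ : ∀ μ, DifferentiableAt ℝ (fun w => Y w μ) z := fun μ =>
    (EuclideanSpace.proj μ : Eu (n + 1) →L[ℝ] ℝ).differentiableAt.comp z hY
  have h : ∀ μ, fderiv ℝ (fun w => (f w • Y w) μ) z (stdVec μ)
      = f z * fderiv ℝ (fun w => Y w μ) z (stdVec μ) + Y z μ * fderiv ℝ f z (stdVec μ) := by
    intro μ
    have : HasFDerivAt (fun w => (f w • Y w) μ) _ z := hf.hasFDerivAt.mul (hYμ μ).hasFDerivAt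
    rw [this.fderiv]
    simp
  unfold divergence
  simp only [h, Finset.sum_add_distrib, ← Finset.mul_sum]
  congr 1
  conv_rhs => rw [eu_sum (Y z), map_sum]
  refine Finset.sum_congr rfl fun μ _ => ?_
  exact ((fderiv ℝ f z).map_smul (Y z μ) (stdVec μ)).symm

end Stokes


/-! ### Stokes' theorem: cutoffs in charts and patching -/

section Stokes

variable {n : ℕ} {X B : Type*}
  [TopologicalSpace X] [T2Space X] [ChartedSpace (Eu (n + 1)) X] [IsManifold (𝓡 (n + 1)) ∞ X]
  [TopologicalSpace B] [ChartedSpace (Eu n) B] [IsManifold (𝓡 n) ∞ B]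
  {vol : VolumeForm (n + 1) X} {σ : VolumeForm n B} {U : Set X} {ι : B → X}

/-- A vector field in a chart, cut off by `χ` and multiplied by the density of the measure. -/
def cutField (vol : VolumeForm (n + 1) X) (ψ : OpenPartialHomeomorph X (Eu (n + 1)))
    (χ : X → ℝ) (G : Eu (n + 1) → Eu (n + 1)) : Eu (n + 1) → Eu (n + 1) :=
  ψ.target.indicator fun w => (χ (ψ.symm w) * |formDensity vol.form ψ w|) • G w

/-- The chart `ψ`, the cutoff `χ` supported in it, and a smooth extension `G` of the components of
the vector field `Z` on the closure of `U`, near the support of `χ`. -/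
structure IsCutoff (vol : VolumeForm (n + 1) X) (U : Set X) (Z : X → Eu (n + 1)) (D : X → ℝ)
    (ψ : OpenPartialHomeomorph X (Eu (n + 1))) (χ : X → ℝ) (G : Eu (n + 1) → Eu (n + 1)) :
    Prop where
  mem_atlas : ψ ∈ IsManifold.maximalAtlas (𝓡 (n + 1)) ∞ X
  isOpen : IsOpen U
  smooth : ContMDiff (𝓡 (n + 1)) 𝓘(ℝ, ℝ) ∞ χ
  compact : IsCompact (tsupport χ)
  subset : tsupport χ ⊆ ψ.source
  contDiffAt : ∀ x ∈ tsupport χ, ContDiffAt ℝ 1 G (ψ x)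
  extends_field : ∀ x ∈ tsupport χ, ∀ᶠ w in 𝓝 (ψ x), ψ.symm w ∈ closure U → G w = vcoord ψ Z w
  div_eq : ∀ x ∈ U, x ∈ ψ.source →
    divergence (fun w => formDensity vol.form ψ w • vcoord ψ Z w) (ψ x)
      = D x * formDensity vol.form ψ (ψ x)

namespace IsCutoff

variable {Z : X → Eu (n + 1)} {D : X → ℝ} {ψ : OpenPartialHomeomorph X (Eu (n + 1))} {χ : X → ℝ}
  {G : Eu (n + 1) → Eu (n + 1)}

lemma isCompact_image (h : IsCutoff vol U Z D ψ χ G) : IsCompact (ψ '' tsupport χ) :=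
  h.compact.image_of_continuousOn (ψ.continuousOn.mono h.subset)

lemma cutField_eventually_zero (h : IsCutoff vol U Z D ψ χ G) {w : Eu (n + 1)}
    (hw : w ∉ ψ '' tsupport χ) : cutField vol ψ χ G =ᶠ[𝓝 w] fun _ => 0 := by
  filter_upwards [h.isCompact_image.isClosed.isOpen_compl.mem_nhds hw] with v hv
  by_cases hvt : v ∈ ψ.target
  · rw [cutField, indicator_of_mem hvt]
    have : χ (ψ.symm v) = 0 := by
      by_contra hne
      exact hv ⟨ψ.symm v, subset_tsupport _ hne, ψ.right_inv hvt⟩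
    simp [this]
  · rw [cutField, indicator_of_notMem hvt]

/-- Near the image of the support of `χ` every factor is regular, the absolute value because the
density does not vanish; elsewhere the field is locally zero, which makes the extension by zero
harmless. -/
lemma contDiff_cutField (h : IsCutoff vol U Z D ψ χ G) : ContDiff ℝ 1 (cutField vol ψ χ G) := by
  rw [contDiff_iff_contDiffAt]
  intro w
  by_cases hw : w ∈ ψ '' tsupport χ
  · obtain ⟨x, hx, rfl⟩ := hw
    have hxt := ψ.map_source (h.subset hx)
    have hf := contDiffAt_formDensity vol h.mem_atlas hxt
    have habs : ContDiffAt ℝ ∞ (fun w => |formDensity vol.form ψ w|) (ψ x) :=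
      hf.abs (formDensity_ne_zero vol h.mem_atlas hxt)
    have hχ := contDiffAt_comp_symm h.mem_atlas h.smooth hxt
    have hle : (1 : ℕ∞ω) ≤ ∞ := by exact_mod_cast le_top
    refine (((hχ.of_le hle).mul (habs.of_le hle)).smul
      (h.contDiffAt x hx)).congr_of_eventuallyEq ?_
    filter_upwards [ψ.open_target.mem_nhds hxt] with v hv
    rw [cutField, indicator_of_mem hv]
    rfl
  · exact contDiffAt_const.congr_of_eventuallyEq (h.cutField_eventually_zero hw)

lemma tsupport_cutField (h : IsCutoff vol U Z D ψ χ G) :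
    tsupport (cutField vol ψ χ G) ⊆ ψ '' tsupport χ := by
  refine closure_minimal (fun w hw => ?_) h.isCompact_image.isClosed
  by_contra hn
  exact hw (h.cutField_eventually_zero hn).self_of_nhds

lemma hasCompactSupport_cutField (h : IsCutoff vol U Z D ψ χ G) :
    HasCompactSupport (cutField vol ψ χ G) :=
  h.isCompact_image.of_isClosed_subset (isClosed_tsupport _) h.tsupport_cutField

/-- The divergence of the cut off field. -/
lemma divergence_cutField (h : IsCutoff vol U Z D ψ χ G) {x : X} (hxU : x ∈ U)
    (hxs : x ∈ ψ.source) :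
    divergence (cutField vol ψ χ G) (ψ x)
      = |formDensity vol.form ψ (ψ x)| * (χ x * D x + dirDeriv χ x (Z x)) := by
  by_cases hx : x ∈ tsupport χ
  · have hxt := ψ.map_source hxs
    set f := formDensity vol.form ψ with hf
    have hfx : f (ψ x) ≠ 0 := formDensity_ne_zero vol h.mem_atlas hxt
    have hfd := contDiffAt_formDensity vol h.mem_atlas hxt
    have hχ := contDiffAt_comp_symm h.mem_atlas h.smooth hxt
    -- The sign of the density is locally constant, so the absolute value contributes only a
    -- constant factor to the derivatives.
    set s : ℝ := ((SignType.sign (f (ψ x)) : SignType) : ℝ) with hs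
    have hsgn : ∀ᶠ w in 𝓝 (ψ x), |f w| = s * f w := by
      rcases lt_or_gt_of_ne hfx with hlt | hgt
      · filter_upwards [hfd.continuousAt.eventually_lt continuousAt_const hlt] with w hw
        rw [abs_of_neg hw, hs, sign_neg hlt]
        simp [hf]
      · filter_upwards [continuousAt_const.eventually_lt hfd.continuousAt hgt] with w hw
        rw [abs_of_pos hw, hs, sign_pos hgt]
        simp [hf]
    have hU : ∀ᶠ w in 𝓝 (ψ x), ψ.symm w ∈ U := by
      have hc := ψ.continuousAt_symm hxt
      refine hc.eventually_mem (h.isOpen.mem_nhds ?_)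
      rwa [ψ.left_inv hxs]
    -- At a point of the open set `U` the extension `G` agrees with the field on a full
    -- neighbourhood, so their divergences agree.
    have hG : ∀ᶠ w in 𝓝 (ψ x), G w = vcoord ψ Z w := by
      filter_upwards [h.extends_field x hx, hU] with w hw hwU
      exact hw (subset_closure hwU)
    have hfG : DifferentiableAt ℝ (fun w => f w • G w) (ψ x) :=
      (hfd.differentiableAt (by simp)).smul ((h.contDiffAt x hx).differentiableAt (by norm_num))
    have hsχ : DifferentiableAt ℝ (fun w => s * (χ ∘ ψ.symm) w) (ψ x) :=
      (hχ.differentiableAt (by simp)).const_mul s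
    have e1 : cutField vol ψ χ G =ᶠ[𝓝 (ψ x)]
        fun w => (s * (χ ∘ ψ.symm) w) • (f w • G w) := by
      filter_upwards [hsgn, ψ.open_target.mem_nhds hxt] with w hw hwt
      rw [cutField, indicator_of_mem hwt, smul_smul]
      congr 1
      rw [← hf, hw]
      simp only [Function.comp]
      ring
    have e2 : (fun w => f w • G w) =ᶠ[𝓝 (ψ x)] fun w => f w • vcoord ψ Z w := by
      filter_upwards [hG] with w hw
      rw [hw]
    have hcongr : ∀ {Y Y' : Eu (n + 1) → Eu (n + 1)}, Y =ᶠ[𝓝 (ψ x)] Y' →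
        divergence Y (ψ x) = divergence Y' (ψ x) := by
      intro Y Y' hY
      refine Finset.sum_congr rfl fun μ _ => ?_
      have : (fun w => Y w μ) =ᶠ[𝓝 (ψ x)] fun w => Y' w μ := by
        filter_upwards [hY] with w hw
        rw [hw]
      rw [this.fderiv_eq]
    rw [hcongr e1, divergence_smul hsχ hfG, hcongr e2, h.div_eq x hxU hxs,
      fderiv_const_mul (hχ.differentiableAt (by simp)), hsgn.self_of_nhds, hG.self_of_nhds]
    have e3 : vcoord ψ Z (ψ x) = dchart ψ x (Z x) := by rw [vcoord, ψ.left_inv hxs]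
    have e4 := dirDeriv_chart h.mem_atlas h.smooth hxs (Z x)
    simp only [Function.comp, ψ.left_inv hxs, e3, map_smul, _root_.smul_apply, smul_eq_mul,
      Function.comp_def] at e4 ⊢
    rw [e4]
    ring
  · have h0 : χ x = 0 := image_eq_zero_of_notMem_tsupport hx
    rw [h0, dirDeriv_eq_zero hx, divergence_eq_zero]
    · ring
    · intro hmem
      obtain ⟨y, hy, hyx⟩ := h.tsupport_cutField hmem
      rw [ψ.injOn (h.subset hy) hxs hyx] at hy
      exact hx hy

variable [MeasurableSpace X] [BorelSpace X] {m : Measure X}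

/-- The integral over the domain, in the chart. -/
lemma integral_domain (h : IsCutoff vol U Z D ψ χ G) (hm : IsVolumeMeasure vol m) :
    IntegrableOn (fun x => χ x * D x + dirDeriv χ x (Z x)) U m ∧
    ∫ x in U, (χ x * D x + dirDeriv χ x (Z x)) ∂m
      = ∫ w in ψ.target ∩ ψ.symm ⁻¹' U, divergence (cutField vol ψ χ G) w := by
  set g : X → ℝ := fun x => χ x * D x + dirDeriv χ x (Z x) with hg
  set V := ψ.target ∩ ψ.symm ⁻¹' U with hV
  have hVo : IsOpen V := ψ.isOpen_inter_preimage_symm h.isOpen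
  have hcont := continuous_divergence h.contDiff_cutField
  have hw : ∀ w ∈ ψ.target, |formDensity vol.form ψ w| * U.indicator g (ψ.symm w)
      = V.indicator (divergence (cutField vol ψ χ G)) w := by
    intro w hwt
    by_cases hwU : ψ.symm w ∈ U
    · have hwV : w ∈ V := ⟨hwt, hwU⟩
      rw [indicator_of_mem hwU, indicator_of_mem hwV]
      have := h.divergence_cutField hwU (ψ.map_target hwt)
      rw [ψ.right_inv hwt] at this
      rw [this]
    · have hwV : w ∉ V := fun hh => hwU hh.2
      rw [indicator_of_notMem hwU, indicator_of_notMem hwV, mul_zero]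
  -- No regularity of `D` is assumed; measurability is recovered from the continuous divergence by
  -- dividing by the density.
  have hmeas : AEStronglyMeasurable (fun w => U.indicator g (ψ.symm w))
      (volume.restrict ψ.target) := by
    have h1 : AEStronglyMeasurable (fun w => |formDensity vol.form ψ w|⁻¹
        * V.indicator (divergence (cutField vol ψ χ G)) w) (volume.restrict ψ.target) := by
      refine AEStronglyMeasurable.mul ?_
        (hcont.stronglyMeasurable.indicator hVo.measurableSet).aestronglyMeasurable
      refine ContinuousOn.aestronglyMeasurable ?_ ψ.open_target.measurableSet
      exact (continuousOn_formDensity vol h.mem_atlas).abs.inv₀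
        fun w hw => abs_ne_zero.2 (formDensity_ne_zero vol h.mem_atlas hw)
    refine h1.congr ?_
    filter_upwards [ae_restrict_mem ψ.open_target.measurableSet] with w hwt
    rw [← hw w hwt, inv_mul_cancel_left₀]
    exact abs_ne_zero.2 (formDensity_ne_zero vol h.mem_atlas hwt)
  have hint : Integrable (divergence (cutField vol ψ χ G)) :=
    hcont.integrable_of_hasCompactSupport
      (hasCompactSupport_divergence h.hasCompactSupport_cutField)
  have hI : IntegrableOn (U.indicator g) ψ.source m := by
    refine hm.integrableOn_source h.mem_atlas hmeas ?_
    refine (IntegrableOn.congr_fun (f := V.indicator (divergence (cutField vol ψ χ G))) ?_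
      (fun w hwt => (hw w hwt).symm) ψ.open_target.measurableSet)
    exact (hint.indicator hVo.measurableSet).integrableOn
  have hzero : ∀ x ∉ ψ.source, U.indicator g x = 0 := by
    intro x hx
    have hx' : x ∉ tsupport χ := fun hh => hx (h.subset hh)
    by_cases hxU : x ∈ U
    · rw [indicator_of_mem hxU, hg]
      simp only
      rw [dirDeriv_eq_zero hx', image_eq_zero_of_notMem_tsupport hx']
      ring
    · rw [indicator_of_notMem hxU]
  constructor
  · rw [← integrable_indicator_iff h.isOpen.measurableSet]
    rw [← integrableOn_univ]
    exact (integrableOn_iff_integrable_of_support_subset (fun x hx => by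
      by_contra hn; exact hx (hzero x hn))).1 hI |>.integrableOn
  · rw [← integral_indicator h.isOpen.measurableSet,
      ← setIntegral_eq_integral_of_forall_compl_eq_zero hzero,
      hm.setIntegral_source h.mem_atlas hmeas,
      setIntegral_congr_fun ψ.open_target.measurableSet hw,
      setIntegral_indicator hVo.measurableSet, inter_eq_right.2 inter_subset_left]

/-- The cutoff is supported inside the domain. -/
lemma integral_interior (h : IsCutoff vol U Z D ψ χ G) (hm : IsVolumeMeasure vol m)
    (hU : ψ.source ⊆ U) :
    ∫ x in U, (χ x * D x + dirDeriv χ x (Z x)) ∂m = 0 := by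
  have hV : ψ.target ∩ ψ.symm ⁻¹' U = ψ.target :=
    inter_eq_left.2 fun w hw => hU (ψ.map_target hw)
  rw [(h.integral_domain hm).2, hV, setIntegral_eq_integral_of_forall_compl_eq_zero]
  · exact integral_divergence h.contDiff_cutField h.hasCompactSupport_cutField
  · intro w hw
    refine divergence_eq_zero fun hmem => hw ?_
    obtain ⟨x, hx, rfl⟩ := h.tsupport_cutField hmem
    exact ψ.map_source (h.subset hx)

variable [MeasurableSpace B] [BorelSpace B] {mB : Measure B}

/-- The cutoff is supported in a slice chart at the boundary. -/
lemma integral_boundary (h : IsCutoff vol U Z D ψ χ G) (hm : IsVolumeMeasure vol m)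
    (hmB : IsVolumeMeasure σ mB) (hdom : IsSmoothDomain vol σ U ι)
    {κ : OpenPartialHomeomorph B (Eu n)} (hs : IsSlice vol σ U ι ψ κ) :
    Integrable (fun s => χ (ι s) * flux vol σ ι s (Z (ι s))) mB ∧
    ∫ x in U, (χ x * D x + dirDeriv χ x (Z x)) ∂m
      = ∫ s, χ (ι s) * flux vol σ ι s (Z (ι s)) ∂mB := by
  set H := cutField vol ψ χ G with hH
  set g : B → ℝ := fun s => χ (ι s) * flux vol σ ι s (Z (ι s)) with hg
  have hcl : ∀ s, ι s ∈ closure U := fun s =>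
    frontier_subset_closure (hdom.range_eq ▸ mem_range_self s)
  have hzero : ∀ s ∉ κ.source, g s = 0 := by
    intro s hsn
    have : ι s ∉ tsupport χ := fun hh => hsn ((hs.source_iff s).2 (h.subset hh))
    simp only [hg]
    rw [image_eq_zero_of_notMem_tsupport this, zero_mul]
  -- In the boundary chart, the flux integrand is the transverse component of the cut off field.
  have hw : ∀ y ∈ κ.target, |formDensity σ.form κ y| * g (κ.symm y) = H (hyperplane y) 0 := by
    intro y hy
    set t := κ.symm y with ht
    have hts : t ∈ κ.source := κ.map_target hy
    have hκt : κ t = y := κ.right_inv hy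
    have hψt : ψ (ι t) = hyperplane y := by rw [hs.coord t hts, hκt]
    have hιs := (hs.source_iff t).1 hts
    have hyt : hyperplane y ∈ ψ.target := hψt ▸ ψ.map_source hιs
    have hsymm : ψ.symm (hyperplane y) = ι t := by rw [← hψt, ψ.left_inv hιs]
    simp only [hg, hH]
    rw [cutField, indicator_of_mem hyt, hsymm]
    by_cases hx : ι t ∈ tsupport χ
    · have hG : G (hyperplane y) = dchart ψ (ι t) (Z (ι t)) := by
        have := (h.extends_field (ι t) hx).self_of_nhds
        rw [hψt, hsymm] at this
        rw [this (hcl t), vcoord, hsymm]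
      have hpos := hs.pos t hts
      rw [hψt, hκt] at hpos
      have hσ : formDensity σ.form κ y ≠ 0 := formDensity_ne_zero σ hs.mem_atlas_boundary hy
      rw [hs.flux_eq hts, hψt, hκt, ← hG]
      simp only [PiLp.smul_apply, smul_eq_mul]
      set a := formDensity vol.form ψ (hyperplane y)
      set b := formDensity σ.form κ y
      -- The boundary orientation enters here: the two densities have the same sign.
      have hab : |b| * (a / b) = |a| := by
        rcases lt_or_gt_of_ne hσ with hb | hb
        · have ha : a < 0 := by nlinarith
          rw [abs_of_neg hb, abs_of_neg ha]; field_simp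
        · have ha : 0 < a := by nlinarith
          rw [abs_of_pos hb, abs_of_pos ha]; field_simp
      rw [← hab]
      ring
    · rw [image_eq_zero_of_notMem_tsupport hx]
      simp
  have hHc : Continuous (fun y : Eu n => H (hyperplane y) 0) :=
    (EuclideanSpace.proj (0 : Fin (n + 1)) : Eu (n + 1) →L[ℝ] ℝ).continuous.comp
      (h.contDiff_cutField.continuous.comp contDiff_hyperplane.continuous)
  -- A point of the hyperplane in the image of the support of `χ` lies outside `U` and in its
  -- closure, hence on the frontier, hence in the image of `ι`; its coordinates then lie in the
  -- target of `κ`.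
  have hHz : ∀ y ∉ κ.target, H (hyperplane y) 0 = 0 := by
    intro y hy
    suffices hyperplane y ∉ ψ '' tsupport χ by
      rw [hH, (h.cutField_eventually_zero this).self_of_nhds]; rfl
    rintro ⟨x, hx, hxy⟩
    have hxs := h.subset hx
    have hxU : x ∉ U := fun hh => by
      have := (hs.mem_iff x hxs).1 hh
      rw [hxy] at this
      simp at this
    have hxcl : x ∈ closure U := by
      rw [← ψ.left_inv hxs, hxy]
      have hyt : hyperplane y ∈ ψ.target := hxy ▸ ψ.map_source hxs
      -- The point is approached from the side `z⁰ < 0`, which is `U` in the chart.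
      have hline : Tendsto (fun e : ℝ => hyperplane y - e • (stdVec 0 : Eu (n + 1))) (𝓝[>] 0)
          (𝓝 (hyperplane y)) := by
        have : Continuous fun e : ℝ => hyperplane y - e • (stdVec 0 : Eu (n + 1)) := by fun_prop
        have h0 := (this.tendsto 0).mono_left (nhdsWithin_le_nhds (s := Ioi 0))
        simpa using h0
      refine mem_closure_of_tendsto ((ψ.continuousAt_symm hyt).tendsto.comp hline) ?_
      filter_upwards [hline.eventually (ψ.open_target.mem_nhds hyt), self_mem_nhdsWithin]
        with e he hpos
      refine (hs.mem_iff _ (ψ.map_target he)).2 ?_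
      rw [ψ.right_inv he]
      simpa [stdVec] using hpos
    have : x ∈ frontier U := ⟨hxcl, by rwa [h.isOpen.interior_eq]⟩
    rw [← hdom.range_eq] at this
    obtain ⟨t, rfl⟩ := this
    have hts := (hs.source_iff t).2 hxs
    rw [hs.coord t hts] at hxy
    have : κ t = y := by
      ext j
      have := congrArg (fun z : Eu (n + 1) => z j.succ) hxy
      simpa using this
    exact hy (this ▸ κ.map_source hts)
  have hHcs : HasCompactSupport (fun y : Eu n => H (hyperplane y) 0) := by
    have hemb : Topology.IsClosedEmbedding (hyperplane : Eu n → Eu (n + 1)) := by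
      refine Topology.IsClosedEmbedding.of_continuous_injective_isClosedMap
        contDiff_hyperplane.continuous ?_ ?_
      · intro a b hab
        ext j
        have := congrArg (fun z : Eu (n + 1) => z j.succ) hab
        simpa using this
      · have hiso : Isometry (hyperplane : Eu n → Eu (n + 1)) := by
          refine Isometry.of_dist_eq fun a b => ?_
          rw [EuclideanSpace.dist_eq, EuclideanSpace.dist_eq, Fin.sum_univ_succ]
          simp
        exact hiso.isClosedEmbedding.isClosedMap
    exact (h.hasCompactSupport_cutField.comp_isClosedEmbedding hemb).comp_left
      (g := fun z : Eu (n + 1) => z 0) rfl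
  have hmeas : AEStronglyMeasurable (fun y => g (κ.symm y)) (volume.restrict κ.target) := by
    have h1 : AEStronglyMeasurable (fun y => |formDensity σ.form κ y|⁻¹ * H (hyperplane y) 0)
        (volume.restrict κ.target) := by
      refine AEStronglyMeasurable.mul ?_ hHc.aestronglyMeasurable
      refine ContinuousOn.aestronglyMeasurable ?_ κ.open_target.measurableSet
      exact (continuousOn_formDensity σ hs.mem_atlas_boundary).abs.inv₀
        fun w hw => abs_ne_zero.2 (formDensity_ne_zero σ hs.mem_atlas_boundary hw)
    refine h1.congr ?_
    filter_upwards [ae_restrict_mem κ.open_target.measurableSet] with w hwt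
    rw [← hw w hwt, inv_mul_cancel_left₀]
    exact abs_ne_zero.2 (formDensity_ne_zero σ hs.mem_atlas_boundary hwt)
  have hI : IntegrableOn g κ.source mB := by
    refine hmB.integrableOn_source hs.mem_atlas_boundary hmeas ?_
    refine IntegrableOn.congr_fun (f := fun y => H (hyperplane y) 0) ?_
      (fun w hwt => (hw w hwt).symm) κ.open_target.measurableSet
    exact (hHc.integrable_of_hasCompactSupport hHcs).integrableOn
  refine ⟨(integrableOn_iff_integrable_of_support_subset (fun x hx => by
      by_contra hn; exact hx (hzero x hn))).1 hI, ?_⟩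
  rw [(h.integral_domain hm).2, ← setIntegral_eq_integral_of_forall_compl_eq_zero hzero,
    hmB.setIntegral_source hs.mem_atlas_boundary hmeas,
    setIntegral_congr_fun κ.open_target.measurableSet hw,
    setIntegral_eq_integral_of_forall_compl_eq_zero hHz,
    ← integral_halfSpace_divergence h.contDiff_cutField h.hasCompactSupport_cutField]
  have hmeas0 : MeasurableSet {z : Eu (n + 1) | z 0 < 0} :=
    (isOpen_lt (EuclideanSpace.proj (0 : Fin (n + 1))).continuous continuous_const).measurableSet
  symm
  -- Inside the chart `U` is the half space, and the part of the half space outside the chart does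
  -- not meet the support.
  refine setIntegral_eq_of_subset_of_forall_sdiff_eq_zero hmeas0 ?_ ?_
  · rintro w ⟨hwt, hwU⟩
    have := (hs.mem_iff _ (ψ.map_target hwt)).1 hwU
    rwa [ψ.right_inv hwt] at this
  · rintro w ⟨hw0, hwn⟩
    refine divergence_eq_zero fun hmem => hwn ?_
    obtain ⟨x, hx, rfl⟩ := h.tsupport_cutField hmem
    have hxs := h.subset hx
    exact ⟨ψ.map_source hxs, by
      show ψ.symm (ψ x) ∈ U
      rw [ψ.left_inv hxs]
      exact (hs.mem_iff x hxs).2 hw0⟩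

end IsCutoff

variable [MeasurableSpace X] [BorelSpace X] {m : Measure X}
  [MeasurableSpace B] [BorelSpace B] {mB : Measure B}

variable (vol U) in
/-- The vector field `Z` on the closure of `U` is smooth up to the boundary and has divergence
`D` on `U`. -/
structure HasDivergence (Z : X → Eu (n + 1)) (D : X → ℝ) : Prop where
  smooth : ∀ x ∈ closure U, ∀ ψ ∈ IsManifold.maximalAtlas (𝓡 (n + 1)) ∞ X, x ∈ ψ.source →
    ∃ G, ContDiffAt ℝ 1 G (ψ x) ∧ ∀ᶠ w in 𝓝 (ψ x), ψ.symm w ∈ closure U → G w = vcoord ψ Z w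
  div_eq : ∀ x ∈ U, ∀ ψ ∈ IsManifold.maximalAtlas (𝓡 (n + 1)) ∞ X, x ∈ ψ.source →
    divergence (fun w => formDensity vol.form ψ w • vcoord ψ Z w) (ψ x)
      = D x * formDensity vol.form ψ (ψ x)

/-- The local extension stays valid at all points of some compact neighbourhood. Cutoffs supported
in the interior of that neighbourhood automatically have compact support. -/
lemma HasDivergence.exists_local {Z : X → Eu (n + 1)} {D : X → ℝ}
    (hZ : HasDivergence vol U Z D) (hU : IsOpen U) {x : X} (hx : x ∈ closure U)
    {ψ : OpenPartialHomeomorph X (Eu (n + 1))}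
    (hψ : ψ ∈ IsManifold.maximalAtlas (𝓡 (n + 1)) ∞ X) (hxψ : x ∈ ψ.source) :
    ∃ W G, IsOpen W ∧ x ∈ W ∧ ∀ χ : X → ℝ, ContMDiff (𝓡 (n + 1)) 𝓘(ℝ, ℝ) ∞ χ →
      tsupport χ ⊆ W → IsCutoff vol U Z D ψ χ G := by
  obtain ⟨G, hG, hGZ⟩ := hZ.smooth x hx ψ hψ hxψ
  have h1 : ∀ᶠ w in 𝓝 (ψ x), ContDiffAt ℝ 1 G w ∧
      ∀ᶠ v in 𝓝 w, ψ.symm v ∈ closure U → G v = vcoord ψ Z v :=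
    (hG.eventually (by norm_num)).and hGZ.eventually_nhds
  have h2 := (ψ.continuousAt hxψ).eventually h1
  have : LocallyCompactSpace X := ChartedSpace.locallyCompactSpace (Eu (n + 1)) X
  obtain ⟨K, hK, hKs, hKc⟩ := LocallyCompactSpace.local_compact_nhds x _
    (inter_mem h2 (ψ.open_source.mem_nhds hxψ))
  refine ⟨interior K, G, isOpen_interior, mem_interior_iff_mem_nhds.2 hK, fun χ hχ hsub => ?_⟩
  have hsub' : tsupport χ ⊆ K := hsub.trans interior_subset
  exact ⟨hψ, hU, hχ, hKc.of_isClosed_subset (isClosed_tsupport _) hsub',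
    fun y hy => (hKs (hsub' hy)).2, fun y hy => (hKs (hsub' hy)).1.1,
    fun y hy => (hKs (hsub' hy)).1.2, fun y hyU hys => hZ.div_eq y hyU ψ hψ hys⟩

/-- Around a point of `U` the flux term is absent and the integral of the divergence is zero; around
a boundary point a slice chart reduces to the half space. -/
lemma HasDivergence.stokes_local {Z : X → Eu (n + 1)} {D : X → ℝ}
    (hZ : HasDivergence vol U Z D) (hm : IsVolumeMeasure vol m)
    (hmB : IsVolumeMeasure σ mB) (hdom : IsSmoothDomain vol σ U ι) {x : X} (hx : x ∈ closure U) :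
    ∃ W, IsOpen W ∧ x ∈ W ∧ ∀ χ : X → ℝ, ContMDiff (𝓡 (n + 1)) 𝓘(ℝ, ℝ) ∞ χ →
      tsupport χ ⊆ W → IntegrableOn (fun x => χ x * D x + dirDeriv χ x (Z x)) U m ∧
        Integrable (fun s => χ (ι s) * flux vol σ ι s (Z (ι s))) mB ∧
        ∫ x in U, (χ x * D x + dirDeriv χ x (Z x)) ∂m
          = ∫ s, χ (ι s) * flux vol σ ι s (Z (ι s)) ∂mB := by
  by_cases hxU : x ∈ U
  -- The chart is restricted to `U` so that a cutoff supported in it does not see the boundary.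
  · set ψ := (chartAt (Eu (n + 1)) x).restr U with hψdef
    have hψ : ψ ∈ IsManifold.maximalAtlas (𝓡 (n + 1)) ∞ X :=
      restr_mem_maximalAtlas (contDiffGroupoid ∞ (𝓡 (n + 1)))
        (IsManifold.chart_mem_maximalAtlas x) hdom.isOpen
    have hsrc : ψ.source = (chartAt (Eu (n + 1)) x).source ∩ U := by
      rw [hψdef, OpenPartialHomeomorph.restr_source, hdom.isOpen.interior_eq]
    obtain ⟨W, G, hW, hxW, hc⟩ := hZ.exists_local hdom.isOpen hx hψ
      (hsrc ▸ ⟨mem_chart_source _ x, hxU⟩)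
    refine ⟨W, hW, hxW, fun χ hχ hsub => ?_⟩
    have h := hc χ hχ hsub
    have hsU : ψ.source ⊆ U := hsrc ▸ inter_subset_right
    have hz : (fun s => χ (ι s) * flux vol σ ι s (Z (ι s))) = fun _ => 0 := by
      funext s
      have hιs : ι s ∉ U := by
        have : ι s ∈ frontier U := hdom.range_eq ▸ mem_range_self s
        rw [hdom.isOpen.frontier_eq] at this
        exact this.2
      rw [image_eq_zero_of_notMem_tsupport fun hh => hιs (hsU (h.subset hh)), zero_mul]
    refine ⟨(h.integral_domain hm).1, ?_, ?_⟩
    · rw [hz]; exact integrable_zero _ _ _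
    · rw [hz, h.integral_interior hm hsU, integral_zero]
  · have hf : x ∈ frontier U := ⟨hx, by rwa [hdom.isOpen.interior_eq]⟩
    rw [← hdom.range_eq] at hf
    obtain ⟨s, rfl⟩ := hf
    obtain ⟨ψ, κ, hs, hsκ⟩ := hdom.exists_slice s
    obtain ⟨W, G, hW, hxW, hc⟩ := hZ.exists_local hdom.isOpen hx hs.mem_atlas
      ((hs.source_iff s).1 hsκ)
    refine ⟨W, hW, hxW, fun χ hχ hsub => ?_⟩
    have h := hc χ hχ hsub
    exact ⟨(h.integral_domain hm).1, h.integral_boundary hm hmB hdom hs⟩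

/-- **Stokes' theorem** on a relatively compact domain with smooth boundary. -/
theorem HasDivergence.stokes [SecondCountableTopology X] {Z : X → Eu (n + 1)} {D : X → ℝ}
    (hZ : HasDivergence vol U Z D) (hm : IsVolumeMeasure vol m)
    (hmB : IsVolumeMeasure σ mB) (hdom : IsSmoothDomain vol σ U ι) :
    ∫ x in U, D x ∂m = ∫ s, flux vol σ ι s (Z (ι s)) ∂mB := by
  have : LocallyCompactSpace X := ChartedSpace.locallyCompactSpace (Eu (n + 1)) X
  choose W hWo hxW hW using fun x : closure U => hZ.stokes_local hm hmB hdom x.2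
  obtain ⟨P, hP⟩ := SmoothPartitionOfUnity.exists_isSubordinate (𝓡 (n + 1))
    (isClosed_closure (s := U)) W hWo fun x hx => mem_iUnion.2 ⟨⟨x, hx⟩, hxW ⟨x, hx⟩⟩
  -- By compactness only finitely many members of the partition meet the closure of `U`.
  have hfin := P.locallyFinite.finite_nonempty_inter_compact hdom.isCompact_closure
  set I := hfin.toFinset with hI
  have hone : ∀ x ∈ closure U, ∑ i ∈ I, P i x = 1 := by
    intro x hx
    rw [← P.sum_eq_one hx, finsum_eq_sum_of_support_subset]
    intro i hi
    simp only [hI, Finite.coe_toFinset, mem_ofPred_eq]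
    exact ⟨x, hi, hx⟩
  have hloc := fun i => hW i (P i) (P i).contMDiff (hP i)
  -- The cutoffs sum to the constant `1` on the open set `U`, so the terms in which they are
  -- differentiated cancel.
  have hdir : ∀ x ∈ U, ∑ i ∈ I, dirDeriv (P i) x (Z x) = 0 := by
    intro x hx
    set ψ := chartAt (Eu (n + 1)) x
    have hψ : ψ ∈ IsManifold.maximalAtlas (𝓡 (n + 1)) ∞ X := IsManifold.chart_mem_maximalAtlas x
    have hxs : x ∈ ψ.source := mem_chart_source _ x
    simp only [← dirDeriv_chart hψ (P _).contMDiff hxs]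
    have hd : ∀ i ∈ I, DifferentiableAt ℝ (fun w => (P i ∘ ψ.symm) w) (ψ x) := fun i _ =>
      (contDiffAt_comp_symm hψ (P i).contMDiff (ψ.map_source hxs)).differentiableAt (by simp)
    have h1 := fderiv_fun_sum hd
    have h2 : (fun w => ∑ i ∈ I, (P i ∘ ψ.symm) w) =ᶠ[𝓝 (ψ x)] fun _ => 1 := by
      have hc := (ψ.continuousAt_symm (ψ.map_source hxs)).eventually_mem
        (hdom.isOpen.mem_nhds (by rwa [ψ.left_inv hxs]))
      filter_upwards [hc] with w hw
      exact hone _ (subset_closure hw)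
    rw [h2.fderiv_eq, fderiv_fun_const] at h1
    have h3 := congrArg (fun L : Eu (n + 1) →L[ℝ] ℝ => L (dchart ψ x (Z x))) h1
    simp only [_root_.sum_apply] at h3
    exact h3.symm
  calc ∫ x in U, D x ∂m
      = ∫ x in U, ∑ i ∈ I, (P i x * D x + dirDeriv (P i) x (Z x)) ∂m := by
        refine setIntegral_congr_fun hdom.isOpen.measurableSet fun x hx => ?_
        simp only [Finset.sum_add_distrib, ← Finset.sum_mul, hone x (subset_closure hx), hdir x hx]
        ring
    _ = ∑ i ∈ I, ∫ x in U, (P i x * D x + dirDeriv (P i) x (Z x)) ∂m :=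
        integral_finsetSum _ fun i _ => (hloc i).1
    _ = ∑ i ∈ I, ∫ s, P i (ι s) * flux vol σ ι s (Z (ι s)) ∂mB :=
        Finset.sum_congr rfl fun i _ => (hloc i).2.2
    _ = ∫ s, ∑ i ∈ I, P i (ι s) * flux vol σ ι s (Z (ι s)) ∂mB :=
        (integral_finsetSum _ fun i _ => (hloc i).2.1).symm
    _ = ∫ s, flux vol σ ι s (Z (ι s)) ∂mB := by
        congr 1
        funext s
        have : ι s ∈ closure U :=
          frontier_subset_closure (hdom.range_eq ▸ mem_range_self s)
        rw [← Finset.sum_mul, hone _ this, one_mul]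

end Stokes


/-! ### Adapted charts, jets, and the Legendre map -/

section Bundle

variable {n k : ℕ} {X Y : Type*}
  [TopologicalSpace X] [ChartedSpace (Eu (n + 1)) X] [IsManifold (𝓡 (n + 1)) ∞ X]
  [TopologicalSpace Y] [ChartedSpace (Eu (n + 1) × Eu k) Y]
  [IsManifold 𝓘(ℝ, Eu (n + 1) × Eu k) ∞ Y]

section TotalChart

variable {e : OpenPartialHomeomorph Y (Eu (n + 1) × Eu k)}

/-- The differential of a chart of the total space. -/
def ctot (e : OpenPartialHomeomorph Y (Eu (n + 1) × Eu k)) (y : Y) :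
    Eu (n + 1) × Eu k →L[ℝ] Eu (n + 1) × Eu k :=
  mder (Eu (n + 1) × Eu k) (Eu (n + 1) × Eu k) e y

/-- The differential of an inverse chart of the total space. -/
def ctotSymm (e : OpenPartialHomeomorph Y (Eu (n + 1) × Eu k)) (p : Eu (n + 1) × Eu k) :
    Eu (n + 1) × Eu k →L[ℝ] Eu (n + 1) × Eu k :=
  mder (Eu (n + 1) × Eu k) (Eu (n + 1) × Eu k) e.symm p

lemma mdifferentiableAt_total
    (he : e ∈ IsManifold.maximalAtlas 𝓘(ℝ, Eu (n + 1) × Eu k) ∞ Y) {y : Y} (hy : y ∈ e.source) :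
    MDifferentiableAt 𝓘(ℝ, Eu (n + 1) × Eu k) 𝓘(ℝ, Eu (n + 1) × Eu k) e y :=
  (contMDiffAt_of_mem_maximalAtlas he hy).mdifferentiableAt (by simp)

lemma mdifferentiableAt_total_symm
    (he : e ∈ IsManifold.maximalAtlas 𝓘(ℝ, Eu (n + 1) × Eu k) ∞ Y)
    {p : Eu (n + 1) × Eu k} (hp : p ∈ e.target) :
    MDifferentiableAt 𝓘(ℝ, Eu (n + 1) × Eu k) 𝓘(ℝ, Eu (n + 1) × Eu k) e.symm p :=
  (contMDiffAt_symm_of_mem_maximalAtlas he hp).mdifferentiableAt (by simp)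

lemma mdifferentiable_total
    (he : e ∈ IsManifold.maximalAtlas 𝓘(ℝ, Eu (n + 1) × Eu k) ∞ Y) :
    e.MDifferentiable 𝓘(ℝ, Eu (n + 1) × Eu k) 𝓘(ℝ, Eu (n + 1) × Eu k) :=
  ⟨fun _ hx => (mdifferentiableAt_total he hx).mdifferentiableWithinAt,
   fun _ hx => (mdifferentiableAt_total_symm he hx).mdifferentiableWithinAt⟩

lemma ctotSymm_ctot (he : e ∈ IsManifold.maximalAtlas 𝓘(ℝ, Eu (n + 1) × Eu k) ∞ Y) {y : Y}
    (hy : y ∈ e.source) (v : Eu (n + 1) × Eu k) : ctotSymm e (e y) (ctot e y v) = v :=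
  congrArg (fun L : Eu (n + 1) × Eu k →L[ℝ] Eu (n + 1) × Eu k => L v)
    ((mdifferentiable_total he).symm_comp_deriv hy)

lemma ctot_ctotSymm (he : e ∈ IsManifold.maximalAtlas 𝓘(ℝ, Eu (n + 1) × Eu k) ∞ Y) {y : Y}
    (hy : y ∈ e.source) (v : Eu (n + 1) × Eu k) : ctot e y (ctotSymm e (e y) v) = v := by
  have h := (mdifferentiable_total he).comp_symm_deriv (e.map_source hy)
  rw [e.left_inv hy] at h
  exact congrArg (fun L : Eu (n + 1) × Eu k →L[ℝ] Eu (n + 1) × Eu k => L v) h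

end TotalChart

variable {ρ : Y → X}

/-- The differential of the projection. -/
def dproj (ρ : Y → X) (y : Y) : Eu (n + 1) × Eu k →L[ℝ] Eu (n + 1) :=
  mder (Eu (n + 1) × Eu k) (Eu (n + 1)) ρ y

namespace AdaptedChart

variable (C : AdaptedChart n k ρ)

lemma base_source {y : Y} (hy : y ∈ C.total.source) : ρ y ∈ C.base.source := C.mapsTo y hy

lemma total_eq {y : Y} (hy : y ∈ C.total.source) :
    C.total y = (C.base (ρ y), (C.total y).2) := Prod.ext (C.fst_eq y hy) rfl

lemma proj_symm {p : Eu (n + 1) × Eu k} (hp : p ∈ C.total.target) :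
    ρ (C.total.symm p) = C.base.symm p.1 := by
  have h1 := C.total.map_target hp
  have h2 := C.fst_eq _ h1
  rw [C.total.right_inv hp] at h2
  rw [h2, C.base.left_inv (C.base_source h1)]

lemma mdifferentiableAt_base {x : X} (hx : x ∈ C.base.source) :
    MDifferentiableAt (𝓡 (n + 1)) (𝓡 (n + 1)) C.base x :=
  (contMDiffAt_chart C.base_mem hx).mdifferentiableAt (by simp)

lemma mdifferentiableAt_base_symm {z : Eu (n + 1)} (hz : z ∈ C.base.target) :
    MDifferentiableAt (𝓡 (n + 1)) (𝓡 (n + 1)) C.base.symm z :=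
  (contMDiffAt_chart_symm C.base_mem hz).mdifferentiableAt (by simp)

/-- The derivative of `fst_eq`. -/
lemma fst_ctot (hρ : IsFibred n k ρ) {y : Y} (hy : y ∈ C.total.source)
    (v : Eu (n + 1) × Eu k) :
    (ctot C.total y v).1 = dchart C.base (ρ y) (dproj ρ y v) := by
  have h1 : (fun y => (C.total y).1) =ᶠ[𝓝 y] C.base ∘ ρ := by
    filter_upwards [C.total.open_source.mem_nhds hy] with y' hy'
    exact C.fst_eq y' hy'
  have h2 : mder (Eu (n + 1) × Eu k) (Eu (n + 1)) (Prod.fst ∘ C.total) y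
      = (mder (Eu (n + 1) × Eu k) (Eu (n + 1)) Prod.fst (C.total y)).comp (ctot C.total y) :=
    mder_comp (mdifferentiableAt_iff_differentiableAt.2 differentiableAt_fst)
      (mdifferentiableAt_total C.total_mem hy)
  have h3 := mder_comp (C.mdifferentiableAt_base (C.base_source hy))
    ((hρ.smooth y).mdifferentiableAt (by simp))
  rw [← mder_congr h1] at h3
  have h4 := congrArg (fun L : Eu (n + 1) × Eu k →L[ℝ] Eu (n + 1) => L v) (h2.symm.trans h3)
  rw [mder_eq_fderiv, fderiv_fst] at h4
  exact h4

lemma dproj_eq_zero_iff (hρ : IsFibred n k ρ) {y : Y} (hy : y ∈ C.total.source)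
    (v : Eu (n + 1) × Eu k) : dproj ρ y v = 0 ↔ (ctot C.total y v).1 = 0 := by
  rw [C.fst_ctot hρ hy]
  refine ⟨fun h => by rw [h, map_zero], fun h => ?_⟩
  rw [← dsymm_dchart C.base_mem (C.base_source hy) (dproj ρ y v), h, map_zero]

/-- The vertical tangent vector `∂/∂y^a`, as a vector of the model space. -/
def cvert (y : Y) (a : Fin k) : Eu (n + 1) × Eu k :=
  ctotSymm C.total (C.total y) (0, stdVec a)

lemma ctot_cvert {y : Y} (hy : y ∈ C.total.source) (a : Fin k) :
    ctot C.total y (C.cvert y a) = (0, stdVec a) :=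
  ctot_ctotSymm C.total_mem hy _

lemma dproj_cvert (hρ : IsFibred n k ρ) {y : Y} (hy : y ∈ C.total.source) (a : Fin k) :
    dproj ρ y (C.cvert y a) = 0 := by
  rw [C.dproj_eq_zero_iff hρ hy, C.ctot_cvert hy]

lemma vertical_eq_sum (hρ : IsFibred n k ρ) {y : Y} (hy : y ∈ C.total.source)
    {v : Eu (n + 1) × Eu k} (hv : dproj ρ y v = 0) :
    v = ∑ a, (ctot C.total y v).2 a • C.cvert y a := by
  have h1 := (C.dproj_eq_zero_iff hρ hy v).1 hv
  have h2 : ctot C.total y v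
      = ∑ a, (ctot C.total y v).2 a • ((0, stdVec a) : Eu (n + 1) × Eu k) := by
    refine Prod.ext ?_ ?_
    · simp [Prod.fst_sum, h1]
    · rw [Prod.snd_sum]
      exact eu_sum _
  conv_lhs => rw [← ctotSymm_ctot C.total_mem hy v, h2, map_sum]
  refine Finset.sum_congr rfl fun a _ => ?_
  exact (ctotSymm C.total (C.total y)).map_smul _ _

/-! #### Changing the base coordinates -/

section Rebase

variable {ψ : OpenPartialHomeomorph X (Eu (n + 1))}

/-- The change of coordinates of the total space induced by one of the base. -/
def transition (ψ : OpenPartialHomeomorph X (Eu (n + 1))) :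
    OpenPartialHomeomorph (Eu (n + 1) × Eu k) (Eu (n + 1) × Eu k) :=
  (C.base.symm.trans ψ).prod (OpenPartialHomeomorph.refl (Eu k))

lemma mem_rebase_source {y : Y} :
    y ∈ (C.total.trans (C.transition ψ)).source ↔ y ∈ C.total.source ∧ ρ y ∈ ψ.source := by
  rw [OpenPartialHomeomorph.trans_source]
  refine and_congr_right fun hy => ?_
  have h1 := C.base_source hy
  simp only [transition, mem_preimage, OpenPartialHomeomorph.prod_source, mem_prod,
    OpenPartialHomeomorph.trans_source, OpenPartialHomeomorph.symm_source,
    OpenPartialHomeomorph.refl_source, mem_univ, and_true, mem_inter_iff]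
  rw [C.fst_eq y hy, C.base.left_inv h1]
  exact and_iff_right (C.base.map_source h1)

/-- The adapted chart with the same fibre coordinates and other base coordinates. -/
def rebase (ψ : OpenPartialHomeomorph X (Eu (n + 1)))
    (hψ : ψ ∈ IsManifold.maximalAtlas (𝓡 (n + 1)) ∞ X) : AdaptedChart n k ρ where
  base := ψ
  total := C.total.trans (C.transition ψ)
  base_mem := hψ
  total_mem := by
    have hsm : ∀ {c c' : OpenPartialHomeomorph X (Eu (n + 1))},
        c ∈ IsManifold.maximalAtlas (𝓡 (n + 1)) ∞ X → c' ∈ IsManifold.maximalAtlas (𝓡 (n + 1)) ∞ X →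
        ∀ z ∈ (c.symm.trans c').source, ContMDiffAt (𝓡 (n + 1)) (𝓡 (n + 1)) ∞ (c.symm.trans c') z := by
      intro c c' hc hc' z hz
      rw [OpenPartialHomeomorph.trans_source] at hz
      exact ContMDiffAt.comp (g := c') (f := c.symm) z (contMDiffAt_chart hc' hz.2)
        (contMDiffAt_chart_symm hc hz.1)
    have hpr : ∀ {c c' : OpenPartialHomeomorph X (Eu (n + 1))},
        c ∈ IsManifold.maximalAtlas (𝓡 (n + 1)) ∞ X → c' ∈ IsManifold.maximalAtlas (𝓡 (n + 1)) ∞ X →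
        ∀ p : Eu (n + 1) × Eu k, p.1 ∈ (c.symm.trans c').source →
          ContMDiffAt 𝓘(ℝ, Eu (n + 1) × Eu k) 𝓘(ℝ, Eu (n + 1) × Eu k) ∞
            (fun q : Eu (n + 1) × Eu k => ((c.symm.trans c') q.1, q.2)) p := by
      intro c c' hc hc' p hp
      have h := (hsm hc hc' p.1 hp).contDiffAt
      exact ((h.comp p contDiffAt_fst).prodMk contDiffAt_snd).contMDiffAt
    refine OpenPartialHomeomorph.mem_maximalAtlas_of_contMDiffOn _ ?_ ?_
    · intro y hy
      have hy' := C.mem_rebase_source.1 hy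
      rw [OpenPartialHomeomorph.trans_source] at hy
      refine ContMDiffAt.contMDiffWithinAt ?_
      refine ContMDiffAt.comp (f := C.total)
        (g := fun q : Eu (n + 1) × Eu k => ((C.base.symm.trans ψ) q.1, q.2)) y (hpr C.base_mem hψ (C.total y) ?_)
        (contMDiffAt_of_mem_maximalAtlas C.total_mem hy.1)
      exact hy.2.1
    · intro p hp
      rw [OpenPartialHomeomorph.trans_target] at hp
      refine ContMDiffAt.contMDiffWithinAt ?_
      refine ContMDiffAt.comp (g := C.total.symm)
        (f := fun q : Eu (n + 1) × Eu k => ((ψ.symm.trans C.base) q.1, q.2)) p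
        (contMDiffAt_symm_of_mem_maximalAtlas C.total_mem hp.2) ?_
      refine hpr hψ C.base_mem p ?_
      have := hp.1.1
      exact this
  mapsTo := fun y hy => (C.mem_rebase_source.1 hy).2
  fst_eq := fun y hy => by
    have h := (C.mem_rebase_source.1 hy).1
    show ψ (C.base.symm (C.total y).1) = ψ (ρ y)
    rw [C.fst_eq y h, C.base.left_inv (C.base_source h)]

variable (hψ : ψ ∈ IsManifold.maximalAtlas (𝓡 (n + 1)) ∞ X)

lemma mem_rebase_total {y : Y} :
    y ∈ (C.rebase ψ hψ).total.source ↔ y ∈ C.total.source ∧ ρ y ∈ ψ.source :=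
  C.mem_rebase_source

lemma snd_ctot {y : Y} (hy : y ∈ C.total.source) (v : Eu (n + 1) × Eu k) :
    (ctot C.total y v).2 = mder (Eu (n + 1) × Eu k) (Eu k) (fun y => (C.total y).2) y v := by
  have h2 : mder (Eu (n + 1) × Eu k) (Eu k) (Prod.snd ∘ C.total) y
      = (mder (Eu (n + 1) × Eu k) (Eu k) Prod.snd (C.total y)).comp (ctot C.total y) :=
    mder_comp (mdifferentiableAt_iff_differentiableAt.2 differentiableAt_snd)
      (mdifferentiableAt_total C.total_mem hy)
  rw [mder_eq_fderiv, fderiv_snd] at h2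
  exact (congrArg (fun L : Eu (n + 1) × Eu k →L[ℝ] Eu k => L v) h2).symm

/-- A vertical vector is determined by its fibre coordinates, and those are left alone. Normal
momenta can therefore be computed over a slice chart without changing their components. -/
lemma cvert_rebase (hρ : IsFibred n k ρ) {y : Y} (hy : y ∈ (C.rebase ψ hψ).total.source)
    (a : Fin k) : (C.rebase ψ hψ).cvert y a = C.cvert y a := by
  set C' := C.rebase ψ hψ with hC'
  have hyC : y ∈ C.total.source := (C.mem_rebase_total hψ).1 hy |>.1
  have h1 : ctot C'.total y (C.cvert y a) = (0, stdVec a) := by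
    refine Prod.ext ?_ ?_
    · exact (C'.dproj_eq_zero_iff hρ hy _).1 (C.dproj_cvert hρ hyC a)
    · have : (ctot C'.total y (C.cvert y a)).2 = (ctot C.total y (C.cvert y a)).2 := by
        rw [C'.snd_ctot hy, C.snd_ctot hyC]
        rfl
      rw [this, C.ctot_cvert hyC]
  have h2 := ctotSymm_ctot C'.total_mem hy (C.cvert y a)
  rw [h1] at h2
  exact h2

end Rebase

end AdaptedChart

end Bundle


/-! ### Jets, the Lagrangian and the Legendre vector in adapted coordinates -/

section Jets

variable {n k : ℕ} {X Y : Type*}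
  [TopologicalSpace X] [ChartedSpace (Eu (n + 1)) X] [IsManifold (𝓡 (n + 1)) ∞ X]
  [TopologicalSpace Y] [ChartedSpace (Eu (n + 1) × Eu k) Y]
  [IsManifold 𝓘(ℝ, Eu (n + 1) × Eu k) ∞ Y]

variable {ρ : Y → X}

/-- A linear map of the model spaces that is a jet of a section at `ρ y`. -/
def IsJet (ρ : Y → X) (y : Y) (A : Eu (n + 1) →L[ℝ] Eu (n + 1) × Eu k) : Prop :=
  (dproj ρ y).comp A = ContinuousLinearMap.id ℝ _

/-- The value of a function on `J¹Y` at a linear map of the model spaces. -/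
def jev (L : J1 n k ρ → ℝ) (y : Y) (A : Eu (n + 1) →L[ℝ] Eu (n + 1) × Eu k) : ℝ :=
  jetEval L y A

/-- The coordinates of a jet. -/
def jetCoord (C : AdaptedChart n k ρ) (y : Y) (A : Eu (n + 1) →L[ℝ] Eu (n + 1) × Eu k) :
    JetCoord n k :=
  (C.base (ρ y), (C.total y).2,
    ((ContinuousLinearMap.snd ℝ (Eu (n + 1)) (Eu k)).comp ((ctot C.total y).comp A)).comp
      (dsymm C.base (C.base (ρ y))))

variable {vol : VolumeForm (n + 1) X} {L : J1 n k ρ → ℝ} {C : AdaptedChart n k ρ}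

/-- The splitting condition forces the base components of `A v`, and the fibre components are the
jet coordinates. So the coordinates determine the jet. -/
lemma IsJet.apply_eq (hρ : IsFibred n k ρ) {y : Y} (hy : y ∈ C.total.source)
    {A : Eu (n + 1) →L[ℝ] Eu (n + 1) × Eu k} (hA : IsJet ρ y A) (v : Eu (n + 1)) :
    A v = ctotSymm C.total (C.total y)
      (dchart C.base (ρ y) v, (jetCoord C y A).2.2 (dchart C.base (ρ y) v)) := by
  have hAv : dproj ρ y (A v) = v := congrArg (fun B : Eu (n + 1) →L[ℝ] Eu (n + 1) => B v) hA
  have e2 : dchart C.base (ρ y) v = (ctot C.total y (A v)).1 := by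
    rw [C.fst_ctot hρ hy, hAv]
  have e3 : (jetCoord C y A).2.2 (dchart C.base (ρ y) v) = (ctot C.total y (A v)).2 := by
    show (ctot C.total y (A (dsymm C.base (C.base (ρ y)) (dchart C.base (ρ y) v)))).2 = _
    rw [dsymm_dchart C.base_mem (C.base_source hy)]
  rw [e3, e2]
  exact (ctotSymm_ctot C.total_mem hy (A v)).symm

/-- By `IsJet.apply_eq`, the linear map that `localLagrangian` reassembles from the coordinates is
`A` itself. -/
lemma localLagrangian_jetCoord (hρ : IsFibred n k ρ) {y : Y} (hy : y ∈ C.total.source)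
    {A : Eu (n + 1) →L[ℝ] Eu (n + 1) × Eu k} (hA : IsJet ρ y A) :
    localLagrangian vol L C (jetCoord C y A)
      = jev L y A * formDensity vol.form C.base (C.base (ρ y)) := by
  have e1 : ((jetCoord C y A).1, (jetCoord C y A).2.1) = C.total y := (C.total_eq hy).symm
  show jev L (C.total.symm ((jetCoord C y A).1, (jetCoord C y A).2.1))
    ((ctotSymm C.total ((jetCoord C y A).1, (jetCoord C y A).2.1)).comp
      (((ContinuousLinearMap.id ℝ (Eu (n + 1))).prod (jetCoord C y A).2.2).comp
        (dchart C.base (ρ (C.total.symm ((jetCoord C y A).1, (jetCoord C y A).2.1)))))) * _ = _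
  rw [e1, C.total.left_inv hy]
  congr 2
  ext1 v
  exact (hA.apply_eq hρ hy v).symm

/-- The direction `e^μ ⊗ v` in the space of linear maps. -/
def covec (μ : Fin (n + 1)) {F : Type*} [NormedAddCommGroup F] [NormedSpace ℝ F] (v : F) :
    Eu (n + 1) →L[ℝ] F :=
  (EuclideanSpace.proj μ : Eu (n + 1) →L[ℝ] ℝ).smulRight v

/-- The line `A + t e^μ ⊗ v` of jets. -/
def jetLine {F : Type*} [NormedAddCommGroup F] [NormedSpace ℝ F] (A : Eu (n + 1) →L[ℝ] F)
    (μ : Fin (n + 1)) (v : F) (t : ℝ) : Eu (n + 1) →L[ℝ] F :=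
  A + t • covec μ v

/-- The Legendre vector: the vertical derivative of `L` at the jet `A` in the direction of
`v`, a vertical vector, as a vector field on the base. -/
def leg (L : J1 n k ρ → ℝ) (y : Y) (A : Eu (n + 1) →L[ℝ] Eu (n + 1) × Eu k)
    (v : Eu (n + 1) × Eu k) : Eu (n + 1) :=
  WithLp.toLp 2 fun μ => deriv (fun t : ℝ => jev L y (jetLine A μ v t)) 0

/-- Hence the default value `0` of `jetEval` is never met in the derivative defining `leg` along a
vertical vector. -/
lemma IsJet.line {y : Y} {A : Eu (n + 1) →L[ℝ] Eu (n + 1) × Eu k} (hA : IsJet ρ y A)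
    {v : Eu (n + 1) × Eu k} (hv : dproj ρ y v = 0) (μ : Fin (n + 1)) (t : ℝ) :
    IsJet ρ y (jetLine A μ v t) := by
  unfold IsJet at hA ⊢
  ext1 w
  have h := congrArg (fun B : Eu (n + 1) →L[ℝ] Eu (n + 1) => B w) hA
  have h2 : jetLine A μ v t w = A w + (t * w μ) • v := by
    simp [jetLine, covec, smul_smul]
  rw [ContinuousLinearMap.comp_apply, h2, map_add, map_smul, hv, smul_zero, add_zero]
  exact h

lemma hasDerivAt_third {E₁ E₂ E₃ : Type*} [NormedAddCommGroup E₁] [NormedSpace ℝ E₁]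
    [NormedAddCommGroup E₂] [NormedSpace ℝ E₂] [NormedAddCommGroup E₃] [NormedSpace ℝ E₃]
    {f : E₁ × E₂ × E₃ → ℝ} {a : E₁} {b : E₂} {c : E₃} (hf : DifferentiableAt ℝ f (a, b, c))
    (d : E₃) : HasDerivAt (fun t : ℝ => f (a, b, c + t • d)) (fderiv ℝ f (a, b, c) (0, 0, d)) 0 := by
  have h1 : HasDerivAt (fun t : ℝ => (a, b, c + t • d)) ((0 : E₁), (0 : E₂), d) 0 := by
    refine (hasDerivAt_const _ _).prodMk ((hasDerivAt_const _ _).prodMk ?_)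
    simpa using ((hasDerivAt_id (0 : ℝ)).smul_const d).const_add c
  have h2 : HasFDerivAt f (fderiv ℝ f (a, b, c)) ((fun t : ℝ => (a, b, c + t • d)) 0) := by
    simpa using hf.hasFDerivAt
  exact h2.comp_hasDerivAt 0 h1

lemma comp_jetLine {F G : Type*} [NormedAddCommGroup F] [NormedSpace ℝ F]
    [NormedAddCommGroup G] [NormedSpace ℝ G] (S : F →L[ℝ] G) (D : Eu (n + 1) →L[ℝ] Eu (n + 1))
    (A : Eu (n + 1) →L[ℝ] F) (μ : Fin (n + 1)) (v : F) (t : ℝ) :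
    (S.comp (jetLine A μ v t)).comp D
      = (S.comp A).comp D
        + t • ((EuclideanSpace.proj μ : Eu (n + 1) →L[ℝ] ℝ).comp D).smulRight (S v) := by
  ext1 w
  simp [jetLine, covec, smul_smul]

lemma IsSmoothLagrangian.contDiffAt (hL : IsSmoothLagrangian vol L) {q : JetCoord n k}
    (hq : (q.1, q.2.1) ∈ C.total.target) : ContDiffAt ℝ ∞ (localLagrangian vol L C) q := by
  refine (hL C).contDiffAt (IsOpen.mem_nhds ?_ hq)
  exact C.total.open_target.preimage (by fun_prop)

lemma jetCoord_mem {y : Y} (hy : y ∈ C.total.source)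
    (A : Eu (n + 1) →L[ℝ] Eu (n + 1) × Eu k) :
    ((jetCoord C y A).1, (jetCoord C y A).2.1) ∈ C.total.target := by
  have : ((jetCoord C y A).1, (jetCoord C y A).2.1) = C.total y := (C.total_eq hy).symm
  rw [this]
  exact C.total.map_source hy

/-- The Legendre vector in adapted coordinates: its components are the momenta `∂ℓ/∂y^a_μ v^a`
divided by the density of the volume form. -/
lemma leg_eq (hρ : IsFibred n k ρ) (hL : IsSmoothLagrangian vol L) {y : Y}
    (hy : y ∈ C.total.source) {A : Eu (n + 1) →L[ℝ] Eu (n + 1) × Eu k} (hA : IsJet ρ y A)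
    {v : Eu (n + 1) × Eu k} (hv : dproj ρ y v = 0) :
    leg L y A v = (formDensity vol.form C.base (C.base (ρ y)))⁻¹ •
      dsymm C.base (C.base (ρ y)) (WithLp.toLp 2 fun ν =>
        ∑ a, momentum (localLagrangian vol L C) (jetCoord C y A) ν a * (ctot C.total y v).2 a) := by
  set f := formDensity vol.form C.base (C.base (ρ y)) with hf
  have hf0 : f ≠ 0 := formDensity_ne_zero vol C.base_mem (C.base.map_source (C.base_source hy))
  set ℓ := localLagrangian vol L C with hℓ
  set D := dsymm C.base (C.base (ρ y)) with hD
  set w := (ctot C.total y v).2 with hw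
  ext μ
  -- Along the line of jets only the coordinates `y^a_μ` move, and they move affinely.
  have h1 : ∀ t : ℝ, jev L y (jetLine A μ v t) = f⁻¹ * ℓ ((jetCoord C y A).1, (jetCoord C y A).2.1,
      (jetCoord C y A).2.2
        + t • ((EuclideanSpace.proj μ : Eu (n + 1) →L[ℝ] ℝ).comp D).smulRight w) := by
    intro t
    have h2 := localLagrangian_jetCoord (vol := vol) (L := L) hρ hy (hA.line hv μ t)
    have h3 : jetCoord C y (jetLine A μ v t) = ((jetCoord C y A).1, (jetCoord C y A).2.1,
      (jetCoord C y A).2.2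
        + t • ((EuclideanSpace.proj μ : Eu (n + 1) →L[ℝ] ℝ).comp D).smulRight w) := by
      refine Prod.ext rfl (Prod.ext rfl ?_)
      exact comp_jetLine ((ContinuousLinearMap.snd ℝ (Eu (n + 1)) (Eu k)).comp (ctot C.total y))
        D A μ v t
    rw [← h3, hℓ, h2, ← hf]
    field_simp
  have h2 : leg L y A v μ = f⁻¹ * fderiv ℝ ℓ (jetCoord C y A) (0, 0,
      ((EuclideanSpace.proj μ : Eu (n + 1) →L[ℝ] ℝ).comp D).smulRight w) := by
    show deriv (fun t : ℝ => jev L y (jetLine A μ v t)) 0 = _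
    rw [funext h1]
    refine HasDerivAt.deriv (HasDerivAt.const_mul _ (hasDerivAt_third ?_ _))
    exact (hL.contDiffAt (jetCoord_mem hy A)).differentiableAt (by simp)
  rw [h2, vertical_expand]
  simp only [PiLp.zero_apply, zero_mul, Finset.sum_const_zero, zero_add, PiLp.smul_apply,
    smul_eq_mul]
  congr 1
  have h3 : ∀ P : Eu (n + 1), D P μ = ∑ ν, P ν * D (stdVec ν) μ := by
    intro P
    conv_lhs => rw [eu_sum P, map_sum]
    simp [WithLp.ofLp_sum, Finset.sum_apply]
  rw [h3]
  refine Finset.sum_congr rfl fun ν _ => ?_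
  simp only [Finset.sum_mul]
  refine Finset.sum_congr rfl fun a _ => ?_
  rw [momentum_def]
  show (D (stdVec ν) μ * w a) * _ = _
  ring

lemma dchart_leg (hρ : IsFibred n k ρ) (hL : IsSmoothLagrangian vol L) {y : Y}
    (hy : y ∈ C.total.source) {A : Eu (n + 1) →L[ℝ] Eu (n + 1) × Eu k} (hA : IsJet ρ y A)
    {v : Eu (n + 1) × Eu k} (hv : dproj ρ y v = 0) :
    dchart C.base (ρ y) (leg L y A v)
      = (formDensity vol.form C.base (C.base (ρ y)))⁻¹ • (WithLp.toLp 2 fun ν =>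
        ∑ a, momentum (localLagrangian vol L C) (jetCoord C y A) ν a * (ctot C.total y v).2 a) := by
  rw [leg_eq hρ hL hy hA hv, map_smul, dchart_dsymm C.base_mem (C.base_source hy)]

/-- A derivative along lines is not linear in the direction by definition; linearity is read off
from `leg_eq`, where smoothness of the coordinate Lagrangian has been used. -/
lemma leg_add (hρ : IsFibred n k ρ) (hL : IsSmoothLagrangian vol L) {y : Y}
    {A : Eu (n + 1) →L[ℝ] Eu (n + 1) × Eu k} (hA : IsJet ρ y A)
    {v w : Eu (n + 1) × Eu k} (hv : dproj ρ y v = 0) (hw : dproj ρ y w = 0) :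
    leg L y A (v + w) = leg L y A v + leg L y A w := by
  obtain ⟨C, hC⟩ := hρ.exists_chart y
  rw [leg_eq hρ hL hC hA hv, leg_eq hρ hL hC hA hw,
    leg_eq hρ hL hC hA (by rw [map_add, hv, hw, add_zero]), ← smul_add, ← map_add]
  congr 2
  ext ν
  simp [mul_add, Finset.sum_add_distrib]

lemma leg_smul (hρ : IsFibred n k ρ) (hL : IsSmoothLagrangian vol L) {y : Y}
    {A : Eu (n + 1) →L[ℝ] Eu (n + 1) × Eu k} (hA : IsJet ρ y A)
    {v : Eu (n + 1) × Eu k} (hv : dproj ρ y v = 0) (c : ℝ) :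
    leg L y A (c • v) = c • leg L y A v := by
  obtain ⟨C, hC⟩ := hρ.exists_chart y
  rw [leg_eq hρ hL hC hA hv, leg_eq hρ hL hC hA (by rw [map_smul, hv, smul_zero]), smul_comm c]
  congr 1
  rw [← map_smul]
  congr 1
  ext ν
  simp only [map_smul, Prod.smul_snd, PiLp.smul_apply, smul_eq_mul, Finset.mul_sum]
  exact Finset.sum_congr rfl fun a _ => by ring

/-! ### Sections and families of sections -/

variable (n k) in
/-- `φ` is a smooth section near `x`. -/
def IsSectionAt (ρ : Y → X) (φ : X → Y) (x : X) : Prop :=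
  ContMDiffAt (𝓡 (n + 1)) 𝓘(ℝ, Eu (n + 1) × Eu k) ∞ φ x ∧ ∀ᶠ x' in 𝓝 x, ρ (φ x') = x'

variable {φ : X → Y} {x : X}

lemma IsSectionAt.mdifferentiableAt (h : IsSectionAt n k ρ φ x) :
    MDifferentiableAt (𝓡 (n + 1)) 𝓘(ℝ, Eu (n + 1) × Eu k) φ x :=
  h.1.mdifferentiableAt (by simp)

lemma IsSectionAt.proj (h : IsSectionAt n k ρ φ x) : ρ (φ x) = x := h.2.self_of_nhds

/-- Differentiate `ρ ∘ φ = id`, which holds near `x`. -/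
lemma IsSectionAt.isJet (hρ : IsFibred n k ρ) (h : IsSectionAt n k ρ φ x) :
    IsJet ρ (φ x) (mder (Eu (n + 1)) (Eu (n + 1) × Eu k) φ x) := by
  have h1 := mder_comp (E := Eu (n + 1)) ((hρ.smooth (φ x)).mdifferentiableAt (by simp))
    h.mdifferentiableAt
  have h2 : (ρ ∘ φ) =ᶠ[𝓝 x] id := h.2
  rw [mder_congr h2] at h1
  refine h1.symm.trans ?_
  exact mfderiv_id

lemma IsSectionAt.mem_base (h : IsSectionAt n k ρ φ x) (hC : φ x ∈ C.total.source) :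
    x ∈ C.base.source := by
  have := C.base_source hC
  rwa [h.proj] at this

lemma IsSectionAt.jetCoord_eq (h : IsSectionAt n k ρ φ x) (hC : φ x ∈ C.total.source) :
    jetCoord C (φ x) (mder (Eu (n + 1)) (Eu (n + 1) × Eu k) φ x) = localJet C φ (C.base x) := by
  have hx := h.mem_base hC
  have hz := C.base.map_source hx
  have hs := C.mdifferentiableAt_base_symm hz
  have e0 : C.base.symm (C.base x) = x := C.base.left_inv hx
  have hφ : MDifferentiableAt (𝓡 (n + 1)) 𝓘(ℝ, Eu (n + 1) × Eu k) φ (C.base.symm (C.base x)) := by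
    rw [e0]; exact h.mdifferentiableAt
  have hT : MDifferentiableAt 𝓘(ℝ, Eu (n + 1) × Eu k) 𝓘(ℝ, Eu (n + 1) × Eu k) C.total
      ((φ ∘ C.base.symm) (C.base x)) := by
    rw [Function.comp, e0]; exact mdifferentiableAt_total C.total_mem hC
  have e1 := mder_comp hφ hs
  have e2 := mder_comp hT (MDifferentiableAt.comp (C.base x) hφ hs)
  have hd : DifferentiableAt ℝ (C.total ∘ φ ∘ C.base.symm) (C.base x) :=
    mdifferentiableAt_iff_differentiableAt.1
      (MDifferentiableAt.comp (C.base x) hT (MDifferentiableAt.comp (C.base x) hφ hs))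
  refine Prod.ext ?_ (Prod.ext ?_ ?_)
  · show C.base (ρ (φ x)) = C.base x
    rw [h.proj]
  · show (C.total (φ x)).2 = (C.total (φ (C.base.symm (C.base x)))).2
    rw [e0]
  · ext1 v
    have e3 : fderiv ℝ (localField C φ) (C.base x) v
        = (fderiv ℝ (C.total ∘ φ ∘ C.base.symm) (C.base x) v).2 := by
      have : localField C φ = fun w => ((C.total ∘ φ ∘ C.base.symm) w).2 := rfl
      rw [this, hd.hasFDerivAt.snd.fderiv]
      rfl
    show (ctot C.total (φ x) (mder _ _ φ x (dsymm C.base (C.base (ρ (φ x))) v))).2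
      = fderiv ℝ (localField C φ) (C.base x) v
    rw [e3, ← mder_eq_fderiv, e2, e1, h.proj]
    simp only [Function.comp, e0]
    rfl

lemma IsSectionAt.localLagrangian_eq (hρ : IsFibred n k ρ) (h : IsSectionAt n k ρ φ x)
    (hC : φ x ∈ C.total.source) :
    localLagrangian vol L C (localJet C φ (C.base x))
      = jev L (φ x) (mder (Eu (n + 1)) (Eu (n + 1) × Eu k) φ x)
        * formDensity vol.form C.base (C.base x) := by
  rw [← h.jetCoord_eq hC, localLagrangian_jetCoord hρ hC (h.isJet hρ), h.proj]

variable (n k) in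
/-- `Φ` is a smooth family of sections near `p`. -/
def IsFamilyAt (ρ : Y → X) (Φ : ℝ → X → Y) (p : ℝ × X) : Prop :=
  ∀ᶠ p in 𝓝 p, ContMDiffAt (𝓘(ℝ, ℝ).prod (𝓡 (n + 1))) 𝓘(ℝ, Eu (n + 1) × Eu k) ∞
      (fun p : ℝ × X => Φ p.1 p.2) p ∧ ρ (Φ p.1 p.2) = p.2

variable {Φ : ℝ → X → Y} {p : ℝ × X}

lemma IsFamilyAt.eventually (h : IsFamilyAt n k ρ Φ p) :
    ∀ᶠ p in 𝓝 p, IsFamilyAt n k ρ Φ p :=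
  eventually_eventually_nhds.2 h

lemma IsFamilyAt.contMDiffAt (h : IsFamilyAt n k ρ Φ p) :
    ContMDiffAt (𝓘(ℝ, ℝ).prod (𝓡 (n + 1))) 𝓘(ℝ, Eu (n + 1) × Eu k) ∞
      (fun p : ℝ × X => Φ p.1 p.2) p := h.self_of_nhds.1

lemma IsFamilyAt.isSectionAt {ε : ℝ} (h : IsFamilyAt n k ρ Φ (ε, x)) :
    IsSectionAt n k ρ (Φ ε) x := by
  refine ⟨?_, ?_⟩
  · exact ContMDiffAt.comp (g := fun p : ℝ × X => Φ p.1 p.2) (f := fun x => (ε, x)) x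
      h.contMDiffAt (contMDiffAt_const.prodMk contMDiffAt_id)
  · have : Tendsto (fun x' => (ε, x')) (𝓝 x) (𝓝 (ε, x)) :=
      (Continuous.prodMk_right ε).tendsto x
    exact (this.eventually h).mono fun x' hx' => hx'.2

/-- The coordinate expression of a family. -/
def localFamily (C : AdaptedChart n k ρ) (Φ : ℝ → X → Y) (p : ℝ × Eu (n + 1)) : Eu k :=
  localField C (Φ p.1) p.2

lemma IsFamilyAt.eventually_mem {ε : ℝ} (h : IsFamilyAt n k ρ Φ (ε, x))
    (hC : Φ ε x ∈ C.total.source) : ∀ᶠ p : ℝ × X in 𝓝 (ε, x), Φ p.1 p.2 ∈ C.total.source :=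
  h.contMDiffAt.continuousAt.eventually (C.total.open_source.mem_nhds hC)

lemma IsFamilyAt.contDiffAt {ε : ℝ} (h : IsFamilyAt n k ρ Φ (ε, x))
    (hC : Φ ε x ∈ C.total.source) : ContDiffAt ℝ ∞ (localFamily C Φ) (ε, C.base x) := by
  have hx := h.isSectionAt.mem_base hC
  have h1 : ContMDiffAt 𝓘(ℝ, ℝ × Eu (n + 1)) (𝓘(ℝ, ℝ).prod (𝓡 (n + 1))) ∞
      (fun p : ℝ × Eu (n + 1) => (p.1, C.base.symm p.2)) (ε, C.base x) := by
    refine ContMDiffAt.prodMk contDiffAt_fst.contMDiffAt ?_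
    exact ContMDiffAt.comp (g := C.base.symm) (f := Prod.snd) (ε, C.base x)
      (contMDiffAt_chart_symm C.base_mem (C.base.map_source hx)) contDiffAt_snd.contMDiffAt
  have h2 : ContMDiffAt (𝓘(ℝ, ℝ).prod (𝓡 (n + 1))) 𝓘(ℝ, Eu (n + 1) × Eu k) ∞
      (fun p : ℝ × X => Φ p.1 p.2) (ε, C.base.symm (C.base x)) := by
    rw [C.base.left_inv hx]; exact h.contMDiffAt
  have h3 : ContMDiffAt 𝓘(ℝ, Eu (n + 1) × Eu k) 𝓘(ℝ, Eu (n + 1) × Eu k) ∞ C.total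
      (Φ ε (C.base.symm (C.base x))) := by
    rw [C.base.left_inv hx]; exact contMDiffAt_of_mem_maximalAtlas C.total_mem hC
  have h4 := ContMDiffAt.comp (g := fun p : ℝ × X => Φ p.1 p.2)
    (f := fun p : ℝ × Eu (n + 1) => (p.1, C.base.symm p.2)) (ε, C.base x) h2 h1
  have h5 := ContMDiffAt.comp (g := C.total) (ε, C.base x) h3 h4
  exact contDiffAt_snd.comp (ε, C.base x) h5.contDiffAt

lemma IsFamilyAt.localJet_mem {ε : ℝ} (h : IsFamilyAt n k ρ Φ (ε, x))
    (hC : Φ ε x ∈ C.total.source) :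
    ((localJet C (Φ ε) (C.base x)).1, (localJet C (Φ ε) (C.base x)).2.1) ∈ C.total.target := by
  rw [← h.isSectionAt.jetCoord_eq hC]
  exact jetCoord_mem hC _

lemma IsFamilyAt.contDiffAt_lagrangian (hL : IsSmoothLagrangian vol L) {ε : ℝ}
    (h : IsFamilyAt n k ρ Φ (ε, x)) (hC : Φ ε x ∈ C.total.source) :
    ContDiffAt ℝ ∞ (localLagrangian vol L C) (familyJet (localFamily C Φ) (ε, C.base x)) :=
  hL.contDiffAt (h.localJet_mem hC)

/-- The velocity of a curve, as a vector of the model space. -/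
def vel (n k : ℕ) {Y : Type*} [TopologicalSpace Y] [ChartedSpace (Eu (n + 1) × Eu k) Y]
    (c : ℝ → Y) : Eu (n + 1) × Eu k := mder ℝ (Eu (n + 1) × Eu k) c 0 (1 : ℝ)

lemma ctot_vel {c : ℝ → Y} (hc : MDifferentiableAt 𝓘(ℝ, ℝ) 𝓘(ℝ, Eu (n + 1) × Eu k) c 0)
    (hC : c 0 ∈ C.total.source) :
    (ctot C.total (c 0) (vel n k c)).2 = deriv (fun e => (C.total (c e)).2) 0 := by
  have hT := mdifferentiableAt_total C.total_mem hC
  have e1 := mder_comp (E := ℝ) hT hc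
  have hd : DifferentiableAt ℝ (C.total ∘ c) 0 :=
    mdifferentiableAt_iff_differentiableAt.1 (MDifferentiableAt.comp 0 hT hc)
  have e2 : deriv (fun e => (C.total (c e)).2) 0 = (fderiv ℝ (C.total ∘ c) 0 1).2 := by
    have := hd.hasFDerivAt.snd.hasDerivAt.deriv
    exact this
  rw [e2, ← mder_eq_fderiv, e1]
  rfl

lemma dproj_vel (hρ : IsFibred n k ρ) {c : ℝ → Y}
    (hc : MDifferentiableAt 𝓘(ℝ, ℝ) 𝓘(ℝ, Eu (n + 1) × Eu k) c 0)
    (h : ∀ᶠ e in 𝓝 (0 : ℝ), ρ (c e) = ρ (c 0)) : dproj ρ (c 0) (vel n k c) = 0 := by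
  have e1 := mder_comp (E := ℝ) ((hρ.smooth (c 0)).mdifferentiableAt (by simp)) hc
  have e2 : (ρ ∘ c) =ᶠ[𝓝 0] fun _ => ρ (c 0) := h
  rw [mder_congr e2] at e1
  have e3 : mder ℝ (Eu (n + 1)) (fun _ : ℝ => ρ (c 0)) 0 = 0 := mfderiv_const
  rw [e3] at e1
  exact (congrArg (fun B : ℝ →L[ℝ] Eu (n + 1) => B 1) e1).symm

lemma IsFamilyAt.mdifferentiableAt_left {ε : ℝ} (h : IsFamilyAt n k ρ Φ (ε, x)) :
    MDifferentiableAt 𝓘(ℝ, ℝ) 𝓘(ℝ, Eu (n + 1) × Eu k) (fun e => Φ e x) ε :=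
  ContMDiffAt.mdifferentiableAt (n := ∞)
    (ContMDiffAt.comp (g := fun p : ℝ × X => Φ p.1 p.2) (f := fun e => (e, x)) ε
      h.contMDiffAt (contMDiffAt_id.prodMk contMDiffAt_const)) (by simp)

lemma IsFamilyAt.dproj_vel (hρ : IsFibred n k ρ) (h : IsFamilyAt n k ρ Φ (0, x)) :
    dproj ρ (Φ 0 x) (vel n k fun e => Φ e x) = 0 := by
  refine BoundaryFields.dproj_vel (c := fun e => Φ e x) hρ h.mdifferentiableAt_left ?_
  have : Tendsto (fun e : ℝ => (e, x)) (𝓝 0) (𝓝 (0, x)) := (Continuous.prodMk_left x).tendsto 0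
  filter_upwards [this.eventually h] with e he
  rw [he.2, h.isSectionAt.proj]

lemma IsFamilyAt.ctot_vel (h : IsFamilyAt n k ρ Φ (0, x))
    (hC : Φ 0 x ∈ C.total.source) :
    (ctot C.total (Φ 0 x) (vel n k fun e => Φ e x)).2
      = familyVelocity (localFamily C Φ) (C.base x) := by
  rw [BoundaryFields.ctot_vel (c := fun e => Φ e x) h.mdifferentiableAt_left hC]
  have : ∀ e, (C.total (Φ e x)).2 = localFamily C Φ (e, C.base x) := by
    intro e
    show _ = (C.total (Φ e (C.base.symm (C.base x)))).2
    rw [C.base.left_inv (h.isSectionAt.mem_base hC)]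
  simp only [this]
  rfl

lemma IsFamilyAt.dchart_leg (hρ : IsFibred n k ρ) (hL : IsSmoothLagrangian vol L)
    (h : IsFamilyAt n k ρ Φ (0, x)) (hC : Φ 0 x ∈ C.total.source) :
    dchart C.base x (leg L (Φ 0 x) (mder (Eu (n + 1)) (Eu (n + 1) × Eu k) (Φ 0) x)
        (vel n k fun e => Φ e x))
      = (formDensity vol.form C.base (C.base x))⁻¹ •
        momentumCurrent (localLagrangian vol L C) (localFamily C Φ) (C.base x) := by
  have := BoundaryFields.dchart_leg hρ hL hC (h.isSectionAt.isJet hρ) (h.dproj_vel hρ)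
  rw [h.isSectionAt.jetCoord_eq hC, h.isSectionAt.proj, h.ctot_vel hC] at this
  exact this

end Jets


lemma divergence_congr {d : ℕ} {G G' : Eu d → Eu d} {z : Eu d} (h : G =ᶠ[𝓝 z] G') :
    divergence G z = divergence G' z := by
  unfold divergence
  refine Finset.sum_congr rfl fun μ _ => ?_
  have : (fun w => G w μ) =ᶠ[𝓝 z] fun w => G' w μ := h.mono fun w hw => by simp only [hw]
  rw [this.fderiv_eq]

/-! ### The first variation of the action -/

namespace FieldTheory

variable {n k : ℕ} {X Y B : Type*}
  [TopologicalSpace X] [T2Space X] [SecondCountableTopology X]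
  [ChartedSpace (Eu (n + 1)) X] [IsManifold (𝓡 (n + 1)) ∞ X]
  [MeasurableSpace X] [BorelSpace X]
  [TopologicalSpace Y] [ChartedSpace (Eu (n + 1) × Eu k) Y]
  [IsManifold 𝓘(ℝ, Eu (n + 1) × Eu k) ∞ Y]
  [TopologicalSpace B] [T2Space B] [SecondCountableTopology B]
  [ChartedSpace (Eu n) B] [IsManifold (𝓡 n) ∞ B]
  [MeasurableSpace B] [BorelSpace B]
  {T : FieldTheory n k X Y B} {Φ : ℝ → X → Y} {φ : X → Y} {x : X}

lemma IsFieldFamily.isFamilyAt (h : T.IsFieldFamily Φ) (ε : ℝ) (hx : x ∈ closure T.U) :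
    IsFamilyAt n k T.ρ Φ (ε, x) :=
  eventually_nhdsSet_iff_forall.1 h (ε, x) ⟨mem_univ _, hx⟩

lemma mem_chart (y : Y) : y ∈ (T.chart y).total.source :=
  Classical.choose_spec (T.fibred.exists_chart y)

variable (n k) in
/-- The tangent map of a field, as a map of the model spaces. -/
def _root_.BoundaryFields.tang {X Y : Type*} [TopologicalSpace X] [ChartedSpace (Eu (n + 1)) X]
    [TopologicalSpace Y] [ChartedSpace (Eu (n + 1) × Eu k) Y] (φ : X → Y) (x : X) : Eu (n + 1) →L[ℝ] Eu (n + 1) × Eu k :=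
  mder (Eu (n + 1)) (Eu (n + 1) × Eu k) φ x

variable (T) in
/-- The Lagrangian function along a family of fields. -/
def lagrangianAlong (Φ : ℝ → X → Y) (p : ℝ × X) : ℝ :=
  jev T.L (Φ p.1 p.2) (tang n k (Φ p.1) p.2)

lemma lagrangianAlong_mul {ε : ℝ} (h : IsFamilyAt n k T.ρ Φ (ε, x))
    {C : AdaptedChart n k T.ρ} (hC : Φ ε x ∈ C.total.source) :
    T.lagrangianAlong Φ (ε, x) * formDensity T.vol.form C.base (C.base x)
      = localLagrangian T.vol T.L C (familyJet (localFamily C Φ) (ε, C.base x)) :=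
  (h.isSectionAt.localLagrangian_eq T.fibred hC).symm

/-- The coordinate Lagrangian along the jets, divided by the density, is smooth in the parameter and
the base coordinates jointly. The regularity needed to differentiate the action follows. -/
lemma lagrangianAlong_local {ε : ℝ} (h : IsFamilyAt n k T.ρ Φ (ε, x))
    {C : AdaptedChart n k T.ρ} (hC : Φ ε x ∈ C.total.source) :
    ∃ g : ℝ × Eu (n + 1) → ℝ, ContDiffAt ℝ ∞ g (ε, C.base x) ∧
      ∀ᶠ p in 𝓝 (ε, x), T.lagrangianAlong Φ p = g (p.1, C.base p.2) := by
  have hx := h.isSectionAt.mem_base hC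
  have hz := C.base.map_source hx
  refine ⟨fun p => localLagrangian T.vol T.L C (familyJet (localFamily C Φ) p)
    / formDensity T.vol.form C.base p.2, ?_, ?_⟩
  · refine ContDiffAt.div ?_ ?_ (formDensity_ne_zero T.vol C.base_mem hz)
    · exact (h.contDiffAt_lagrangian T.smooth_L hC).comp _
        (contDiffAt_familyJet (r := ∞) (h.contDiffAt hC))
    · exact ContDiffAt.comp (g := formDensity T.vol.form C.base) _
        (contDiffAt_formDensity T.vol C.base_mem hz) contDiffAt_snd
  · filter_upwards [h.eventually, h.eventually_mem hC] with p hp hpC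
    have hx' := hp.isSectionAt.mem_base hpC
    rw [eq_div_iff (formDensity_ne_zero T.vol C.base_mem (C.base.map_source hx'))]
    exact lagrangianAlong_mul hp hpC

lemma continuousAt_chart_prod {C : AdaptedChart n k T.ρ} (hx : x ∈ C.base.source) (ε : ℝ) :
    ContinuousAt (fun p : ℝ × X => (p.1, C.base p.2)) (ε, x) :=
  continuousAt_fst.prodMk (ContinuousAt.comp (f := Prod.snd) (C.base.continuousAt hx)
    continuousAt_snd)

lemma continuousAt_lagrangianAlong {ε : ℝ} (h : IsFamilyAt n k T.ρ Φ (ε, x)) :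
    ContinuousAt (T.lagrangianAlong Φ) (ε, x) := by
  obtain ⟨g, hg, hev⟩ := lagrangianAlong_local h (mem_chart (T := T) (Φ ε x))
  refine ContinuousAt.congr ?_ (hev.mono fun p hp => hp.symm)
  exact ContinuousAt.comp (g := g) (f := fun p : ℝ × X => (p.1, (T.chart (Φ ε x)).base p.2))
    hg.continuousAt
    (continuousAt_chart_prod (h.isSectionAt.mem_base (mem_chart _)) ε)

lemma hasDerivAt_lagrangianAlong {ε : ℝ} (h : IsFamilyAt n k T.ρ Φ (ε, x)) :
    HasDerivAt (fun e => T.lagrangianAlong Φ (e, x))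
      (deriv (fun e => T.lagrangianAlong Φ (e, x)) ε) ε := by
  obtain ⟨g, hg, hev⟩ := lagrangianAlong_local h (mem_chart (T := T) (Φ ε x))
  have h1 := hasDerivAt_slice_left (hg.differentiableAt (by simp))
  have h2 : (fun e => T.lagrangianAlong Φ (e, x))
      =ᶠ[𝓝 ε] fun e => g (e, (T.chart (Φ ε x)).base x) :=
    ((Continuous.prodMk_left x).tendsto ε).eventually hev
  exact (h1.congr_of_eventuallyEq h2).differentiableAt.hasDerivAt

lemma continuousAt_deriv_lagrangianAlong {ε : ℝ} (h : IsFamilyAt n k T.ρ Φ (ε, x)) :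
    ContinuousAt (fun p : ℝ × X => deriv (fun e => T.lagrangianAlong Φ (e, p.2)) p.1) (ε, x) := by
  set C := T.chart (Φ ε x)
  have hC : Φ ε x ∈ C.total.source := mem_chart _
  have hx := h.isSectionAt.mem_base hC
  obtain ⟨g, hg, hev⟩ := lagrangianAlong_local h hC
  have h1 : ContinuousAt (fun p : ℝ × X => fderiv ℝ g (p.1, C.base p.2) (1, 0)) (ε, x) := by
    have hd : ContinuousAt (fun q => fderiv ℝ g q (1, 0)) (ε, C.base x) :=
      ((hg.fderiv_right (m := 0) (by simp)).clm_apply contDiffAt_const).continuousAt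
    exact ContinuousAt.comp (g := fun q => fderiv ℝ g q (1, 0))
      (f := fun p : ℝ × X => (p.1, C.base p.2)) hd (continuousAt_chart_prod hx ε)
  refine h1.congr ?_
  have h2 : ∀ᶠ p : ℝ × X in 𝓝 (ε, x), DifferentiableAt ℝ g (p.1, C.base p.2) :=
    (continuousAt_chart_prod hx ε).eventually
      ((hg.of_le (m := 1) (by simp)).eventually (by simp) |>.mono
        fun q hq => hq.differentiableAt (by simp))
  filter_upwards [eventually_eventually_nhds.2 hev, h2] with p hp hpd
  have h3 : (fun e => T.lagrangianAlong Φ (e, p.2)) =ᶠ[𝓝 p.1] fun e => g (e, C.base p.2) :=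
    ((Continuous.prodMk_left p.2).tendsto p.1).eventually hp
  rw [h3.deriv_eq]
  exact (hasDerivAt_slice_left hpd).deriv.symm

/-- Differentiation under the integral sign: the parameter derivative is jointly continuous, hence
bounded for parameters in `[-1, 1]` and points of the compact closure, and `U` has finite measure.
-/
lemma hasDerivAt_action (h : T.IsFieldFamily Φ) :
    HasDerivAt (fun ε => T.action (Φ ε))
      (∫ x in T.U, deriv (fun e => T.lagrangianAlong Φ (e, x)) 0 ∂T.m) 0 := by
  have := T.isVolumeMeasure.isLocallyFinite
  have hK := T.domain.isCompact_closure
  have hc1 : ∀ ε, ContinuousOn (fun x => T.lagrangianAlong Φ (ε, x)) (closure T.U) := by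
    intro ε x hx
    exact (ContinuousAt.comp (f := fun x => (ε, x))
      (continuousAt_lagrangianAlong (h.isFamilyAt ε hx))
      (Continuous.prodMk_right ε).continuousAt).continuousWithinAt
  have hc2 : ContinuousOn (fun p : ℝ × X => deriv (fun e => T.lagrangianAlong Φ (e, p.2)) p.1)
      (Icc (-1) 1 ×ˢ closure T.U) := by
    rintro ⟨ε, x⟩ hp
    exact (continuousAt_deriv_lagrangianAlong (h.isFamilyAt ε hp.2)).continuousWithinAt
  obtain ⟨M, hM⟩ := (isCompact_Icc.prod hK).exists_bound_of_continuousOn hc2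
  have hfin : T.m T.U ≠ ⊤ := ((measure_mono subset_closure).trans_lt hK.measure_lt_top).ne
  refine (hasDerivAt_integral_of_dominated_loc_of_deriv_le
    (F := fun ε x => T.lagrangianAlong Φ (ε, x))
    (F' := fun ε x => deriv (fun e => T.lagrangianAlong Φ (e, x)) ε)
    (bound := fun _ => M) (x₀ := (0 : ℝ)) (s := Icc (-1) 1) (Icc_mem_nhds (by norm_num) (by norm_num))
    ?_ ?_ ?_ ?_ ?_ ?_).2
  · exact Eventually.of_forall fun ε => ((hc1 ε).mono subset_closure).aestronglyMeasurable
      T.domain.isOpen.measurableSet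
  · exact ((hc1 0).integrableOn_compact hK).mono_set subset_closure
  · refine ContinuousOn.aestronglyMeasurable ?_ T.domain.isOpen.measurableSet
    intro x hx
    exact (ContinuousAt.comp (f := fun x => ((0 : ℝ), x))
      (continuousAt_deriv_lagrangianAlong (h.isFamilyAt 0 (subset_closure hx)))
      (Continuous.prodMk_right (0 : ℝ)).continuousAt).continuousWithinAt
  · refine (ae_restrict_iff' T.domain.isOpen.measurableSet).2 (Eventually.of_forall ?_)
    intro x hx ε hε
    exact hM (ε, x) ⟨hε, subset_closure hx⟩
  · exact integrableOn_const hfin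
  · refine (ae_restrict_iff' T.domain.isOpen.measurableSet).2 (Eventually.of_forall ?_)
    intro x hx ε _
    exact hasDerivAt_lagrangianAlong (h.isFamilyAt ε (subset_closure hx))

variable (T) in
/-- The vector field whose flux through the boundary is the first variation of the action. -/
def legVelocity (Φ : ℝ → X → Y) (x : X) : Eu (n + 1) :=
  leg T.L (Φ 0 x) (tang n k (Φ 0) x) (vel n k fun e => Φ e x)

lemma mem_rebase_chart {y : Y} {ψ : OpenPartialHomeomorph X (Eu (n + 1))}
    (hψ : ψ ∈ IsManifold.maximalAtlas (𝓡 (n + 1)) ∞ X) (hy : T.ρ y ∈ ψ.source) :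
    y ∈ ((T.chart y).rebase ψ hψ).total.source :=
  ((T.chart y).mem_rebase_total hψ).2 ⟨mem_chart y, hy⟩

lemma eventually_chart_symm {ψ : OpenPartialHomeomorph X (Eu (n + 1))} (hx : x ∈ ψ.source)
    {P : ℝ × X → Prop} {ε : ℝ} (h : ∀ᶠ p in 𝓝 (ε, x), P p) :
    ∀ᶠ w in 𝓝 (ψ x), P (ε, ψ.symm w) := by
  have h1 : Tendsto ψ.symm (𝓝 (ψ x)) (𝓝 x) := by
    have := ψ.continuousAt_symm (ψ.map_source hx)
    rwa [ContinuousAt, ψ.left_inv hx] at this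
  have h2 : Tendsto (fun w => (ε, ψ.symm w)) (𝓝 (ψ x)) (𝓝 (ε, x)) :=
    ((Continuous.prodMk_right ε).tendsto x).comp h1
  exact h2.eventually h

lemma vcoord_legVelocity {C : AdaptedChart n k T.ρ} (h : IsFamilyAt n k T.ρ Φ (0, x))
    (hC : Φ 0 x ∈ C.total.source) :
    ∀ᶠ w in 𝓝 (C.base x), vcoord C.base (T.legVelocity Φ) w
      = (formDensity T.vol.form C.base w)⁻¹ •
        momentumCurrent (localLagrangian T.vol T.L C) (localFamily C Φ) w := by
  have hx := h.isSectionAt.mem_base hC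
  filter_upwards [eventually_chart_symm (ψ := C.base) hx h.eventually,
    eventually_chart_symm (ψ := C.base) hx (h.eventually_mem hC),
    C.base.open_target.mem_nhds (C.base.map_source hx)] with w h1 h2 h3
  have := h1.dchart_leg T.fibred T.smooth_L h2
  rw [C.base.right_inv h3] at this
  exact this

lemma contDiffAt_momentumCurrent {C : AdaptedChart n k T.ρ} (h : IsFamilyAt n k T.ρ Φ (0, x))
    (hC : Φ 0 x ∈ C.total.source) :
    ContDiffAt ℝ ∞ (momentumCurrent (localLagrangian T.vol T.L C) (localFamily C Φ))
      (C.base x) := by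
  have hu := h.contDiffAt hC
  refine (contDiffAt_piLp 2).2 fun μ => ?_
  unfold momentumCurrent
  simp only
  refine ContDiffAt.sum fun a _ => ContDiffAt.mul ?_ ?_
  · exact ContDiffAt.comp (g := fun p => momentum (localLagrangian T.vol T.L C)
      (familyJet (localFamily C Φ) p) μ a) (f := fun w => ((0 : ℝ), w)) (C.base x)
      (contDiffAt_momentum_familyJet (r := ∞) hu (h.contDiffAt_lagrangian T.smooth_L hC) μ a)
      (contDiffAt_const.prodMk contDiffAt_id)
  · exact (contDiffAt_piLp 2).1 (contDiffAt_familyVelocity (r := ∞) hu) a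

/-- In coordinates, the density times the field is `momentumCurrent`, whose divergence is known from
`divergence_momentumCurrent`. Only the initial field has to be a solution, which is what allows
testing the differential on arbitrary variations. -/
lemma hasDivergence_legVelocity (h : T.IsFieldFamily Φ) (hsol : T.IsSolution (Φ 0)) :
    HasDivergence T.vol T.U (T.legVelocity Φ)
      (fun x => deriv (fun e => T.lagrangianAlong Φ (e, x)) 0) := by
  refine ⟨fun x hx ψ hψ hxψ => ?_, fun x hx ψ hψ hxψ => ?_⟩
  · have hf := h.isFamilyAt 0 hx
    -- The chart of the base is prescribed, so the adapted chart is rebuilt over it.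
    set C := (T.chart (Φ 0 x)).rebase ψ hψ with hCdef
    have hC : Φ 0 x ∈ C.total.source := mem_rebase_chart hψ (by rwa [hf.isSectionAt.proj])
    refine ⟨fun w => (formDensity T.vol.form ψ w)⁻¹ •
      momentumCurrent (localLagrangian T.vol T.L C) (localFamily C Φ) w, ?_, ?_⟩
    · have h1 := contDiffAt_formDensity T.vol hψ (ψ.map_source hxψ)
      have h2 := contDiffAt_momentumCurrent hf hC
      exact ((h1.inv (formDensity_ne_zero T.vol hψ (ψ.map_source hxψ))).smul h2).of_le
        (by simp)
    · filter_upwards [vcoord_legVelocity hf hC] with w hw _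
      exact hw.symm
  · have hf := h.isFamilyAt 0 (subset_closure hx)
    set C := (T.chart (Φ 0 x)).rebase ψ hψ with hCdef
    have hC : Φ 0 x ∈ C.total.source := mem_rebase_chart hψ (by rwa [hf.isSectionAt.proj])
    have h1 : (fun w => formDensity T.vol.form ψ w • vcoord ψ (T.legVelocity Φ) w)
        =ᶠ[𝓝 (ψ x)] momentumCurrent (localLagrangian T.vol T.L C) (localFamily C Φ) := by
      filter_upwards [vcoord_legVelocity hf hC, ψ.open_target.mem_nhds (ψ.map_source hxψ)]
        with w hw hwt
      have hw' : vcoord ψ (T.legVelocity Φ) w = _ := hw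
      rw [hw', smul_smul]
      have := formDensity_ne_zero T.vol hψ hwt
      show (formDensity T.vol.form ψ w * (formDensity T.vol.form ψ w)⁻¹) • _ = _
      rw [mul_inv_cancel₀ this, one_smul]
    rw [divergence_congr h1]
    have h2 : ((2 : ℕ∞) : ℕ∞ω) ≤ ((⊤ : ℕ∞) : ℕ∞ω) := WithTop.coe_le_coe.2 le_top
    have h3 := divergence_momentumCurrent ((hf.contDiffAt hC).of_le h2)
      ((hf.contDiffAt_lagrangian T.smooth_L hC).of_le h2) (hsol.2 x hx C hC)
    refine h3.trans ?_
    have h4 : (fun e => localLagrangian T.vol T.L C (familyJet (localFamily C Φ) (e, C.base x)))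
        =ᶠ[𝓝 0] fun e => T.lagrangianAlong Φ (e, x) * formDensity T.vol.form ψ (ψ x) := by
      have ht : Tendsto (fun e : ℝ => (e, x)) (𝓝 0) (𝓝 (0, x)) :=
        (Continuous.prodMk_left x).tendsto 0
      filter_upwards [ht.eventually hf.eventually, ht.eventually (hf.eventually_mem hC)]
        with e he heC
      exact (lagrangianAlong_mul he heC).symm
    rw [h4.deriv_eq, deriv_mul_const_field]

variable (T) in
/-- The flux density through the boundary. -/
def bflux (s : B) : Eu (n + 1) →ₗ[ℝ] ℝ := flux T.vol T.σ T.ι s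

/-- The first variation of the action at a solution. -/
theorem first_variation (h : T.IsFieldFamily Φ) (hsol : T.IsSolution (Φ 0)) :
    HasDerivAt (fun ε => T.action (Φ ε))
      (∫ s, T.bflux s (T.legVelocity Φ (T.ι s)) ∂T.mB) 0 := by
  have h1 := hasDerivAt_action h
  rwa [(hasDivergence_legVelocity h hsol).stokes T.isVolumeMeasure T.isVolumeMeasure_B
    T.domain] at h1

end FieldTheory


/-! ### First derivatives of fields on the closure of an open set -/

section Jets

variable {n k : ℕ} {X Y : Type*}
  [TopologicalSpace X] [ChartedSpace (Eu (n + 1)) X] [IsManifold (𝓡 (n + 1)) ∞ X]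
  [TopologicalSpace Y] [ChartedSpace (Eu (n + 1) × Eu k) Y]
  [IsManifold 𝓘(ℝ, Eu (n + 1) × Eu k) ∞ Y]
  {ρ : Y → X} {C : AdaptedChart n k ρ} {φ φ' : X → Y} {x : X}

lemma IsJet.ext (hρ : IsFibred n k ρ) {y : Y} (hy : y ∈ C.total.source)
    {A A' : Eu (n + 1) →L[ℝ] Eu (n + 1) × Eu k} (hA : IsJet ρ y A) (hA' : IsJet ρ y A')
    (h : jetCoord C y A = jetCoord C y A') : A = A' := by
  ext1 v
  rw [hA.apply_eq hρ hy, hA'.apply_eq hρ hy, h]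

lemma IsSectionAt.contDiffAt (h : IsSectionAt n k ρ φ x) (hC : φ x ∈ C.total.source) :
    ContDiffAt ℝ ∞ (localField C φ) (C.base x) := by
  have hx := h.mem_base hC
  have h2 : ContMDiffAt (𝓡 (n + 1)) 𝓘(ℝ, Eu (n + 1) × Eu k) ∞ φ (C.base.symm (C.base x)) := by
    rw [C.base.left_inv hx]; exact h.1
  have h3 : ContMDiffAt 𝓘(ℝ, Eu (n + 1) × Eu k) 𝓘(ℝ, Eu (n + 1) × Eu k) ∞ C.total
      (φ (C.base.symm (C.base x))) := by
    rw [C.base.left_inv hx]; exact contMDiffAt_of_mem_maximalAtlas C.total_mem hC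
  have h4 := ContMDiffAt.comp (C.base x) h2
    (contMDiffAt_chart_symm C.base_mem (C.base.map_source hx))
  exact contDiffAt_snd.comp (C.base x) (ContMDiffAt.comp (C.base x) h3 h4).contDiffAt

lemma tendsto_chart_symm {ψ : OpenPartialHomeomorph X (Eu (n + 1))} (hx : x ∈ ψ.source) :
    Tendsto ψ.symm (𝓝 (ψ x)) (𝓝 x) := by
  have := ψ.continuousAt_symm (ψ.map_source hx)
  rwa [ContinuousAt, ψ.left_inv hx] at this

/-- Fields that agree on the closure of an open set have the same jets there. -/
lemma localJet_eq_of_eqOn {U : Set X} (hU : IsOpen U) (h : IsSectionAt n k ρ φ x)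
    (h' : IsSectionAt n k ρ φ' x) (he : EqOn φ φ' (closure U)) (hx : x ∈ closure U)
    (hC : φ x ∈ C.total.source) : localJet C φ (C.base x) = localJet C φ' (C.base x) := by
  have hxb := h.mem_base hC
  have hC' : φ' x ∈ C.total.source := he hx ▸ hC
  have ht := tendsto_chart_symm (n := n) hxb
  have hc : ∀ {ξ : X → Y}, IsSectionAt n k ρ ξ x → ξ x ∈ C.total.source →
      ContinuousAt (fderiv ℝ (localField C ξ)) (C.base x) := fun h hC =>
    ((h.contDiffAt hC).fderiv_right (m := 0) (by simp)).continuousAt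
  -- The point is approached from inside `U`, where the derivatives agree; continuity of both
  -- derivatives carries the equality to the limit.
  set F : Filter (Eu (n + 1)) := 𝓝 (C.base x) ⊓ 𝓟 (C.base.symm ⁻¹' U) with hF
  have : F.NeBot := by
    rw [hF, inf_principal_neBot_iff]
    intro O hO
    have h1 : C.base.source ∩ C.base ⁻¹' O ∈ 𝓝 x :=
      inter_mem (C.base.open_source.mem_nhds hxb) (C.base.continuousAt hxb hO)
    obtain ⟨x', ⟨hx1, hx2⟩, hx3⟩ := mem_closure_iff_nhds.1 hx _ h1
    refine ⟨C.base x', hx2, ?_⟩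
    show C.base.symm (C.base x') ∈ U
    rwa [C.base.left_inv hx1]
  have hev : fderiv ℝ (localField C φ) =ᶠ[F] fderiv ℝ (localField C φ') := by
    have h1 : ∀ᶠ w in F, w ∈ C.base.target ∧ C.base.symm w ∈ U :=
      (Eventually.filter_mono inf_le_left
        (C.base.open_target.mem_nhds (C.base.map_source hxb))).and
        (Eventually.filter_mono inf_le_right (mem_principal_self _))
    filter_upwards [h1] with w hw
    refine Filter.EventuallyEq.fderiv_eq ?_
    have h2 : ∀ᶠ w' in 𝓝 w, C.base.symm w' ∈ U :=
      (C.base.continuousAt_symm hw.1).eventually (hU.mem_nhds hw.2)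
    filter_upwards [h2] with w' hw'
    unfold localField
    rw [he (subset_closure hw')]
  have h1 := ((hc h hC).mono_left (inf_le_left : F ≤ _))
  have h2 := ((hc h' hC').mono_left (inf_le_left : F ≤ _))
  have h3 := tendsto_nhds_unique_of_eventuallyEq h1 h2 hev
  refine Prod.ext rfl (Prod.ext ?_ h3)
  show (C.total (φ (C.base.symm (C.base x)))).2 = (C.total (φ' (C.base.symm (C.base x)))).2
  rw [C.base.left_inv hxb, he hx]

/-- Uniqueness of solutions is stated on the closure only, while the momenta at the boundary involve
full first derivatives; this makes the momenta independent of the extension beyond the closure. -/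
lemma tang_eq_of_eqOn (hρ : IsFibred n k ρ) {U : Set X} (hU : IsOpen U)
    (h : IsSectionAt n k ρ φ x)
    (h' : IsSectionAt n k ρ φ' x) (he : EqOn φ φ' (closure U)) (hx : x ∈ closure U) :
    tang n k φ x = tang n k φ' x := by
  obtain ⟨C, hC⟩ := hρ.exists_chart (φ x)
  have hC' : φ' x ∈ C.total.source := he hx ▸ hC
  have h2 : IsJet ρ (φ x) (tang n k φ' x) := by
    rw [he hx]; exact h'.isJet hρ
  refine IsJet.ext hρ hC (h.isJet hρ) h2 ?_
  have e1 : jetCoord C (φ x) (tang n k φ x) = localJet C φ (C.base x) := h.jetCoord_eq hC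
  have e2 : jetCoord C (φ' x) (tang n k φ' x) = localJet C φ' (C.base x) := h'.jetCoord_eq hC'
  rw [e1, he hx, e2]
  exact localJet_eq_of_eqOn hU h h' he hx hC

end Jets

/-! ### The boundary as a topological space -/

section BoundaryTopology

variable {n : ℕ} {X B : Type*}
  [TopologicalSpace X] [ChartedSpace (Eu (n + 1)) X] [IsManifold (𝓡 (n + 1)) ∞ X]
  [TopologicalSpace B] [ChartedSpace (Eu n) B] [IsManifold (𝓡 n) ∞ B]
  {vol : VolumeForm (n + 1) X} {σ : VolumeForm n B} {U : Set X} {ι : B → X}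

/-- In slice coordinates, dropping the transverse coordinate is a continuous local left inverse of
`ι`. Compactness of `∂U` as a manifold follows, and neighbourhoods in it come from neighbourhoods in
`X`. -/
lemma IsSmoothDomain.isInducing (h : IsSmoothDomain vol σ U ι) : Topology.IsInducing ι := by
  refine Topology.isInducing_iff_nhds.2 fun s => le_antisymm
    ((h.contMDiff.continuous.tendsto s).le_comap) ?_
  obtain ⟨ψ, κ, hs, hm⟩ := h.exists_slice s
  have hm' := (hs.source_iff s).1 hm
  set P : Eu (n + 1) → Eu n := fun z => WithLp.toLp 2 fun j => z j.succ with hP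
  have hPc : Continuous P := by
    have : Continuous fun z : Eu (n + 1) => fun j : Fin n => z j.succ := by fun_prop
    exact (PiLp.continuous_toLp 2 _).comp this
  have hPh : ∀ w : Eu n, P (hyperplane w) = w := by
    intro w
    ext j
    simp [hP]
  set F : X → B := fun x => κ.symm (P (ψ x)) with hF
  have hFs : ∀ t ∈ κ.source, F (ι t) = t := by
    intro t ht
    simp only [hF]
    rw [hs.coord t ht, hPh, κ.left_inv ht]
  have hFc : ContinuousAt F (ι s) := by
    refine ContinuousAt.comp (g := κ.symm) (f := fun x => P (ψ x)) ?_
      (hPc.continuousAt.comp (ψ.continuousAt hm'))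
    rw [hs.coord s hm, hPh]
    exact κ.continuousAt_symm (κ.map_source hm)
  have h1 : Tendsto (F ∘ ι) (comap ι (𝓝 (ι s))) (𝓝 s) := by
    have := hFc.tendsto
    rw [hFs s hm] at this
    exact this.comp tendsto_comap
  -- All boundary points mapped near `ι s` lie in the source of `κ`, by `source_iff`; no other sheet
  -- of the boundary comes close.
  have h2 : F ∘ ι =ᶠ[comap ι (𝓝 (ι s))] id := by
    have : ∀ᶠ x in 𝓝 (ι s), x ∈ ψ.source := ψ.open_source.mem_nhds hm'
    filter_upwards [this.comap ι] with t ht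
    exact hFs t ((hs.source_iff t).2 ht)
  exact (h1.congr' h2)

lemma IsSmoothDomain.compactSpace (h : IsSmoothDomain vol σ U ι) : CompactSpace B := by
  refine ⟨h.isInducing.isCompact_iff.2 ?_⟩
  rw [image_univ, h.range_eq]
  exact h.isCompact_closure.of_isClosed_subset isClosed_frontier frontier_subset_closure

lemma IsSmoothDomain.mem_closure (h : IsSmoothDomain vol σ U ι) (s : B) : ι s ∈ closure U :=
  frontier_subset_closure (h.range_eq ▸ mem_range_self s)

end BoundaryTopology

/-! ### The action and the boundary Lagrangian of an admissible boundary datum -/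

namespace FieldTheory

variable {n k : ℕ} {X Y B : Type*}
  [TopologicalSpace X] [T2Space X] [SecondCountableTopology X]
  [ChartedSpace (Eu (n + 1)) X] [IsManifold (𝓡 (n + 1)) ∞ X]
  [MeasurableSpace X] [BorelSpace X]
  [TopologicalSpace Y] [ChartedSpace (Eu (n + 1) × Eu k) Y]
  [IsManifold 𝓘(ℝ, Eu (n + 1) × Eu k) ∞ Y]
  [TopologicalSpace B] [T2Space B] [SecondCountableTopology B]
  [ChartedSpace (Eu n) B] [IsManifold (𝓡 n) ∞ B]
  [MeasurableSpace B] [BorelSpace B]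
  {T : FieldTheory n k X Y B} {Φ : ℝ → X → Y} {φ φ' : X → Y} {x : X}

lemma action_congr (h : EqOn φ φ' (closure T.U)) : T.action φ = T.action φ' := by
  refine setIntegral_congr_fun T.domain.isOpen.measurableSet fun x hx => ?_
  have h1 : φ =ᶠ[𝓝 x] φ' := by
    filter_upwards [T.domain.isOpen.mem_nhds hx] with x' hx'
    exact h (subset_closure hx')
  show jev T.L (φ x) (tang n k φ x) = jev T.L (φ' x) (tang n k φ' x)
  rw [h1.self_of_nhds, tang, mder_congr h1, tang]

/-- The solution chosen in the definition agrees with any other on the closure, and the action only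
sees the field there. -/
lemma boundaryLagrangian_eq {b : T.BoundaryData} (hb : b ∈ T.admissible) (hφ : T.Solves φ b) :
    T.boundaryLagrangian b = T.action φ := by
  have h : ∃ φ, T.Solves φ b := ⟨φ, hφ⟩
  obtain ⟨φ₀, -, h0⟩ := hb
  rw [boundaryLagrangian, dif_pos h]
  exact action_congr fun x hx =>
    (h0 _ (Classical.choose_spec h) hx).trans (h0 _ hφ hx).symm

lemma admissible_eqOn {b : T.BoundaryData} (hb : b ∈ T.admissible) (hφ : T.Solves φ b)
    (hφ' : T.Solves φ' b) : EqOn φ φ' (closure T.U) := by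
  obtain ⟨φ₀, -, h0⟩ := hb
  exact fun x hx => (h0 _ hφ hx).trans (h0 _ hφ' hx).symm

/-- Single fields thereby inherit the regularity statements proved for families. -/
lemma isFieldFamily_const (h : T.IsField φ) : T.IsFieldFamily fun _ => φ := by
  refine eventually_nhdsSet_iff_forall.2 fun p hp => ?_
  have h1 := eventually_nhdsSet_iff_forall.1 h p.2 hp.2
  filter_upwards [continuousAt_snd.eventually h1] with q hq
  exact ⟨ContMDiffAt.comp q hq.1 contMDiffAt_snd, hq.2⟩

lemma IsField.isSectionAt (h : T.IsField φ) (hx : x ∈ closure T.U) :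
    IsSectionAt n k T.ρ φ x :=
  ((isFieldFamily_const h).isFamilyAt 0 hx).isSectionAt

/-! ### Normal momenta -/

section Slice

variable {ψ : OpenPartialHomeomorph X (Eu (n + 1))} {κ : OpenPartialHomeomorph B (Eu n)}

/-- The normal momentum in slice coordinates. -/
lemma bflux_leg_cvert (h : IsSlice T.vol T.σ T.U T.ι ψ κ) {t : B} (ht : t ∈ κ.source)
    {C : AdaptedChart n k T.ρ} {y : Y} (hy : y ∈ C.total.source) (hyt : T.ρ y = T.ι t)
    {A : Eu (n + 1) →L[ℝ] Eu (n + 1) × Eu k} (hA : IsJet T.ρ y A) (a : Fin k) :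
    T.bflux t (leg T.L y A (C.cvert y a))
      = momentum (localLagrangian T.vol T.L (C.rebase ψ h.mem_atlas))
        (jetCoord (C.rebase ψ h.mem_atlas) y A) 0 a / formDensity T.σ.form κ (κ t) := by
  set C' := C.rebase ψ h.mem_atlas with hC'
  have htψ := (h.source_iff t).1 ht
  have hy' : y ∈ C'.total.source := (C.mem_rebase_total h.mem_atlas).2 ⟨hy, hyt ▸ htψ⟩
  have h0 := formDensity_ne_zero T.vol h.mem_atlas (ψ.map_source htψ)
  rw [← C.cvert_rebase h.mem_atlas T.fibred hy' a, bflux, h.flux_eq ht]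
  congr 1
  have h1 := dchart_leg T.fibred T.smooth_L hy' hA (C'.dproj_cvert T.fibred hy' a)
  rw [C'.ctot_cvert hy', hyt] at h1
  have h2 : dchart ψ (T.ι t) (leg T.L y A (C'.cvert y a)) = _ := h1
  rw [h2]
  simp only [PiLp.smul_apply, smul_eq_mul]
  have h3 : ∑ b, momentum (localLagrangian T.vol T.L C') (jetCoord C' y A) 0 b
      * ((stdVec a : Eu k) b) = momentum (localLagrangian T.vol T.L C') (jetCoord C' y A) 0 a := by
    rw [Finset.sum_eq_single a]
    · simp [stdVec]
    · intro b _ hb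
      simp [stdVec, hb]
    · simp
  rw [h3]
  show (formDensity T.vol.form ψ (ψ (T.ι t)))⁻¹ * _ * _ = _
  field_simp

end Slice

/-- By `bflux_leg_cvert` the normal momentum is the transverse momentum over a slice chart divided
by the boundary density, and both depend smoothly on parameter and point. This makes the momenta
smooth sections, and curves of them smooth curves. -/
lemma contMDiffAt_bflux_leg (h : T.IsFieldFamily Φ) {ε : ℝ} {s : B}
    {C : AdaptedChart n k T.ρ} (hC : Φ ε (T.ι s) ∈ C.total.source) (a : Fin k) :
    ContMDiffAt (𝓘(ℝ, ℝ).prod (𝓡 n)) 𝓘(ℝ, ℝ) ∞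
      (fun p : ℝ × B => T.bflux p.2 (leg T.L (Φ p.1 (T.ι p.2)) (tang n k (Φ p.1) (T.ι p.2))
        (C.cvert (Φ p.1 (T.ι p.2)) a))) (ε, s) := by
  obtain ⟨ψ, κ, hs, hm⟩ := T.domain.exists_slice s
  have hf := h.isFamilyAt ε (T.domain.mem_closure s)
  have hmψ := (hs.source_iff s).1 hm
  set C' := C.rebase ψ hs.mem_atlas with hC'
  have hCs' : Φ ε (T.ι s) ∈ C'.total.source :=
    (C.mem_rebase_total hs.mem_atlas).2 ⟨hC, by rwa [hf.isSectionAt.proj]⟩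
  have hι : ContMDiffAt (𝓘(ℝ, ℝ).prod (𝓡 n)) (𝓡 (n + 1)) ∞ (fun p : ℝ × B => T.ι p.2) (ε, s) :=
    T.domain.contMDiff.contMDiffAt.comp (ε, s) contMDiffAt_snd
  have hψι : ContMDiffAt (𝓘(ℝ, ℝ).prod (𝓡 n)) 𝓘(ℝ, Eu (n + 1)) ∞
      (fun p : ℝ × B => ψ (T.ι p.2)) (ε, s) :=
    ContMDiffAt.comp (g := ψ) (f := fun p : ℝ × B => T.ι p.2) (ε, s)
      (contMDiffAt_chart hs.mem_atlas hmψ) hι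
  have h1 : ContMDiffAt (𝓘(ℝ, ℝ).prod (𝓡 n)) 𝓘(ℝ, ℝ × Eu (n + 1)) ∞
      (fun p : ℝ × B => (p.1, ψ (T.ι p.2))) (ε, s) :=
    contMDiffAt_fst.prodMk_space hψι
  have h2 := contDiffAt_momentum_familyJet (r := ∞) (hf.contDiffAt hCs')
    (hf.contDiffAt_lagrangian T.smooth_L hCs') 0 a
  have h3 := ContMDiffAt.comp (g := fun q => momentum (localLagrangian T.vol T.L C')
    (familyJet (localFamily C' Φ) q) 0 a) (ε, s) h2.contMDiffAt h1
  have h4 : ContMDiffAt (𝓘(ℝ, ℝ).prod (𝓡 n)) 𝓘(ℝ, ℝ) ∞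
      (fun p : ℝ × B => (formDensity T.σ.form κ (κ p.2))⁻¹) (ε, s) := by
    have e1 : ContMDiffAt (𝓡 n) 𝓘(ℝ, ℝ) ∞ (fun t => (formDensity T.σ.form κ (κ t))⁻¹) s :=
      ContMDiffAt.comp (g := fun w => (formDensity T.σ.form κ w)⁻¹) (f := κ) s
        ((contDiffAt_formDensity T.σ hs.mem_atlas_boundary (κ.map_source hm)).inv
          (formDensity_ne_zero T.σ hs.mem_atlas_boundary (κ.map_source hm))).contMDiffAt
        (contMDiffAt_chart hs.mem_atlas_boundary hm)
    exact ContMDiffAt.comp (g := fun t => (formDensity T.σ.form κ (κ t))⁻¹)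
      (f := (Prod.snd : ℝ × B → B)) (ε, s) e1 contMDiffAt_snd
  refine (h3.mul h4).congr_of_eventuallyEq ?_
  have ht : Tendsto (fun p : ℝ × B => (p.1, T.ι p.2)) (𝓝 (ε, s)) (𝓝 (ε, T.ι s)) :=
    (continuous_fst.prodMk (T.domain.contMDiff.continuous.comp continuous_snd)).tendsto (ε, s)
  filter_upwards [ht.eventually hf.eventually, ht.eventually (hf.eventually_mem hC),
    (continuous_snd.tendsto (ε, s)).eventually (κ.open_source.mem_nhds hm)] with p hp hpC hpκ
  have hp' := hp.isSectionAt
  have hpC' : Φ p.1 (T.ι p.2) ∈ C'.total.source :=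
    (C.mem_rebase_total hs.mem_atlas).2 ⟨hpC, by
      rw [hp'.proj]; exact (hs.source_iff p.2).1 hpκ⟩
  have hjet : IsJet T.ρ (Φ p.1 (T.ι p.2)) (tang n k (Φ p.1) (T.ι p.2)) := hp'.isJet T.fibred
  rw [bflux_leg_cvert hs hpκ hpC hp'.proj hjet a, div_eq_mul_inv]
  have e2 : jetCoord C' (Φ p.1 (T.ι p.2)) (tang n k (Φ p.1) (T.ι p.2))
      = localJet C' (Φ p.1) (ψ (T.ι p.2)) := hp'.jetCoord_eq hpC'
  rw [e2]
  rfl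

end FieldTheory


/-! ### Evaluation of covectors on vertical vectors -/

section VertEval

variable {n k : ℕ} {X Y : Type*}
  [TopologicalSpace X] [ChartedSpace (Eu (n + 1)) X]
  [TopologicalSpace Y] [ChartedSpace (Eu (n + 1) × Eu k) Y]
  {ρ : Y → X} {y : Y} {W : Type*} [AddCommGroup W] [Module ℝ W]

lemma vertEval_of_vertical (f : Vert n k ρ y →ₗ[ℝ] W) {v : Eu (n + 1) × Eu k}
    (hv : dproj ρ y v = 0) : vertEval f v = f ⟨v, hv⟩ := dif_pos hv

lemma vertEval_smul (f : Vert n k ρ y →ₗ[ℝ] W) {v : Eu (n + 1) × Eu k}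
    (hv : dproj ρ y v = 0) (c : ℝ) :
    vertEval f (show Eu (n + 1) × Eu k from c • v) = c • vertEval f v := by
  rw [vertEval_of_vertical f hv,
    vertEval_of_vertical f (v := c • v) (by rw [map_smul, hv, smul_zero])]
  exact f.map_smul c ⟨v, hv⟩

lemma vertEval_zero (f : Vert n k ρ y →ₗ[ℝ] W) :
    vertEval f (0 : Eu (n + 1) × Eu k) = 0 := by
  rw [vertEval_of_vertical f (v := 0) (map_zero _)]
  exact f.map_zero

end VertEval

namespace FieldTheory

variable {n k : ℕ} {X Y B : Type*}
  [TopologicalSpace X] [T2Space X] [SecondCountableTopology X]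
  [ChartedSpace (Eu (n + 1)) X] [IsManifold (𝓡 (n + 1)) ∞ X]
  [MeasurableSpace X] [BorelSpace X]
  [TopologicalSpace Y] [ChartedSpace (Eu (n + 1) × Eu k) Y]
  [IsManifold 𝓘(ℝ, Eu (n + 1) × Eu k) ∞ Y]
  [TopologicalSpace B] [T2Space B] [SecondCountableTopology B]
  [ChartedSpace (Eu n) B] [IsManifold (𝓡 n) ∞ B]
  [MeasurableSpace B] [BorelSpace B]
  {T : FieldTheory n k X Y B} {Φ : ℝ → X → Y} {φ φ' : X → Y} {x : X} {b : T.BoundaryData}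

/-! ### The momenta of a solution -/

lemma Solves.isJet (hφ : T.Solves φ b) (s : B) :
    IsJet T.ρ (b.toFun s) (tang n k φ (T.ι s)) := by
  rw [← hφ.2 s]
  exact (hφ.1.1.isSectionAt (T.domain.mem_closure s)).isJet T.fibred

/-- The normal momentum of a solution at a boundary point. -/
def legMom (hφ : T.Solves φ b) (s : B) :
    Vert n k T.ρ (b.toFun s) →ₗ[ℝ] (TangentSpace (𝓡 n) s [⋀^Fin n]→L[ℝ] ℝ) where
  toFun v := T.bflux s (leg T.L (b.toFun s) (tang n k φ (T.ι s)) v.1) • T.σ.form s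
  map_add' v w := by
    have h := leg_add T.fibred T.smooth_L (hφ.isJet s) v.2 w.2
    have h2 : T.bflux s (leg T.L (b.toFun s) (tang n k φ (T.ι s)) (v + w).1)
      = T.bflux s (leg T.L (b.toFun s) (tang n k φ (T.ι s)) v.1)
        + T.bflux s (leg T.L (b.toFun s) (tang n k φ (T.ι s)) w.1) :=
      (congrArg (T.bflux s) h).trans (map_add _ _ _)
    rw [h2, add_smul]
  map_smul' c v := by
    have h := leg_smul T.fibred T.smooth_L (hφ.isJet s) v.2 c
    have h2 : T.bflux s (leg T.L (b.toFun s) (tang n k φ (T.ι s)) (c • v).1)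
      = c * T.bflux s (leg T.L (b.toFun s) (tang n k φ (T.ι s)) v.1) :=
      (congrArg (T.bflux s) h).trans (map_smul _ _ _)
    rw [h2, mul_smul]
    rfl

lemma formQuot_smul_form (c : ℝ) (s : B) : formQuot (c • T.σ.form s) (T.σ.form s) = c := by
  have h0 : T.σ.at s (fun i => stdVec i) ≠ 0 := topForm_std_ne_zero (T.σ.at_ne_zero s)
  show c * T.σ.at s (fun i => stdVec i) / T.σ.at s (fun i => stdVec i) = c
  field_simp

lemma formQuot_legMom (hφ : T.Solves φ b) (s : B) {v : Eu (n + 1) × Eu k}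
    (hv : dproj T.ρ (b.toFun s) v = 0) :
    formQuot (vertEval (legMom hφ s) v) (T.σ.form s)
      = T.bflux s (leg T.L (b.toFun s) (tang n k φ (T.ι s)) v) := by
  rw [vertEval_of_vertical _ hv]
  exact formQuot_smul_form _ s

lemma momComponent_legMom (hφ : T.Solves φ b) {C : AdaptedChart n k T.ρ} {s : B}
    (hC : b.toFun s ∈ C.total.source) (a : Fin k) :
    T.momComponent C b.toFun (legMom hφ) s a
      = T.bflux s (leg T.L (b.toFun s) (tang n k φ (T.ι s)) (C.cvert (b.toFun s) a)) :=
  formQuot_legMom hφ s (C.dproj_cvert T.fibred hC a)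

lemma contMDiffAt_momComponent_legMom {c : ℝ → T.BoundaryData} (hΦ : T.IsFieldFamily Φ)
    (hc : ∀ ε, T.Solves (Φ ε) (c ε)) {C : AdaptedChart n k T.ρ} (a : Fin k) {ε : ℝ} {s : B}
    (hC : (c ε).toFun s ∈ C.total.source) :
    ContMDiffAt (𝓘(ℝ, ℝ).prod (𝓡 n)) 𝓘(ℝ, ℝ) ∞
      (fun p : ℝ × B => T.momComponent C (c p.1).toFun (legMom (hc p.1)) p.2 a) (ε, s) := by
  have hC' : Φ ε (T.ι s) ∈ C.total.source := by rwa [(hc ε).2]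
  refine (contMDiffAt_bflux_leg hΦ hC' a).congr_of_eventuallyEq ?_
  have hf := hΦ.isFamilyAt ε (T.domain.mem_closure s)
  have ht : Tendsto (fun p : ℝ × B => (p.1, T.ι p.2)) (𝓝 (ε, s)) (𝓝 (ε, T.ι s)) :=
    (continuous_fst.prodMk (T.domain.contMDiff.continuous.comp continuous_snd)).tendsto (ε, s)
  filter_upwards [ht.eventually (hf.eventually_mem hC')] with p hp
  have hp' : (c p.1).toFun p.2 ∈ C.total.source := by
    rw [← (hc p.1).2 p.2]; exact hp
  rw [momComponent_legMom (hc p.1) hp', ← (hc p.1).2 p.2]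

/-- The momenta of a solution. -/
def legMomenta (hφ : T.Solves φ b) : T.NormalMomenta where
  base := b
  mom := legMom hφ
  smooth_mom C a s hC := by
    have h1 := contMDiffAt_momComponent_legMom (isFieldFamily_const hφ.1.1) (c := fun _ => b)
      (fun _ => hφ) a (ε := 0) hC
    exact ContMDiffAt.comp (g := fun p : ℝ × B => T.momComponent C b.toFun (legMom hφ) p.2 a)
      (f := fun t : B => ((0 : ℝ), t)) s h1 (contMDiffAt_const.prodMk contMDiffAt_id)

lemma pairing_legMomenta (hφ : T.Solves φ b) {δ : B → Eu (n + 1) × Eu k}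
    (hδ : ∀ s, dproj T.ρ (b.toFun s) (δ s) = 0) :
    T.pairing (legMomenta hφ) δ
      = ∫ s, T.bflux s (leg T.L (b.toFun s) (tang n k φ (T.ι s)) (δ s)) ∂T.mB :=
  integral_congr_ae (Eventually.of_forall fun s => formQuot_legMom hφ s (hδ s))

/-- The differential of the boundary Lagrangian is the covector of momenta. -/
lemma isDifferential_legMomenta (hb : b ∈ T.admissible) (hφ : T.Solves φ b) :
    T.IsDifferential (legMomenta hφ) := by
  -- The clause about arbitrary variations comes first; the one about admissible curves is its
  -- special case, since the boundary Lagrangian along the curve is the action of the solutions.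
  have key : ∀ Φ : ℝ → X → Y, T.IsFieldFamily Φ → T.Solves (Φ 0) b →
      HasDerivAt (fun ε => T.action (Φ ε))
        (T.pairing (legMomenta hφ) fun s => vel n k fun ε => Φ ε (T.ι s)) 0 := by
    intro Φ hΦ hs
    have hv : ∀ s, dproj T.ρ (b.toFun s) (vel n k fun ε => Φ ε (T.ι s)) = 0 := by
      intro s
      rw [← hs.2 s]
      exact (hΦ.isFamilyAt 0 (T.domain.mem_closure s)).dproj_vel T.fibred
    rw [pairing_legMomenta hφ hv]
    refine (first_variation hΦ hs.1).congr_deriv ?_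
    refine integral_congr_ae (Eventually.of_forall fun s => ?_)
    have hx := T.domain.mem_closure s
    simp only [legVelocity]
    -- The initial field of the family and `φ` may differ off the closure of `U`, but not in their
    -- tangent maps at the boundary.
    rw [hs.2 s, tang_eq_of_eqOn T.fibred T.domain.isOpen (hs.1.1.isSectionAt hx)
      (hφ.1.1.isSectionAt hx) (admissible_eqOn hb hs hφ) hx]
  refine ⟨fun c hc hc0 => ?_, key⟩
  obtain ⟨hadm, Φ, hΦ, hs⟩ := hc
  have hc0' : c 0 = b := hc0
  have h1 := key Φ hΦ.1 (hc0' ▸ hs 0)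
  have h2 : (fun ε => T.boundaryLagrangian (c ε)) = fun ε => T.action (Φ ε) :=
    funext fun ε => boundaryLagrangian_eq (hadm ε) (hs ε)
  rw [h2]
  have h3 : ∀ s, (fun ε => (c ε).toFun s) = fun ε => Φ ε (T.ι s) :=
    fun s => funext fun ε => ((hs ε).2 s).symm
  have h4 : T.pairing (legMomenta hφ) (fun s => vel n k fun ε => (c ε).toFun s)
      = T.pairing (legMomenta hφ) fun s => vel n k fun ε => Φ ε (T.ι s) := by
    simp only [h3]
  exact h1.congr_deriv h4.symm

/-! ### Uniqueness of the differential -/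

/-- Variations of a field in the direction of a fibre coordinate with a given cutoff. -/
lemma exists_bump_variation (hφ : T.IsField φ) {x₀ : X} (hx₀ : x₀ ∈ closure T.U)
    {C : AdaptedChart n k T.ρ} (hC : φ x₀ ∈ C.total.source) (a : Fin k) :
    ∃ O, IsOpen O ∧ x₀ ∈ O ∧ (∀ x ∈ O, φ x ∈ C.total.source) ∧ ∃ r : ℝ, 0 < r ∧
      ∀ χ : X → ℝ, ContMDiff (𝓡 (n + 1)) 𝓘(ℝ, ℝ) ∞ χ → (∀ x, |χ x| ≤ 1) → tsupport χ ⊆ O →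
        ∃ Φ, T.IsFieldFamily Φ ∧ Φ 0 = φ ∧
          ∀ x, vel n k (fun e => Φ e x) = (r * χ x) • C.cvert (φ x) a := by
  classical
  have hconst := isFieldFamily_const hφ
  have hf := hconst.isFamilyAt 0 hx₀
  set w : Eu (n + 1) × Eu k := (0, stdVec a) with hw
  have ht0 : Tendsto (fun x => ((0 : ℝ), x)) (𝓝 x₀) (𝓝 (0, x₀)) :=
    (Continuous.prodMk_right (0 : ℝ)).tendsto x₀
  have h1 : ∀ᶠ x in 𝓝 x₀, IsSectionAt n k T.ρ φ x ∧ φ x ∈ C.total.source :=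
    ((ht0.eventually hf.eventually).mono fun x hx => hx.isSectionAt).and
      (ht0.eventually (hf.eventually_mem hC))
  have hct : ContinuousAt (fun p : X × ℝ => C.total (φ p.1) + p.2 • w) (x₀, 0) := by
    refine ContinuousAt.add ?_ (continuousAt_snd.smul continuousAt_const)
    exact ContinuousAt.comp (g := C.total) (f := fun p : X × ℝ => φ p.1)
      (C.total.continuousAt hC)
      (ContinuousAt.comp (g := φ) (f := Prod.fst)
        hf.isSectionAt.1.continuousAt continuousAt_fst)
  have h2 : ∀ᶠ p : X × ℝ in 𝓝 (x₀, 0), C.total (φ p.1) + p.2 • w ∈ C.total.target := by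
    refine hct.eventually (C.total.open_target.mem_nhds ?_)
    simpa using C.total.map_source hC
  rw [nhds_prod_eq] at h2
  obtain ⟨P, hP, Q, hQ, hPQ⟩ := eventually_prod_iff.1 h2
  obtain ⟨r', hr', hball⟩ := Metric.eventually_nhds_iff_ball.1 hQ
  obtain ⟨O, hO, hOo, hxO⟩ := eventually_nhds_iff.1 (h1.and hP)
  refine ⟨O, hOo, hxO, fun x hx => (hO x hx).1.2, r' / 2, half_pos hr', ?_⟩
  set r := r' / 2 with hr
  intro χ hχ hχ1 hχO
  -- Displacing by `sin e` instead of `e` bounds the displacement by `r`, so the family stays in the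
  -- chart for all real parameters and still has a nonzero velocity at `0`.
  have htar : ∀ x ∈ O, ∀ e : ℝ, C.total (φ x) + (r * Real.sin e * χ x) • w ∈ C.total.target := by
    intro x hx e
    refine hPQ (hO x hx).2 (hball _ ?_)
    rw [Metric.mem_ball, dist_zero_right, Real.norm_eq_abs, abs_mul, abs_mul,
      abs_of_pos (half_pos hr')]
    have e1 : |Real.sin e| * |χ x| ≤ 1 :=
      mul_le_one₀ (Real.abs_sin_le_one e) (abs_nonneg _) (hχ1 x)
    calc r * |Real.sin e| * |χ x| = r * (|Real.sin e| * |χ x|) := by ring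
      _ ≤ r * 1 := mul_le_mul_of_nonneg_left e1 (half_pos hr').le
      _ < r' := by rw [hr]; linarith
  set Φ : ℝ → X → Y := fun e x =>
    if x ∈ O then C.total.symm (C.total (φ x) + (r * Real.sin e * χ x) • w) else φ x with hΦ
  have hin : ∀ x ∈ O, ∀ e, Φ e x = C.total.symm (C.total (φ x) + (r * Real.sin e * χ x) • w) :=
    fun x hx e => if_pos hx
  have hout : ∀ x e, χ x = 0 → Φ e x = φ x := by
    intro x e hx
    by_cases h : x ∈ O
    · rw [hin x h, hx, mul_zero, zero_smul, add_zero, C.total.left_inv (hO x h).1.2]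
    · exact if_neg h
  have h0 : Φ 0 = φ := by
    funext x
    by_cases h : x ∈ O
    · rw [hin x h, Real.sin_zero, mul_zero, zero_mul, zero_smul, add_zero,
        C.total.left_inv (hO x h).1.2]
    · exact if_neg h
  refine ⟨Φ, ?_, h0, ?_⟩
  · refine eventually_nhdsSet_iff_forall.2 fun p hp => ?_
    by_cases hpO : p.2 ∈ O
    · filter_upwards [(continuous_snd.tendsto p).eventually (hOo.mem_nhds hpO)] with q hq
      refine ⟨?_, ?_⟩
      · have e1 : ContMDiffAt (𝓘(ℝ, ℝ).prod (𝓡 (n + 1))) 𝓘(ℝ, Eu (n + 1) × Eu k) ∞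
            (fun q : ℝ × X => C.total (φ q.2)) q :=
          ContMDiffAt.comp (g := C.total) (f := fun q : ℝ × X => φ q.2) q
            (contMDiffAt_of_mem_maximalAtlas C.total_mem (hO q.2 hq).1.2)
            (ContMDiffAt.comp (g := φ) (f := Prod.snd) q (hO q.2 hq).1.1.1 contMDiffAt_snd)
        have e2 : ContMDiffAt (𝓘(ℝ, ℝ).prod (𝓡 (n + 1))) 𝓘(ℝ, ℝ) ∞
            (fun q : ℝ × X => r * Real.sin q.1 * χ q.2) q := by
          refine ContMDiffAt.mul (contMDiffAt_const.mul ?_) ?_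
          · exact ContMDiffAt.comp (g := Real.sin) (f := Prod.fst) q
              Real.contDiff_sin.contMDiff.contMDiffAt contMDiffAt_fst
          · exact ContMDiffAt.comp (g := χ) (f := Prod.snd) q (hχ q.2) contMDiffAt_snd
        have e3 := e1.add (e2.smul (contMDiffAt_const (c := w)))
        have e4 := ContMDiffAt.comp (g := C.total.symm) q
          (contMDiffAt_symm_of_mem_maximalAtlas C.total_mem (htar q.2 hq q.1)) e3
        refine e4.congr_of_eventuallyEq ?_
        filter_upwards [(continuous_snd.tendsto q).eventually (hOo.mem_nhds hq)] with q' hq'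
        exact hin q'.2 hq' q'.1
      · rw [hin q.2 hq, C.proj_symm (htar q.2 hq q.1)]
        have e1 : (C.total (φ q.2) + (r * Real.sin q.1 * χ q.2) • w).1 = C.base q.2 := by
          rw [Prod.fst_add, Prod.smul_fst, hw, smul_zero, add_zero, C.fst_eq _ (hO q.2 hq).1.2,
            (hO q.2 hq).1.1.proj]
        rw [e1, C.base.left_inv ((hO q.2 hq).1.1.mem_base (hO q.2 hq).1.2)]
    -- Outside `O` the cutoff vanishes nearby, and the family is locally the constant one.
    · have hn : p.2 ∉ tsupport χ := fun h => hpO (hχO h)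
      have hev : ∀ᶠ q : ℝ × X in 𝓝 p, q.2 ∉ tsupport χ :=
        (continuous_snd.tendsto p).eventually ((isClosed_tsupport χ).isOpen_compl.mem_nhds hn)
      have hz : ∀ q : ℝ × X, q.2 ∉ tsupport χ → Φ q.1 q.2 = φ q.2 := fun q hq =>
        hout q.2 q.1 (image_eq_zero_of_notMem_tsupport hq)
      filter_upwards [eventually_eventually_nhds.2 hev, hconst.isFamilyAt p.1 hp.2] with q hq hq2
      refine ⟨hq2.1.congr_of_eventuallyEq (hq.mono fun q' hq' => hz q' hq'), ?_⟩
      rw [hz q hq.self_of_nhds]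
      exact hq2.2
  · intro x
    by_cases hxO : x ∈ O
    · have e0 : (fun e => Φ e x)
          = C.total.symm ∘ fun e => C.total (φ x) + (r * Real.sin e * χ x) • w :=
        funext fun e => hin x hxO e
      have e1 : HasDerivAt (fun e => C.total (φ x) + (r * Real.sin e * χ x) • w)
          ((r * χ x) • w) 0 := by
        have := ((((Real.hasDerivAt_sin 0).const_mul r).mul_const (χ x)).smul_const w).const_add
          (C.total (φ x))
        simpa using this
      have e2 : C.total (φ x) + (r * Real.sin 0 * χ x) • w = C.total (φ x) := by simp
      have hs := mdifferentiableAt_total_symm C.total_mem (C.total.map_source (hO x hxO).1.2)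
      have e3 := mder_comp (E := ℝ) (f := fun e => C.total (φ x) + (r * Real.sin e * χ x) • w)
        (x := (0 : ℝ)) (g := C.total.symm) (by simp only [e2]; exact hs)
        e1.differentiableAt.mdifferentiableAt
      simp only [e2] at e3
      rw [mder_eq_fderiv] at e3
      unfold vel
      rw [e0, e3]
      show ctotSymm C.total (C.total (φ x)) (fderiv ℝ _ (0 : ℝ) 1) = _
      rw [← deriv, e1.deriv, map_smul]
      rfl
    · have hz : χ x = 0 := image_eq_zero_of_notMem_tsupport fun h => hxO (hχO h)
      have e0 : (fun e => Φ e x) = fun _ => φ x := funext fun e => hout x e hz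
      unfold vel
      rw [e0, hz, mul_zero, zero_smul]
      have : mder ℝ (Eu (n + 1) × Eu k) (fun _ : ℝ => φ x) 0 = 0 := mfderiv_const
      rw [this]
      rfl

end FieldTheory


lemma continuous_cutoff_mul {B : Type*} [TopologicalSpace B] {χ g : B → ℝ} (hχ : Continuous χ)
    (hg : ∀ s ∈ tsupport χ, ContinuousAt g s) : Continuous fun s => χ s * g s := by
  refine continuous_iff_continuousAt.2 fun s => ?_
  by_cases hs : s ∈ tsupport χ
  · exact hχ.continuousAt.mul (hg s hs)
  · have : (fun s => χ s * g s) =ᶠ[𝓝 s] fun _ => 0 := by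
      filter_upwards [notMem_tsupport_iff_eventuallyEq.1 hs] with t ht
      simp [ht]
    exact continuousAt_const.congr this.symm

namespace FieldTheory

variable {n k : ℕ} {X Y B : Type*}
  [TopologicalSpace X] [T2Space X] [SecondCountableTopology X]
  [ChartedSpace (Eu (n + 1)) X] [IsManifold (𝓡 (n + 1)) ∞ X]
  [MeasurableSpace X] [BorelSpace X]
  [TopologicalSpace Y] [ChartedSpace (Eu (n + 1) × Eu k) Y]
  [IsManifold 𝓘(ℝ, Eu (n + 1) × Eu k) ∞ Y]
  [TopologicalSpace B] [T2Space B] [SecondCountableTopology B]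
  [ChartedSpace (Eu n) B] [IsManifold (𝓡 n) ∞ B]
  [MeasurableSpace B] [BorelSpace B]
  {T : FieldTheory n k X Y B} {Φ : ℝ → X → Y} {φ φ' : X → Y} {x : X} {b : T.BoundaryData}
  {p p' : T.NormalMomenta}

lemma pairing_cutoff {C : AdaptedChart n k T.ρ} {a : Fin k} {c : B → ℝ}
    (hc : ∀ s, c s ≠ 0 → p.base.toFun s ∈ C.total.source) {δ : B → Eu (n + 1) × Eu k}
    (hδ : ∀ s, δ s = c s • C.cvert (p.base.toFun s) a) :
    T.pairing p δ = ∫ s, c s * T.momComponent C p.base.toFun p.mom s a ∂T.mB := by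
  refine integral_congr_ae (Eventually.of_forall fun s => ?_)
  show formQuot (vertEval (p.mom s) (δ s)) (T.σ.form s) = _
  by_cases h : c s = 0
  · have h1 : δ s = (0 : Eu (n + 1) × Eu k) := by rw [hδ, h, zero_smul]
    have h2 : vertEval (p.mom s) (δ s) = 0 := by rw [h1]; exact vertEval_zero _
    rw [h2]
    simp only [h, zero_mul]
    exact zero_div (T.σ.at s fun i => stdVec i)
  · have h2 : vertEval (p.mom s) (δ s)
        = c s • vertEval (p.mom s) (C.cvert (p.base.toFun s) a) := by
      rw [hδ]
      exact vertEval_smul _ (C.dproj_cvert T.fibred (hc s h) a) _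
    rw [h2]
    exact mul_div_assoc _ _ _

/-- The differential of the boundary Lagrangian is given by the momenta of the solution. -/
lemma IsDifferential.momComponent_eq (hp : T.IsDifferential p) (hφ : T.Solves φ p.base)
    {C : AdaptedChart n k T.ρ} {s₀ : B} (hC : p.base.toFun s₀ ∈ C.total.source) (a : Fin k) :
    T.momComponent C p.base.toFun p.mom s₀ a
      = T.bflux s₀ (leg T.L (p.base.toFun s₀) (tang n k φ (T.ι s₀))
        (C.cvert (p.base.toFun s₀) a)) := by
  have := T.domain.compactSpace
  have := T.isVolumeMeasure_B.isLocallyFinite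
  have := T.isVolumeMeasure_B.isOpenPos
  have := ChartedSpace.locallyCompactSpace (Eu (n + 1)) X
  set m : B → ℝ := fun s => T.momComponent C p.base.toFun p.mom s a with hm
  set l : B → ℝ := fun s => T.bflux s (leg T.L (p.base.toFun s) (tang n k φ (T.ι s))
        (C.cvert (p.base.toFun s) a)) with hl
  have hmc : ∀ s, p.base.toFun s ∈ C.total.source → ContinuousAt m s := fun s hs =>
    (p.smooth_mom C a s hs).continuousAt
  have hlc : ∀ s, p.base.toFun s ∈ C.total.source → ContinuousAt l s := by
    intro s hs
    have h1 := (contMDiffAt_bflux_leg (isFieldFamily_const hφ.1.1) (ε := 0) (s := s) (C := C)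
      (by rwa [hφ.2]) a).continuousAt
    have h2 := ContinuousAt.comp (f := fun s : B => ((0 : ℝ), s)) h1
      (Continuous.prodMk_right (0 : ℝ)).continuousAt
    refine h2.congr (Eventually.of_forall fun t => ?_)
    simp only [Function.comp, hl, hφ.2]
  by_contra hne
  have hg0 : m s₀ - l s₀ ≠ 0 := sub_ne_zero.2 hne
  have hx₀ := T.domain.mem_closure s₀
  obtain ⟨O, hOo, hxO, hOC, r, hr, hvar⟩ := exists_bump_variation hφ.1.1 hx₀ (C := C)
    (by rwa [hφ.2]) a
  -- If the components differ at `s₀`, multiplying by the difference there gives a function that is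
  -- positive near `s₀`, whatever the sign.
  have hpos : ∀ᶠ s in 𝓝 s₀, 0 < (m s₀ - l s₀) * (m s - l s) := by
    have h1 : ContinuousAt (fun s => (m s₀ - l s₀) * (m s - l s)) s₀ :=
      continuousAt_const.mul ((hmc s₀ hC).sub (hlc s₀ hC))
    exact h1.eventually (lt_mem_nhds (mul_self_pos.2 hg0))
  -- The variations live on `X`, so the neighbourhood of `s₀` is replaced by the preimage of one in
  -- `X`.
  rw [T.domain.isInducing.nhds_eq_comap] at hpos
  obtain ⟨N, hN, hNpos⟩ := mem_comap.1 hpos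
  obtain ⟨K, hK, hKc, hKO⟩ := exists_mem_nhds_isClosed_subset
    (inter_mem (hOo.mem_nhds hxO) hN)
  obtain ⟨χ, hχs, hχr, hχsup, hχ1⟩ := exists_contMDiff_support_eq_eq_one_iff (𝓡 (n + 1))
    (n := ⊤) (isOpen_interior (s := K)) (isClosed_singleton (x := T.ι s₀))
    (singleton_subset_iff.2 (mem_interior_iff_mem_nhds.2 hK))
  have hsupK : tsupport χ ⊆ K := by
    rw [tsupport, hχsup]
    exact closure_minimal interior_subset hKc
  have h01 : ∀ x, 0 ≤ χ x ∧ χ x ≤ 1 := fun x => hχr (mem_range_self x)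
  obtain ⟨Φ, hΦ, hΦ0, hvel⟩ := hvar χ hχs
    (fun x => abs_le.2 ⟨by linarith [(h01 x).1], (h01 x).2⟩)
    (hsupK.trans (hKO.trans inter_subset_left))
  have hsol : T.Solves (Φ 0) p.base := hΦ0.symm ▸ hφ
  have hsup : ∀ s, T.ι s ∈ tsupport χ → p.base.toFun s ∈ C.total.source := by
    intro s hs
    rw [← hφ.2]
    exact hOC _ (hKO (hsupK hs)).1
  have e1 := hp.2 Φ hΦ hsol
  have e2 : T.pairing p (fun s => vel n k fun ε => Φ ε (T.ι s))
      = ∫ s, (r * χ (T.ι s)) * m s ∂T.mB := by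
    refine pairing_cutoff (c := fun s => r * χ (T.ι s)) (fun s hs => hsup s ?_) fun s => ?_
    · exact subset_tsupport _ (right_ne_zero_of_mul hs)
    · rw [hvel, hφ.2]
  have e3 := first_variation hΦ hsol.1
  have e4 : ∫ s, T.bflux s (T.legVelocity Φ (T.ι s)) ∂T.mB
      = ∫ s, (r * χ (T.ι s)) * l s ∂T.mB := by
    refine integral_congr_ae (Eventually.of_forall fun s => ?_)
    simp only [legVelocity, hl]
    rw [hvel, hΦ0, hφ.2]
    by_cases h : χ (T.ι s) = 0
    · have h0 : leg T.L (p.base.toFun s) (tang n k φ (T.ι s)) (0 : Eu (n + 1) × Eu k) = 0 := by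
        have := leg_smul T.fibred T.smooth_L (hφ.isJet s) (v := 0) (map_zero _) 0
        rwa [zero_smul, zero_smul] at this
      rw [h, mul_zero, zero_smul, h0, map_zero, zero_mul]
    · have hs := hsup s (subset_tsupport _ h)
      rw [leg_smul T.fibred T.smooth_L (hφ.isJet s) (C.dproj_cvert T.fibred hs a), map_smul,
        smul_eq_mul]
  -- Both sides are the derivative of the action along the same bump variation: by the defining
  -- property of `p` and by the first variation formula.
  have e5 : ∫ s, (r * χ (T.ι s)) * m s ∂T.mB = ∫ s, (r * χ (T.ι s)) * l s ∂T.mB := by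
    rw [← e2, ← e4]
    exact e1.unique e3
  have hχc : Continuous fun s => r * χ (T.ι s) :=
    continuous_const.mul (hχs.continuous.comp T.domain.contMDiff.continuous)
  have hts : tsupport (fun s => r * χ (T.ι s)) ⊆ T.ι ⁻¹' tsupport χ :=
    closure_minimal (fun s hs => subset_tsupport _ (right_ne_zero_of_mul hs))
      ((isClosed_tsupport χ).preimage T.domain.contMDiff.continuous)
  have hcm := continuous_cutoff_mul hχc fun s hs => hmc s (hsup s (hts hs))
  have hcl := continuous_cutoff_mul hχc fun s hs => hlc s (hsup s (hts hs))
  have hcd : Continuous fun s => (m s₀ - l s₀) * (r * χ (T.ι s) * m s - r * χ (T.ι s) * l s) :=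
    continuous_const.mul (hcm.sub hcl)
  have hint : ∀ {f : B → ℝ}, Continuous f → Integrable f T.mB := fun hf =>
    hf.integrable_of_hasCompactSupport (HasCompactSupport.of_compactSpace _)
  -- The integrand is continuous, nonnegative on the support of the bump and positive at `s₀`, so
  -- the two integrals cannot be equal.
  have hfin : 0 < ∫ s, (m s₀ - l s₀) * (r * χ (T.ι s) * m s - r * χ (T.ι s) * l s) ∂T.mB := by
    refine hcd.integral_pos_of_hasCompactSupport_nonneg_nonzero
      (HasCompactSupport.of_compactSpace _) (x := s₀) (fun s => ?_) ?_
    · show 0 ≤ (m s₀ - l s₀) * (r * χ (T.ι s) * m s - r * χ (T.ι s) * l s)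
      have e6 : (m s₀ - l s₀) * (r * χ (T.ι s) * m s - r * χ (T.ι s) * l s)
        = r * χ (T.ι s) * ((m s₀ - l s₀) * (m s - l s)) := by ring
      rw [e6]
      by_cases h : χ (T.ι s) = 0
      · rw [h, mul_zero, zero_mul]
      · have : T.ι s ∈ N := (hKO (hsupK (subset_tsupport _ h))).2
        exact mul_nonneg (mul_nonneg hr.le (h01 _).1) (le_of_lt (hNpos this))
    · have hone : χ (T.ι s₀) = 1 := (hχ1 _).1 rfl
      rw [hone]
      have e6 : (m s₀ - l s₀) * (r * 1 * m s₀ - r * 1 * l s₀)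
        = r * ((m s₀ - l s₀) * (m s₀ - l s₀)) := by ring
      rw [e6]
      exact mul_ne_zero hr.ne' (mul_ne_zero hg0 hg0)
  rw [integral_const_mul, integral_sub (hint hcm) (hint hcl), e5, sub_self, mul_zero] at hfin
  exact lt_irrefl _ hfin

/-- The coordinate vectors span the vertical space, and a form of top degree is determined by its
quotient by the volume form. -/
lemma mom_ext {y : Y} {s : B}
    {f g : Vert n k T.ρ y →ₗ[ℝ] (TangentSpace (𝓡 n) s [⋀^Fin n]→L[ℝ] ℝ)}
    {C : AdaptedChart n k T.ρ} (hC : y ∈ C.total.source)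
    (h : ∀ a, formQuot (vertEval f (coordVert C y a)) (T.σ.form s)
      = formQuot (vertEval g (coordVert C y a)) (T.σ.form s)) : f = g := by
  have h1 : ∀ a, f ⟨C.cvert y a, C.dproj_cvert T.fibred hC a⟩
      = g ⟨C.cvert y a, C.dproj_cvert T.fibred hC a⟩ := by
    intro a
    have e : formQuot (vertEval f (C.cvert y a)) (T.σ.form s)
      = formQuot (vertEval g (C.cvert y a)) (T.σ.form s) := h a
    rw [vertEval_of_vertical f (C.dproj_cvert T.fibred hC a),
      vertEval_of_vertical g (C.dproj_cvert T.fibred hC a)] at e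
    have e1 := topQuot_smul (d := n) (β := f ⟨C.cvert y a, C.dproj_cvert T.fibred hC a⟩)
      (T.σ.at_ne_zero s)
    have e2 := topQuot_smul (d := n) (β := g ⟨C.cvert y a, C.dproj_cvert T.fibred hC a⟩)
      (T.σ.at_ne_zero s)
    have e3 : topQuot (d := n) (f ⟨C.cvert y a, C.dproj_cvert T.fibred hC a⟩) (T.σ.at s)
      = topQuot (d := n) (g ⟨C.cvert y a, C.dproj_cvert T.fibred hC a⟩) (T.σ.at s) := e
    rw [e3] at e1
    exact e1.trans e2.symm
  refine LinearMap.ext fun v => ?_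
  have hv : v = ∑ a, (ctot C.total y v.1).2 a
      • (⟨C.cvert y a, C.dproj_cvert T.fibred hC a⟩ : Vert n k T.ρ y) := by
    refine Subtype.ext ?_
    have e := C.vertical_eq_sum T.fibred hC (v := v.1) v.2
    rw [Submodule.coe_sum]
    exact e
  rw [hv, map_sum, map_sum]
  refine Finset.sum_congr rfl fun a _ => ?_
  rw [map_smul, map_smul, h1]

lemma NormalMomenta.ext' (hb : p.base = p'.base)
    (h : ∀ (C : AdaptedChart n k T.ρ) (s : B) (a : Fin k), p.base.toFun s ∈ C.total.source →
      T.momComponent C p.base.toFun p.mom s a = T.momComponent C p'.base.toFun p'.mom s a) :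
    p = p' := by
  obtain ⟨b, π, hπ⟩ := p
  obtain ⟨b', π', hπ'⟩ := p'
  obtain rfl : b = b' := hb
  have : π = π' := funext fun s => mom_ext (mem_chart _) fun a => h _ s a (mem_chart _)
  subst this
  rfl

/-- The momenta of the solution are a differential; any other differential has the same components
by `IsDifferential.momComponent_eq`. -/
lemma existsUnique_differential (hb : b ∈ T.admissible) :
    ∃! p : T.NormalMomenta, p ∈ T.imageDifferential ∧ p.base = b := by
  obtain ⟨φ, hφ, -⟩ := id hb
  refine ⟨legMomenta hφ, ⟨⟨hb, isDifferential_legMomenta hb hφ⟩, rfl⟩, ?_⟩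
  rintro p ⟨⟨-, hp⟩, rfl⟩
  refine NormalMomenta.ext' rfl fun C s a hC => ?_
  rw [hp.momComponent_eq hφ hC]
  exact (momComponent_legMom hφ hC a).symm

lemma contMDiff_boundary {c : ℝ → T.BoundaryData} (hΦ : T.IsFieldFamily Φ)
    (hc : ∀ ε, T.Solves (Φ ε) (c ε)) :
    ContMDiff (𝓘(ℝ, ℝ).prod (𝓡 n)) 𝓘(ℝ, Eu (n + 1) × Eu k) ∞
      (fun p : ℝ × B => (c p.1).toFun p.2) := by
  intro p
  have h1 : (fun p : ℝ × B => (c p.1).toFun p.2) = fun p : ℝ × B => Φ p.1 (T.ι p.2) :=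
    funext fun p => ((hc p.1).2 p.2).symm
  rw [h1]
  exact ContMDiffAt.comp (g := fun p : ℝ × X => Φ p.1 p.2)
    (f := fun p : ℝ × B => (p.1, T.ι p.2)) p
    (hΦ.isFamilyAt p.1 (T.domain.mem_closure p.2)).contMDiffAt
    (contMDiffAt_fst.prodMk
      (ContMDiffAt.comp (g := T.ι) (f := Prod.snd) p T.domain.contMDiff.contMDiffAt
        contMDiffAt_snd))

lemma exists_imageCurve {c : ℝ → T.BoundaryData} (hc : T.IsAdmissibleCurve c) :
    ∃ γ, T.IsImageCurve γ ∧ ∀ ε, (γ ε).base = c ε := by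
  obtain ⟨hadm, Φ, hΦ, hs⟩ := id hc
  refine ⟨fun ε => legMomenta (hs ε), ⟨⟨contMDiff_boundary hΦ.1 hs, fun C a ε s hC => ?_⟩,
    fun ε => ⟨hadm ε, isDifferential_legMomenta (hadm ε) (hs ε)⟩, hc⟩, fun _ => rfl⟩
  exact contMDiffAt_momComponent_legMom hΦ.1 hs a hC

end FieldTheory


/-! ### Coordinate independence of the symplectic current -/

lemma hasDerivAt_toLp {d : ℕ} {f : Fin d → ℝ → ℝ} {f' : Fin d → ℝ} {t : ℝ}
    (h : ∀ i, HasDerivAt (f i) (f' i) t) :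
    HasDerivAt (fun e => (WithLp.toLp 2 fun i => f i e : Eu d)) (WithLp.toLp 2 f') t := by
  have h1 : HasDerivAt (fun e => ∑ i, f i e • (stdVec i : Eu d)) (∑ i, f' i • stdVec i) t :=
    HasDerivAt.fun_sum fun i _ => (h i).smul_const _
  have h2 : (fun e => (WithLp.toLp 2 fun i => f i e : Eu d))
      = fun e => ∑ i, f i e • (stdVec i : Eu d) := funext fun e => eu_sum _
  rw [h2]
  convert h1 using 1
  exact eu_sum _

/-- A sum over coordinates of a canonical symplectic form is invariant under changes of the
coordinates of the configuration space. -/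
lemma canonical_pairing_invariant {k : ℕ} {E : Type*} [NormedAddCommGroup E] [NormedSpace ℝ E]
    {F : Eu k → Eu k} {q₁ q₂ : ℝ → Eu k} {v₁ v₂ : Eu k} {P₁ P₂ Q₁ Q₂ : Fin k → ℝ → E}
    (hF : ContDiffAt ℝ 2 F (q₁ 0)) (h₁ : HasDerivAt q₁ v₁ 0) (h₂ : HasDerivAt q₂ v₂ 0)
    (h0 : q₁ 0 = q₂ 0)
    (hQ₁ : ∀ b, DifferentiableAt ℝ (Q₁ b) 0) (hQ₂ : ∀ b, DifferentiableAt ℝ (Q₂ b) 0)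
    (hQ : ∀ b, Q₁ b 0 = Q₂ b 0)
    (hP₁ : ∀ a, P₁ a =ᶠ[𝓝 0] fun e => ∑ b, fderiv ℝ F (q₁ e) (stdVec a) b • Q₁ b e)
    (hP₂ : ∀ a, P₂ a =ᶠ[𝓝 0] fun e => ∑ b, fderiv ℝ F (q₂ e) (stdVec a) b • Q₂ b e) :
    ∑ a, (v₁ a • deriv (P₂ a) 0 - v₂ a • deriv (P₁ a) 0)
      = ∑ b, (fderiv ℝ F (q₁ 0) v₁ b • deriv (Q₂ b) 0
        - fderiv ℝ F (q₂ 0) v₂ b • deriv (Q₁ b) 0) := by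
  -- Momenta transform by the transposed Jacobian, whose own variation along the curve adds a term
  -- `D²F(v, w)` paired with `Q`.
  have key : ∀ {q : ℝ → Eu k} {v : Eu k} {P Q : Fin k → ℝ → E}, ContDiffAt ℝ 2 F (q 0) →
      HasDerivAt q v 0 → (∀ b, DifferentiableAt ℝ (Q b) 0) →
      (∀ a, P a =ᶠ[𝓝 0] fun e => ∑ b, fderiv ℝ F (q e) (stdVec a) b • Q b e) →
      ∀ w : Eu k, ∑ a, w a • deriv (P a) 0 = ∑ b, (fderiv ℝ F (q 0) w b • deriv (Q b) 0
        + fderiv ℝ (fderiv ℝ F) (q 0) v w b • Q b 0) := by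
    intro q v P Q hF hq hQ hP w
    have hd : ∀ a, deriv (P a) 0 = ∑ b, (fderiv ℝ F (q 0) (stdVec a) b • deriv (Q b) 0
        + fderiv ℝ (fderiv ℝ F) (q 0) v (stdVec a) b • Q b 0) := by
      intro a
      rw [(hP a).deriv_eq]
      refine HasDerivAt.deriv (HasDerivAt.fun_sum fun b _ => ?_)
      have h1 := hasDerivAt_fderiv_curve hF hq (stdVec a)
      have h2 : HasDerivAt (fun e => fderiv ℝ F (q e) (stdVec a) b)
          (fderiv ℝ (fderiv ℝ F) (q 0) v (stdVec a) b) 0 :=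
        (EuclideanSpace.proj b : Eu k →L[ℝ] ℝ).hasFDerivAt.comp_hasDerivAt 0 h1
      exact h2.smul (hQ b).hasDerivAt
    have hlin : ∀ (A : Eu k →L[ℝ] Eu k) (b : Fin k), A w b = ∑ a, w a * A (stdVec a) b := by
      intro A b
      conv_lhs => rw [eu_sum w, map_sum]
      simp [WithLp.ofLp_sum, Finset.sum_apply]
    simp only [hd, Finset.smul_sum]
    rw [Finset.sum_comm]
    refine Finset.sum_congr rfl fun b _ => ?_
    simp only [hlin, Finset.sum_smul, smul_add, mul_smul, Finset.sum_add_distrib]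
  have hF2 : ContDiffAt ℝ 2 F (q₂ 0) := h0 ▸ hF
  have hsymm : IsSymmSndFDerivAt ℝ F (q₂ 0) := hF2.isSymmSndFDerivAt (by simp)
  rw [Finset.sum_sub_distrib, key hF2 h₂ hQ₂ hP₂ v₁, key hF h₁ hQ₁ hP₁ v₂,
    ← Finset.sum_sub_distrib]
  refine Finset.sum_congr rfl fun b _ => ?_
  -- The two second derivative terms are paired with equal momenta at `0` and coincide by symmetry,
  -- so they cancel.
  rw [h0, hQ, hsymm.eq v₁ v₂]
  abel

section Current

variable {n k : ℕ} {X Y : Type*}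
  [TopologicalSpace X] [ChartedSpace (Eu (n + 1)) X] [IsManifold (𝓡 (n + 1)) ∞ X]
  [TopologicalSpace Y] [ChartedSpace (Eu (n + 1) × Eu k) Y]
  [IsManifold 𝓘(ℝ, Eu (n + 1) × Eu k) ∞ Y]
  {ρ : Y → X} {vol : VolumeForm (n + 1) X} {L : J1 n k ρ → ℝ} {C C' : AdaptedChart n k ρ}
  {Φ Ψ : ℝ → X → Y} {x : X}

/-- The Legendre vectors of the coordinate directions along a family of fields. -/
def legFrame (L : J1 n k ρ → ℝ) (C : AdaptedChart n k ρ) (Φ : ℝ → X → Y) (x : X) (a : Fin k)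
    (ε : ℝ) : Eu (n + 1) :=
  leg L (Φ ε x) (tang n k (Φ ε) x) (C.cvert (Φ ε x) a)

lemma legFrame_eq (hρ : IsFibred n k ρ) (hL : IsSmoothLagrangian vol L) {ε : ℝ}
    (h : IsFamilyAt n k ρ Φ (ε, x)) (hC : Φ ε x ∈ C.total.source) (a : Fin k) :
    legFrame L C Φ x a ε = (formDensity vol.form C.base (C.base x))⁻¹ •
      dsymm C.base (C.base x) (WithLp.toLp 2 fun ν =>
        momentum (localLagrangian vol L C) (familyJet (localFamily C Φ) (ε, C.base x)) ν a) := by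
  have hj : IsJet ρ (Φ ε x) (tang n k (Φ ε) x) := h.isSectionAt.isJet hρ
  have h1 := leg_eq hρ hL hC hj (C.dproj_cvert hρ hC a)
  have h2 : jetCoord C (Φ ε x) (tang n k (Φ ε) x) = localJet C (Φ ε) (C.base x) :=
    h.isSectionAt.jetCoord_eq hC
  rw [h2, C.ctot_cvert hC, h.isSectionAt.proj] at h1
  have h3 : ∀ ν, ∑ b, momentum (localLagrangian vol L C) (localJet C (Φ ε) (C.base x)) ν b
      * ((stdVec a : Eu k) b)
      = momentum (localLagrangian vol L C) (localJet C (Φ ε) (C.base x)) ν a := by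
    intro ν
    rw [Finset.sum_eq_single a]
    · simp [stdVec]
    · intro b _ hb
      simp [stdVec, hb]
    · simp
  simp only [h3] at h1
  exact h1

lemma tendsto_left (x : X) : Tendsto (fun e : ℝ => (e, x)) (𝓝 0) (𝓝 (0, x)) :=
  (Continuous.prodMk_left x).tendsto 0

lemma three_le_infty : ((3 : ℕ∞) : ℕ∞ω) ≤ ((⊤ : ℕ∞) : ℕ∞ω) := WithTop.coe_le_coe.2 le_top

lemma two_le_infty : ((2 : ℕ∞) : ℕ∞ω) ≤ ((⊤ : ℕ∞) : ℕ∞ω) := WithTop.coe_le_coe.2 le_top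

lemma hasDerivAt_legFrame (hρ : IsFibred n k ρ) (hL : IsSmoothLagrangian vol L)
    (h : IsFamilyAt n k ρ Φ (0, x)) (hC : Φ 0 x ∈ C.total.source) (a : Fin k) :
    HasDerivAt (legFrame L C Φ x a) ((formDensity vol.form C.base (C.base x))⁻¹ •
      dsymm C.base (C.base x) (WithLp.toLp 2 fun ν => deriv (fun e =>
        momentum (localLagrangian vol L C) (familyJet (localFamily C Φ) (e, C.base x)) ν a) 0))
      0 := by
  have h1 : legFrame L C Φ x a =ᶠ[𝓝 0] fun e => (formDensity vol.form C.base (C.base x))⁻¹ •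
      dsymm C.base (C.base x) (WithLp.toLp 2 fun ν =>
        momentum (localLagrangian vol L C) (familyJet (localFamily C Φ) (e, C.base x)) ν a) := by
    filter_upwards [(tendsto_left x).eventually h.eventually,
      (tendsto_left x).eventually (h.eventually_mem hC)] with e he heC
    exact legFrame_eq hρ hL he heC a
  refine HasDerivAt.congr_of_eventuallyEq ?_ h1
  refine HasDerivAt.const_smul (formDensity vol.form C.base (C.base x))⁻¹ ((dsymm C.base (C.base x)).hasFDerivAt.comp_hasDerivAt 0
    (hasDerivAt_toLp fun ν => DifferentiableAt.hasDerivAt ?_))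
  exact (hasDerivAt_fderiv_apply ((h.contDiffAt hC).of_le two_le_infty)
    ((h.contDiffAt_lagrangian hL hC).of_le two_le_infty) _).differentiableAt

/-- The symplectic current of two families with the same initial jet at `x`: the canonical
symplectic form of the fibre coordinates and the Legendre vectors. -/
def sympVec (L : J1 n k ρ → ℝ) (C : AdaptedChart n k ρ) (Φ Ψ : ℝ → X → Y) (x : X) :
    Eu (n + 1) :=
  ∑ a, ((ctot C.total (Φ 0 x) (vel n k fun e => Φ e x)).2 a • deriv (legFrame L C Ψ x a) 0
    - (ctot C.total (Ψ 0 x) (vel n k fun e => Ψ e x)).2 a • deriv (legFrame L C Φ x a) 0)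

lemma sympVec_eq (hρ : IsFibred n k ρ) (hL : IsSmoothLagrangian vol L)
    (h : IsFamilyAt n k ρ Φ (0, x)) (h' : IsFamilyAt n k ρ Ψ (0, x)) (h0 : Φ 0 x = Ψ 0 x)
    (hC : Φ 0 x ∈ C.total.source) :
    sympVec L C Φ Ψ x = (formDensity vol.form C.base (C.base x))⁻¹ •
      dsymm C.base (C.base x) (symplecticCurrent (localLagrangian vol L C) (localFamily C Φ)
        (localFamily C Ψ) (C.base x)) := by
  have hC' : Ψ 0 x ∈ C.total.source := h0 ▸ hC
  have h1 : symplecticCurrent (localLagrangian vol L C) (localFamily C Φ)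
        (localFamily C Ψ) (C.base x)
      = ∑ a, (familyVelocity (localFamily C Φ) (C.base x) a • (WithLp.toLp 2 fun ν => deriv (fun e =>
        momentum (localLagrangian vol L C) (familyJet (localFamily C Ψ) (e, C.base x)) ν a) 0
          : Eu (n + 1))
        - familyVelocity (localFamily C Ψ) (C.base x) a • (WithLp.toLp 2 fun ν => deriv (fun e =>
        momentum (localLagrangian vol L C) (familyJet (localFamily C Φ) (e, C.base x)) ν a) 0
          : Eu (n + 1))) := by
    ext μ
    simp [symplecticCurrent, WithLp.ofLp_sum, Finset.sum_apply]
  unfold sympVec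
  rw [h1, map_sum, Finset.smul_sum]
  refine Finset.sum_congr rfl fun a _ => ?_
  rw [(hasDerivAt_legFrame hρ hL h hC a).deriv, (hasDerivAt_legFrame hρ hL h' hC' a).deriv,
    h.ctot_vel hC, h'.ctot_vel hC', map_sub, map_smul, map_smul, smul_sub, smul_comm,
    smul_comm (familyVelocity (localFamily C Ψ) (C.base x) a)]

/-- The change of fibre coordinates at a point of the base. -/
def fibreTransition (C C' : AdaptedChart n k ρ) (z : Eu (n + 1)) (q : Eu k) : Eu k :=
  (C'.total (C.total.symm (z, q))).2

section

variable {y : Y}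

lemma fibreTransition_apply (hy : y ∈ C.total.source) :
    fibreTransition C C' (C.base (ρ y)) (C.total y).2 = (C'.total y).2 := by
  unfold fibreTransition
  rw [← C.total_eq hy, C.total.left_inv hy]

lemma contDiffAt_fibreTransition (hy : y ∈ C.total.source) (hy' : y ∈ C'.total.source) :
    ContDiffAt ℝ ∞ (fibreTransition C C' (C.base (ρ y))) (C.total y).2 := by
  have e : C.total.symm (C.base (ρ y), (C.total y).2) = y := by
    rw [← C.total_eq hy, C.total.left_inv hy]
  have ht : (C.base (ρ y), (C.total y).2) ∈ C.total.target := by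
    rw [← C.total_eq hy]; exact C.total.map_source hy
  have h1 : ContMDiffAt 𝓘(ℝ, Eu k) 𝓘(ℝ, Eu (n + 1) × Eu k) ∞
      (fun q : Eu k => C.total.symm (C.base (ρ y), q)) (C.total y).2 :=
    ContMDiffAt.comp (g := C.total.symm) (f := fun q : Eu k => (C.base (ρ y), q)) (C.total y).2
      (contMDiffAt_symm_of_mem_maximalAtlas C.total_mem ht)
      (contDiffAt_const.prodMk contDiffAt_id).contMDiffAt
  have h2 := ContMDiffAt.comp (g := C'.total) (C.total y).2
    (by rw [e]; exact contMDiffAt_of_mem_maximalAtlas C'.total_mem hy') h1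
  exact contDiffAt_snd.comp (C.total y).2 h2.contDiffAt

/-- Both sides are the velocity, in the fibre coordinates of `C'`, of the coordinate line of `C`
through `y` in direction `∂/∂y^a`. -/
lemma fderiv_fibreTransition (hy : y ∈ C.total.source) (hy' : y ∈ C'.total.source) (a : Fin k) :
    fderiv ℝ (fibreTransition C C' (C.base (ρ y))) (C.total y).2 (stdVec a)
      = (ctot C'.total y (C.cvert y a)).2 := by
  have e : C.total.symm (C.base (ρ y), (C.total y).2) = y := by
    rw [← C.total_eq hy, C.total.left_inv hy]
  set c : ℝ → Y := fun t => C.total.symm (C.total y + t • ((0 : Eu (n + 1)), (stdVec a : Eu k)))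
    with hc
  have hline : HasDerivAt (fun t : ℝ => C.total y + t • ((0 : Eu (n + 1)), (stdVec a : Eu k)))
      (0, stdVec a) 0 := by
    simpa using ((hasDerivAt_id (0 : ℝ)).smul_const
      ((0 : Eu (n + 1)), (stdVec a : Eu k))).const_add (C.total y)
  have e0 : C.total y + (0 : ℝ) • ((0 : Eu (n + 1)), (stdVec a : Eu k)) = C.total y := by simp
  have hs := mdifferentiableAt_total_symm C.total_mem (C.total.map_source hy)
  have hs' : MDifferentiableAt 𝓘(ℝ, Eu (n + 1) × Eu k) 𝓘(ℝ, Eu (n + 1) × Eu k) C.total.symm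
      (C.total y + (0 : ℝ) • ((0 : Eu (n + 1)), (stdVec a : Eu k))) := by rw [e0]; exact hs
  have hc0 : c 0 = y := by simp only [hc, e0]; exact C.total.left_inv hy
  have hcd : MDifferentiableAt 𝓘(ℝ, ℝ) 𝓘(ℝ, Eu (n + 1) × Eu k) c 0 :=
    MDifferentiableAt.comp (g := C.total.symm) 0 hs' hline.differentiableAt.mdifferentiableAt
  have hvel : vel n k c = C.cvert y a := by
    have h1 := mder_comp (E := ℝ) (g := C.total.symm) (x := (0 : ℝ))
      (f := fun t : ℝ => C.total y + t • ((0 : Eu (n + 1)), (stdVec a : Eu k))) hs'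
      hline.differentiableAt.mdifferentiableAt
    simp only [e0] at h1
    rw [mder_eq_fderiv] at h1
    unfold vel
    have h2 : c = C.total.symm ∘
      fun t : ℝ => C.total y + t • ((0 : Eu (n + 1)), (stdVec a : Eu k)) := rfl
    rw [h2, h1]
    show ctotSymm C.total (C.total y) (fderiv ℝ _ (0 : ℝ) 1) = _
    rw [← deriv, hline.deriv]
    rfl
  have h3 := ctot_vel (C := C') hcd (by rw [hc0]; exact hy')
  rw [hc0, hvel] at h3
  rw [h3]
  have h4 : ∀ t : ℝ, (C'.total (c t)).2
      = fibreTransition C C' (C.base (ρ y)) ((C.total y).2 + t • stdVec a) := by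
    intro t
    have : C.total y + t • ((0 : Eu (n + 1)), (stdVec a : Eu k))
        = (C.base (ρ y), (C.total y).2 + t • stdVec a) := by
      refine Prod.ext ?_ rfl
      show (C.total y).1 + t • (0 : Eu (n + 1)) = _
      rw [smul_zero, add_zero, C.fst_eq y hy]
    show (C'.total (C.total.symm _)).2 = _
    rw [this]
    rfl
  simp only [h4]
  have h5 : HasDerivAt (fun t : ℝ => (C.total y).2 + t • (stdVec a : Eu k)) (stdVec a) 0 := by
    simpa using ((hasDerivAt_id (0 : ℝ)).smul_const (stdVec a : Eu k)).const_add (C.total y).2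
  have h6 : HasFDerivAt (fibreTransition C C' (C.base (ρ y)))
      (fderiv ℝ (fibreTransition C C' (C.base (ρ y))) (C.total y).2)
      ((fun t : ℝ => (C.total y).2 + t • (stdVec a : Eu k)) 0) := by
    simpa using ((contDiffAt_fibreTransition hy hy').differentiableAt (by simp)).hasFDerivAt
  exact (h6.comp_hasDerivAt 0 h5).deriv.symm

lemma leg_sum (hρ : IsFibred n k ρ) (hL : IsSmoothLagrangian vol L)
    {A : Eu (n + 1) →L[ℝ] Eu (n + 1) × Eu k} (hA : IsJet ρ y A) {v : Fin k → Eu (n + 1) × Eu k}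
    (hv : ∀ b, dproj ρ y (v b) = 0) (c : Fin k → ℝ) (s : Finset (Fin k)) :
    leg L y A (∑ b ∈ s, c b • v b) = ∑ b ∈ s, c b • leg L y A (v b) := by
  have hcv : ∀ b, dproj ρ y (c b • v b) = 0 := fun b => by rw [map_smul, hv, smul_zero]
  induction s using Finset.induction_on with
  | empty =>
    have := leg_smul hρ hL hA (v := 0) (map_zero _) 0
    rw [zero_smul, zero_smul] at this
    simpa using this
  | insert b s hb ih =>
    rw [Finset.sum_insert hb, Finset.sum_insert hb, leg_add hρ hL hA (hcv b) ?_, ih,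
      leg_smul hρ hL hA (hv b)]
    rw [map_sum]
    exact Finset.sum_eq_zero fun i _ => hcv i

end

/-- The Legendre vector is linear in its vertical argument, so momenta change with the coordinate
frame, by the Jacobian of the fibre coordinates. This is the hypothesis of
`canonical_pairing_invariant`. -/
lemma legFrame_transition (hρ : IsFibred n k ρ) (hL : IsSmoothLagrangian vol L) {ε : ℝ}
    (h : IsFamilyAt n k ρ Φ (ε, x)) (hC : Φ ε x ∈ C.total.source)
    (hC' : Φ ε x ∈ C'.total.source) (a : Fin k) :
    legFrame L C Φ x a ε = ∑ b,
      fderiv ℝ (fibreTransition C C' (C.base x)) ((C.total (Φ ε x)).2) (stdVec a) b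
        • legFrame L C' Φ x b ε := by
  have h1 := fderiv_fibreTransition hC hC' a
  rw [h.isSectionAt.proj] at h1
  have h2 := C'.vertical_eq_sum hρ hC' (C.dproj_cvert hρ hC a)
  have hj : IsJet ρ (Φ ε x) (tang n k (Φ ε) x) := h.isSectionAt.isJet hρ
  unfold legFrame
  conv_lhs => rw [h2]
  rw [leg_sum hρ hL hj fun b => C'.dproj_cvert hρ hC' b, h1]

lemma IsFamilyAt.hasDerivAt_total_snd (h : IsFamilyAt n k ρ Φ (0, x))
    (hC : Φ 0 x ∈ C.total.source) :
    HasDerivAt (fun e => (C.total (Φ e x)).2)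
      (ctot C.total (Φ 0 x) (vel n k fun e => Φ e x)).2 0 := by
  rw [BoundaryFields.ctot_vel (c := fun e => Φ e x) h.mdifferentiableAt_left hC]
  refine DifferentiableAt.hasDerivAt ?_
  have h1 := mdifferentiableAt_iff_differentiableAt.1 (MDifferentiableAt.comp (g := C.total)
    (f := fun e => Φ e x) 0 (mdifferentiableAt_total C.total_mem hC) h.mdifferentiableAt_left)
  exact differentiableAt_snd.comp (0 : ℝ) h1

/-- The symplectic current does not depend on the coordinates. -/
lemma sympVec_chart (hρ : IsFibred n k ρ) (hL : IsSmoothLagrangian vol L)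
    (h : IsFamilyAt n k ρ Φ (0, x)) (h' : IsFamilyAt n k ρ Ψ (0, x)) (h0 : Φ 0 x = Ψ 0 x)
    (ht : tang n k (Φ 0) x = tang n k (Ψ 0) x)
    (hC : Φ 0 x ∈ C.total.source) (hC' : Φ 0 x ∈ C'.total.source) :
    sympVec L C Φ Ψ x = sympVec L C' Φ Ψ x := by
  have hP : ∀ {Ξ : ℝ → X → Y}, IsFamilyAt n k ρ Ξ (0, x) → Ξ 0 x ∈ C.total.source →
      Ξ 0 x ∈ C'.total.source → ∀ a, legFrame L C Ξ x a =ᶠ[𝓝 0] fun e => ∑ b,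
      fderiv ℝ (fibreTransition C C' (C.base x)) ((C.total (Ξ e x)).2) (stdVec a) b
        • legFrame L C' Ξ x b e := by
    intro Ξ hΞ hΞC hΞC' a
    filter_upwards [(tendsto_left x).eventually hΞ.eventually,
      (tendsto_left x).eventually (hΞ.eventually_mem hΞC),
      (tendsto_left x).eventually (hΞ.eventually_mem hΞC')] with e h1 h2 h3
    exact legFrame_transition hρ hL h1 h2 h3 a
  -- Velocities transform by the Jacobian itself, contragrediently to the momenta.
  have hv : ∀ {Ξ : ℝ → X → Y}, IsFamilyAt n k ρ Ξ (0, x) → Ξ 0 x ∈ C.total.source →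
      Ξ 0 x ∈ C'.total.source → (ctot C'.total (Ξ 0 x) (vel n k fun e => Ξ e x)).2
        = fderiv ℝ (fibreTransition C C' (C.base x)) ((C.total (Ξ 0 x)).2)
          (ctot C.total (Ξ 0 x) (vel n k fun e => Ξ e x)).2 := by
    intro Ξ hΞ hΞC hΞC'
    rw [ctot_vel (C := C') (c := fun e => Ξ e x) hΞ.mdifferentiableAt_left hΞC']
    have h1 : (fun e => (C'.total (Ξ e x)).2)
        =ᶠ[𝓝 0] fun e => fibreTransition C C' (C.base x) (C.total (Ξ e x)).2 := by
      filter_upwards [(tendsto_left x).eventually hΞ.eventually,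
        (tendsto_left x).eventually (hΞ.eventually_mem hΞC)] with e he heC
      have := fibreTransition_apply (C' := C') heC
      rw [he.isSectionAt.proj] at this
      exact this.symm
    rw [h1.deriv_eq]
    have h2 := contDiffAt_fibreTransition hΞC hΞC'
    rw [hΞ.isSectionAt.proj] at h2
    exact ((h2.differentiableAt (by simp)).hasFDerivAt.comp_hasDerivAt 0 (hΞ.hasDerivAt_total_snd hΞC)).deriv
  have hΨC : Ψ 0 x ∈ C.total.source := h0 ▸ hC
  have hΨC' : Ψ 0 x ∈ C'.total.source := h0 ▸ hC'
  have hF := contDiffAt_fibreTransition hC hC'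
  rw [h.isSectionAt.proj] at hF
  unfold sympVec
  rw [hv h hC hC', hv h' hΨC hΨC']
  refine canonical_pairing_invariant (q₁ := fun e => (C.total (Φ e x)).2)
    (q₂ := fun e => (C.total (Ψ e x)).2) (hF.of_le two_le_infty) (h.hasDerivAt_total_snd hC)
    (h'.hasDerivAt_total_snd hΨC)
    (by simp only [h0]) (fun b => (hasDerivAt_legFrame hρ hL h hC' b).differentiableAt)
    (fun b => (hasDerivAt_legFrame hρ hL h' hΨC' b).differentiableAt) (fun b => ?_)
    (hP h hC hC') (hP h' hΨC hΨC')
  unfold legFrame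
  rw [h0, ht]

end Current

namespace FieldTheory

variable {n k : ℕ} {X Y B : Type*}
  [TopologicalSpace X] [T2Space X] [SecondCountableTopology X]
  [ChartedSpace (Eu (n + 1)) X] [IsManifold (𝓡 (n + 1)) ∞ X]
  [MeasurableSpace X] [BorelSpace X]
  [TopologicalSpace Y] [ChartedSpace (Eu (n + 1) × Eu k) Y]
  [IsManifold 𝓘(ℝ, Eu (n + 1) × Eu k) ∞ Y]
  [TopologicalSpace B] [T2Space B] [SecondCountableTopology B]
  [ChartedSpace (Eu n) B] [IsManifold (𝓡 n) ∞ B]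
  [MeasurableSpace B] [BorelSpace B]
  {T : FieldTheory n k X Y B} {Φ Ψ : ℝ → X → Y} {x : X}

/-! ### Conservation of the symplectic current -/

variable (T) in
/-- The symplectic current of two families of fields with the same initial field. -/
def current (Φ Ψ : ℝ → X → Y) (x : X) : Eu (n + 1) :=
  sympVec T.L (T.chart (Φ 0 x)) Φ Ψ x

/-- The chart in `current` is chosen separately at each point, so its definition shows no
regularity; here it is exchanged for one that can be held fixed near a point. -/
lemma current_eq (hΦ : T.IsFieldFamily Φ) (hΨ : T.IsFieldFamily Ψ)
    (he : EqOn (Φ 0) (Ψ 0) (closure T.U)) (hx : x ∈ closure T.U) {C : AdaptedChart n k T.ρ}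
    (hC : Φ 0 x ∈ C.total.source) :
    T.current Φ Ψ x = sympVec T.L C Φ Ψ x :=
  sympVec_chart T.fibred T.smooth_L (hΦ.isFamilyAt 0 hx) (hΨ.isFamilyAt 0 hx) (he hx)
    (tang_eq_of_eqOn T.fibred T.domain.isOpen (hΦ.isFamilyAt 0 hx).isSectionAt
      (hΨ.isFamilyAt 0 hx).isSectionAt he hx) (mem_chart _) hC

lemma dchart_current (hΦ : T.IsFieldFamily Φ) (hΨ : T.IsFieldFamily Ψ)
    (he : EqOn (Φ 0) (Ψ 0) (closure T.U)) (hx : x ∈ closure T.U) {C : AdaptedChart n k T.ρ}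
    (hC : Φ 0 x ∈ C.total.source) :
    dchart C.base x (T.current Φ Ψ x) = (formDensity T.vol.form C.base (C.base x))⁻¹ •
      symplecticCurrent (localLagrangian T.vol T.L C) (localFamily C Φ) (localFamily C Ψ)
        (C.base x) := by
  have hx' := (hΦ.isFamilyAt 0 hx).isSectionAt.mem_base hC
  rw [current_eq hΦ hΨ he hx hC, sympVec_eq T.fibred T.smooth_L (hΦ.isFamilyAt 0 hx)
    (hΨ.isFamilyAt 0 hx) (he hx) hC, map_smul, dchart_dsymm C.base_mem hx']

lemma vcoord_current (hΦ : T.IsFieldFamily Φ) (hΨ : T.IsFieldFamily Ψ)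
    (he : EqOn (Φ 0) (Ψ 0) (closure T.U)) (hx : x ∈ closure T.U) {C : AdaptedChart n k T.ρ}
    (hC : Φ 0 x ∈ C.total.source) :
    ∀ᶠ w in 𝓝 (C.base x), C.base.symm w ∈ closure T.U → vcoord C.base (T.current Φ Ψ) w
      = (formDensity T.vol.form C.base w)⁻¹ •
        symplecticCurrent (localLagrangian T.vol T.L C) (localFamily C Φ) (localFamily C Ψ) w := by
  have hf := hΦ.isFamilyAt 0 hx
  have hxb := hf.isSectionAt.mem_base hC
  filter_upwards [eventually_chart_symm (ψ := C.base) hxb (hf.eventually_mem hC),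
    C.base.open_target.mem_nhds (C.base.map_source hxb)] with w h2 h3 hw
  have := dchart_current hΦ hΨ he hw h2
  rw [C.base.right_inv h3] at this
  exact this

/-- In a fixed adapted chart the density times the current is `symplecticCurrent`, conserved because
both families consist of solutions. The identification is available only on the closure, where the
initial fields agree; hence the use of an extension in `HasDivergence`. -/
lemma hasDivergence_current (hΦ : T.IsSolutionFamily Φ) (hΨ : T.IsSolutionFamily Ψ)
    (he : EqOn (Φ 0) (Ψ 0) (closure T.U)) :
    HasDivergence T.vol T.U (T.current Φ Ψ) fun _ => 0 := by
  have hreg : ∀ {Ξ : ℝ → X → Y}, T.IsFieldFamily Ξ → ∀ {x}, x ∈ closure T.U →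
      ∀ {C : AdaptedChart n k T.ρ}, Ξ 0 x ∈ C.total.source →
      ContDiffAt ℝ 3 (localFamily C Ξ) (0, C.base x) ∧
      ContDiffAt ℝ 3 (localLagrangian T.vol T.L C)
        (familyJet (localFamily C Ξ) (0, C.base x)) := fun hΞ _ hx _ hC =>
    ⟨((hΞ.isFamilyAt 0 hx).contDiffAt hC).of_le three_le_infty,
      ((hΞ.isFamilyAt 0 hx).contDiffAt_lagrangian T.smooth_L hC).of_le three_le_infty⟩
  refine ⟨fun x hx ψ hψ hxψ => ?_, fun x hx ψ hψ hxψ => ?_⟩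
  · have hf := hΦ.1.isFamilyAt 0 hx
    set C := (T.chart (Φ 0 x)).rebase ψ hψ with hCdef
    have hC : Φ 0 x ∈ C.total.source := mem_rebase_chart hψ (by rwa [hf.isSectionAt.proj])
    have hC' : Ψ 0 x ∈ C.total.source := he hx ▸ hC
    refine ⟨fun w => (formDensity T.vol.form ψ w)⁻¹ •
      symplecticCurrent (localLagrangian T.vol T.L C) (localFamily C Φ) (localFamily C Ψ) w,
      ?_, ?_⟩
    · have h1 := contDiffAt_formDensity T.vol hψ (ψ.map_source hxψ)
      have h2 := contDiffAt_symplecticCurrent (hreg hΦ.1 hx hC).1 (hreg hΨ.1 hx hC').1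
        (hreg hΦ.1 hx hC).2 (hreg hΨ.1 hx hC').2
      exact ((h1.inv (formDensity_ne_zero T.vol hψ (ψ.map_source hxψ))).of_le (by simp)).smul h2
    · filter_upwards [vcoord_current hΦ.1 hΨ.1 he hx hC] with w hw hwU
      exact (hw hwU).symm
  · have hxc := subset_closure hx
    have hf := hΦ.1.isFamilyAt 0 hxc
    have hf' := hΨ.1.isFamilyAt 0 hxc
    set C := (T.chart (Φ 0 x)).rebase ψ hψ with hCdef
    have hC : Φ 0 x ∈ C.total.source := mem_rebase_chart hψ (by rwa [hf.isSectionAt.proj])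
    have hC' : Ψ 0 x ∈ C.total.source := he hxc ▸ hC
    have hU : ∀ᶠ w in 𝓝 (ψ x), ψ.symm w ∈ T.U :=
      (tendsto_chart_symm hxψ).eventually (T.domain.isOpen.mem_nhds hx)
    have h1 : (fun w => formDensity T.vol.form ψ w • vcoord ψ (T.current Φ Ψ) w)
        =ᶠ[𝓝 (ψ x)] symplecticCurrent (localLagrangian T.vol T.L C) (localFamily C Φ)
          (localFamily C Ψ) := by
      filter_upwards [vcoord_current hΦ.1 hΨ.1 he hxc hC,
        ψ.open_target.mem_nhds (ψ.map_source hxψ), hU] with w hw hwt hwU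
      have hw' : vcoord ψ (T.current Φ Ψ) w = _ := hw (subset_closure hwU)
      rw [hw', smul_smul]
      have := formDensity_ne_zero T.vol hψ hwt
      show (formDensity T.vol.form ψ w * (formDensity T.vol.form ψ w)⁻¹) • _ = _
      rw [mul_inv_cancel₀ this, one_smul]
    -- The coordinate equations apply only while the field value stays in the chart, that is, for
    -- small parameters.
    have hEL : ∀ {Ξ : ℝ → X → Y}, T.IsSolutionFamily Ξ → Ξ 0 x ∈ C.total.source →
        ∀ᶠ e in 𝓝 (0 : ℝ), EulerLagrangeAt (localLagrangian T.vol T.L C)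
          (fun w => familyJet (localFamily C Ξ) (e, w)) (C.base x) := by
      intro Ξ hΞ hΞC
      filter_upwards [(tendsto_left x).eventually
        ((hΞ.1.isFamilyAt 0 hxc).eventually_mem hΞC)] with e heC
      exact (hΞ.2 e).2 x hx C heC
    rw [divergence_congr h1, zero_mul]
    refine divergence_symplecticCurrent (hreg hΦ.1 hxc hC).1 (hreg hΨ.1 hxc hC').1 ?_
      (hreg hΦ.1 hxc hC).2 (hEL hΦ hC) (hEL hΨ hC')
    filter_upwards [hU] with w hw
    show (C.total (Φ 0 (ψ.symm w))).2 = (C.total (Ψ 0 (ψ.symm w))).2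
    rw [he (subset_closure hw)]

/-- The symplectic current has no flux through the boundary. -/
theorem integral_current (hΦ : T.IsSolutionFamily Φ) (hΨ : T.IsSolutionFamily Ψ)
    (he : EqOn (Φ 0) (Ψ 0) (closure T.U)) :
    ∫ s, T.bflux s (T.current Φ Ψ (T.ι s)) ∂T.mB = 0 := by
  have h := (hasDivergence_current hΦ hΨ he).stokes T.isVolumeMeasure T.isVolumeMeasure_B T.domain
  rw [integral_zero] at h
  exact h.symm

/-! ### The symplectic form on the image of the differential -/

/-- At each parameter near `0`, `IsDifferential.momComponent_eq` identifies the momenta of the curve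
with fluxes of Legendre vectors. The flux at `s` is a fixed linear map, so it commutes with the
derivative. -/
lemma hasDerivAt_curveCoord {γ : ℝ → T.NormalMomenta} (hγ : ∀ ε, T.IsDifferential (γ ε))
    (hΦ : T.IsFieldFamily Φ) (hs : ∀ ε, T.Solves (Φ ε) (γ ε).base) {s : B}
    {C : AdaptedChart n k T.ρ} (hC : Φ 0 (T.ι s) ∈ C.total.source) :
    HasDerivAt (T.curveCoord γ C s)
      ((ctot C.total (Φ 0 (T.ι s)) (vel n k fun e => Φ e (T.ι s))).2,
        (WithLp.toLp 2 fun a => T.bflux s (deriv (legFrame T.L C Φ (T.ι s) a) 0))) 0 := by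
  have hf := hΦ.isFamilyAt 0 (T.domain.mem_closure s)
  have h1 : HasDerivAt (fun e => ((C.total (Φ e (T.ι s))).2,
      (WithLp.toLp 2 fun a => T.bflux s (legFrame T.L C Φ (T.ι s) a e) : Eu k)))
      ((ctot C.total (Φ 0 (T.ι s)) (vel n k fun e => Φ e (T.ι s))).2,
        (WithLp.toLp 2 fun a => T.bflux s (deriv (legFrame T.L C Φ (T.ι s) a) 0))) 0 := by
    refine (hf.hasDerivAt_total_snd hC).prodMk (hasDerivAt_toLp fun a => ?_)
    exact hasDerivAt_flux s
      (hasDerivAt_legFrame T.fibred T.smooth_L hf hC a).differentiableAt.hasDerivAt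
  refine h1.congr_of_eventuallyEq ?_
  filter_upwards [(tendsto_left (T.ι s)).eventually (hf.eventually_mem hC)] with e he
  have he' : (γ e).base.toFun s ∈ C.total.source := by
    rw [← (hs e).2]; exact he
  refine Prod.ext ?_ ?_
  · show (C.total ((γ e).base.toFun s)).2 = (C.total (Φ e (T.ι s))).2
    rw [(hs e).2]
  · ext a
    show T.momComponent C (γ e).base.toFun (γ e).mom s a
      = T.bflux s (legFrame T.L C Φ (T.ι s) a e)
    rw [(hγ e).momComponent_eq (hs e) he' a, legFrame, (hs e).2]

/-- The symplectic form on the image of the differential is the flux of the symplectic current. -/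
theorem symplectic_eq {γ γ' : ℝ → T.NormalMomenta} (hγ : ∀ ε, T.IsDifferential (γ ε))
    (hγ' : ∀ ε, T.IsDifferential (γ' ε)) (h0 : γ 0 = γ' 0)
    (hΦ : T.IsFieldFamily Φ) (hs : ∀ ε, T.Solves (Φ ε) (γ ε).base)
    (hΨ : T.IsFieldFamily Ψ) (hs' : ∀ ε, T.Solves (Ψ ε) (γ' ε).base) :
    T.symplectic γ γ' = ∫ s, T.bflux s (T.current Φ Ψ (T.ι s)) ∂T.mB := by
  refine integral_congr_ae (Eventually.of_forall fun s => ?_)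
  have e0 : (γ 0).base.toFun s = Φ 0 (T.ι s) := ((hs 0).2 s).symm
  have e1 : Ψ 0 (T.ι s) = Φ 0 (T.ι s) := by rw [(hs 0).2, (hs' 0).2, h0]
  simp only
  rw [e0, current]
  set C := T.chart (Φ 0 (T.ι s)) with hCdef
  have hC : Φ 0 (T.ι s) ∈ C.total.source := mem_chart _
  rw [(hasDerivAt_curveCoord hγ hΦ hs hC).deriv,
    (hasDerivAt_curveCoord hγ' hΨ hs' (C := C) (e1 ▸ hC)).deriv, canonicalSymplectic_apply,
    sympVec, map_sum]
  refine Finset.sum_congr rfl fun a _ => ?_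
  rw [map_sub, map_smul, map_smul]
  rfl

/-! ### The multisymplectic form on the boundary -/

lemma localProlong_eq (hΦ : T.IsFieldFamily Φ) (hx : x ∈ closure T.U) {C : AdaptedChart n k T.ρ}
    (hC : Φ 0 x ∈ C.total.source)
    {V : ∀ x, TangentSpace 𝓘(ℝ, Eu (n + 1) × Eu k) (Φ 0 x)}
    (hV : ∀ x, V x = velocity n k fun ε => Φ ε x) :
    localProlong C (Φ 0) V (C.base x) = familyProlong (localFamily C Φ) (C.base x) := by
  have hf := hΦ.isFamilyAt 0 hx
  have hxb := hf.isSectionAt.mem_base hC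
  have h1 : localVector C (Φ 0) V =ᶠ[𝓝 (C.base x)] familyVelocity (localFamily C Φ) := by
    filter_upwards [eventually_chart_symm (ψ := C.base) hxb hf.eventually,
      eventually_chart_symm (ψ := C.base) hxb (hf.eventually_mem hC),
      C.base.open_target.mem_nhds (C.base.map_source hxb)] with w hw hwC hwt
    have e1 := hw.ctot_vel hwC
    rw [C.base.right_inv hwt] at e1
    rw [← e1, localVector, hV]
    rfl
  rw [localProlong, familyProlong, h1.fderiv_eq, h1.self_of_nhds]

lemma baseVol_cons_sum {d : ℕ} (S : Eu (d + 1)) (v : Fin d → Eu (d + 1)) :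
    baseVol (d + 1) (Fin.cons S v) = ∑ μ, S μ * baseVol (d + 1) (Fin.cons (stdVec μ) v) := by
  have h : ∀ Z : Eu (d + 1), baseVol (d + 1) (Fin.cons Z v) = (baseVol (d + 1)).curryLeft Z v :=
    fun _ => rfl
  conv_lhs => rw [h, eu_sum S, map_sum]
  rw [ContinuousAlternatingMap.sum_apply]
  refine Finset.sum_congr rfl fun μ _ => ?_
  rw [map_smul, h]
  rfl

lemma deriv_momentum_eq {ℓ : JetCoord n k → ℝ} {u : ℝ × Eu (n + 1) → Eu k} {z : Eu (n + 1)}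
    (hu : ContDiffAt ℝ 2 u (0, z)) (hℓ : ContDiffAt ℝ 2 ℓ (familyJet u (0, z)))
    (μ : Fin (n + 1)) (a : Fin k) :
    deriv (fun e => momentum ℓ (familyJet u (e, z)) μ a) 0
      = fderiv ℝ (fun q => momentum ℓ q μ a) (familyJet u (0, z)) (familyProlong u z) := by
  have h1 : HasFDerivAt (fun q => momentum ℓ q μ a) _ ((fun e => familyJet u (e, z)) 0) :=
    ((contDiffAt_momentum (r := 1) hℓ μ a).differentiableAt (by simp)).hasFDerivAt
  exact (h1.comp_hasDerivAt 0 (hasDerivAt_familyJet hu)).deriv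

/-- The pulled back contraction of the multisymplectic form is the flux form of the symplectic
current. -/
lemma msForm_apply (hΦ : T.IsFieldFamily Φ) (hΨ : T.IsFieldFamily Ψ) (h0 : Ψ 0 = Φ 0)
    {V W : ∀ x, TangentSpace 𝓘(ℝ, Eu (n + 1) × Eu k) (Φ 0 x)}
    (hV : ∀ x, V x = velocity n k fun ε => Φ ε x)
    (hW : ∀ x, W x = velocity n k fun ε => Ψ ε x) (hx : x ∈ closure T.U)
    (v : Fin n → Eu (n + 1)) :
    T.msForm (Φ 0) V W x v = T.vol.at x (Fin.cons (T.current Φ Ψ x) v) := by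
  set C := T.chart (Φ 0 x) with hCdef
  have hC : Φ 0 x ∈ C.total.source := mem_chart _
  have hC' : Ψ 0 x ∈ C.total.source := by rw [h0]; exact hC
  have hf := hΦ.isFamilyAt 0 hx
  have hf' := hΨ.isFamilyAt 0 hx
  have hxb := hf.isSectionAt.mem_base hC
  have he : EqOn (Φ 0) (Ψ 0) (closure T.U) := fun y _ => by rw [h0]
  set z := C.base x with hz
  set ℓ := localLagrangian T.vol T.L C with hℓ
  have hu := (hf.contDiffAt hC).of_le two_le_infty
  have hu' := (hf'.contDiffAt hC').of_le two_le_infty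
  have hℓu := (hf.contDiffAt_lagrangian T.smooth_L hC).of_le two_le_infty
  have hℓu' := (hf'.contDiffAt_lagrangian T.smooth_L hC').of_le two_le_infty
  have hjet : familyJet (localFamily C Ψ) (0, z) = familyJet (localFamily C Φ) (0, z) := by
    show localJet C (Ψ 0) z = localJet C (Φ 0) z
    rw [h0]
  -- `W` is typed along `Φ 0` but is the velocity of `Ψ`; generalizing the field allows the
  -- substitution.
  have hW' : localProlong C (Φ 0) W z = familyProlong (localFamily C Ψ) z := by
    have hW2 : ∀ (φ : X → Y) (hφ : Ψ 0 = φ)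
        (W : ∀ x, TangentSpace 𝓘(ℝ, Eu (n + 1) × Eu k) (φ x)),
        (∀ x, W x = velocity n k fun ε => Ψ ε x) →
        localProlong C φ W z = familyProlong (localFamily C Ψ) z := by
      rintro _ rfl W hW
      exact localProlong_eq hΨ hx hC' hW
    exact hW2 _ h0 W hW
  have hd : DifferentiableAt ℝ (localJet C (Φ 0)) z := by
    have h1 := (contDiffAt_familyJet (r := 1) hu).differentiableAt (by simp)
    exact h1.comp z (((differentiableAt_const _).prodMk differentiableAt_id))
  -- The jet of a field covers the identity of the base, so pulling back leaves `d^n x_μ` unchanged.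
  have hfst : ∀ w, (fderiv ℝ (localJet C (Φ 0)) z w).1 = w := by
    intro w
    have h1 := hd.hasFDerivAt.fst
    have h2 : HasFDerivAt (fun w => (localJet C (Φ 0) w).1)
      (ContinuousLinearMap.id ℝ (Eu (n + 1))) z := hasFDerivAt_id z
    exact congrArg (fun A : Eu (n + 1) →L[ℝ] Eu (n + 1) => A w) (h1.unique h2)
  have e1 : T.msForm (Φ 0) V W x v = multisymplectic ℓ (localJet C (Φ 0) z)
      (Fin.cons (localProlong C (Φ 0) V z) (Fin.cons (localProlong C (Φ 0) W z)
        fun i => fderiv ℝ (localJet C (Φ 0)) z (dchart C.base x (v i)))) := rfl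
  rw [e1, localProlong_eq hΦ hx hC hV, hW']
  have e2 := multisymplectic_apply (q := localJet C (Φ 0) z) hℓu
    (v := familyProlong (localFamily C Φ) z) (w := familyProlong (localFamily C Ψ) z) rfl rfl
    fun i => fderiv ℝ (localJet C (Φ 0)) z (dchart C.base x (v i))
  rw [e2, T.vol.at_eq C.base_mem hxb]
  have e3 : (fun i => dchart C.base x ((Fin.cons (T.current Φ Ψ x) v : Fin (n + 1) → Eu (n + 1)) i))
      = Fin.cons ((formDensity T.vol.form C.base z)⁻¹ •
        symplecticCurrent ℓ (localFamily C Φ) (localFamily C Ψ) z)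
        fun i => dchart C.base x (v i) := by
    funext i
    refine Fin.cases ?_ (fun j => ?_) i
    · exact dchart_current hΦ hΨ he hx hC
    · rfl
  -- Expanding the determinant along the current produces its components against `d^n x_μ`; the
  -- density cancels against the one in the current.
  rw [e3, baseVol_cons_sum, Finset.mul_sum]
  have hf0 := formDensity_ne_zero T.vol C.base_mem (C.base.map_source hxb)
  refine Finset.sum_congr rfl fun μ _ => ?_
  rw [dxContr_apply]
  simp only [hfst]
  rw [PiLp.smul_apply, smul_eq_mul, ← mul_assoc, mul_inv_cancel_left₀ hf0]
  congr 1
  refine Finset.sum_congr rfl fun a _ => ?_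
  rw [deriv_momentum_eq hu hℓu, deriv_momentum_eq hu' hℓu', hjet]
  rfl

/-- The integral of the multisymplectic form is the flux of the symplectic current. -/
theorem msIntegral_eq (hΦ : T.IsFieldFamily Φ) (hΨ : T.IsFieldFamily Ψ) (h0 : Ψ 0 = Φ 0)
    {V W : ∀ x, TangentSpace 𝓘(ℝ, Eu (n + 1) × Eu k) (Φ 0 x)}
    (hV : ∀ x, V x = velocity n k fun ε => Φ ε x)
    (hW : ∀ x, W x = velocity n k fun ε => Ψ ε x) :
    T.msIntegral (Φ 0) V W = ∫ s, T.bflux s (T.current Φ Ψ (T.ι s)) ∂T.mB := by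
  refine integral_congr_ae (Eventually.of_forall fun s => ?_)
  have h := msForm_apply hΦ hΨ h0 hV hW (T.domain.mem_closure s)
    fun i => mder (Eu n) (Eu (n + 1)) T.ι s (stdVec i)
  show T.msForm (Φ 0) V W (T.ι s) (fun i => mder (Eu n) (Eu (n + 1)) T.ι s (stdVec i))
    / T.σ.at s (fun i => stdVec i)
    = T.vol.at (T.ι s) (Fin.cons (T.current Φ Ψ (T.ι s))
      fun i => mder (Eu n) (Eu (n + 1)) T.ι s (stdVec i)) / T.σ.at s (fun i => stdVec i)
  rw [h]

/-- First variations come from families of solutions with the same initial field, so the integral is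
the flux of a divergence free current. Admissibility of the boundary data plays no role. -/
theorem multisymplecticFormFormula : T.MultisymplecticFormFormula := by
  rintro φ V W - ⟨Φ, hΦ, rfl, hV⟩ ⟨Ψ, hΨ, h0, hW⟩
  rw [msIntegral_eq hΦ.1 hΨ.1 h0 hV hW]
  exact integral_current hΦ hΨ fun x _ => by rw [h0]

/-- The two families start at solutions with the same admissible boundary data, which agree on the
closure of `U` though perhaps not beyond; this is all that `integral_current` requires. -/
theorem isIsotropicImage : T.IsIsotropicImage := by
  rintro γ γ' ⟨-, hγ, -, Φ, hΦ, hs⟩ ⟨-, hγ', -, Ψ, hΨ, hs'⟩ h0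
  rw [symplectic_eq (fun ε => (hγ ε).2) (fun ε => (hγ' ε).2) h0 hΦ.1 hs hΨ.1 hs']
  refine integral_current hΦ hΨ (admissible_eqOn (hγ 0).1 (hs 0) ?_)
  rw [h0]
  exact hs' 0

end FieldTheory

end BoundaryFields

end

theorem theorem2 {n k : ℕ} {X Y B : Type*}
    [TopologicalSpace X] [T2Space X] [SecondCountableTopology X]
    [ChartedSpace (Eu (n + 1)) X] [IsManifold (𝓡 (n + 1)) ∞ X]
    [MeasurableSpace X] [BorelSpace X]
    [TopologicalSpace Y] [T2Space Y] [SecondCountableTopology Y]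
    [ChartedSpace (Eu (n + 1) × Eu k) Y] [IsManifold 𝓘(ℝ, Eu (n + 1) × Eu k) ∞ Y]
    [TopologicalSpace B] [T2Space B] [SecondCountableTopology B]
    [ChartedSpace (Eu n) B] [IsManifold (𝓡 n) ∞ B]
    [MeasurableSpace B] [BorelSpace B]
    (T : FieldTheory n k X Y B) :
    -- `dL_∂U : 𝒦 → T^*𝒴` is well defined
    (∀ b ∈ T.admissible, ∃! p : T.NormalMomenta, p ∈ T.imageDifferential ∧ p.base = b) ∧
    -- it maps smooth curves to smooth curves
    (∀ c : ℝ → T.BoundaryData, T.IsAdmissibleCurve c →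
      ∃ γ, T.IsImageCurve γ ∧ ∀ ε, (γ ε).base = c ε) ∧
    -- `((dL_∂U)^* ω)(δφ, δφ') = ∫_∂U (j¹φ)^*(i_{j¹W} i_{j¹V} Ω_L)`
    (∀ (γ γ' : ℝ → T.NormalMomenta) (φ : X → Y)
      (V W : ∀ x, TangentSpace 𝓘(ℝ, Eu (n + 1) × Eu k) (φ x)) (Φ Ψ : ℝ → X → Y),
      T.IsImageCurve γ → T.IsImageCurve γ' → γ 0 = γ' 0 →
      T.IsSolutionFamily Φ → (∀ ε, T.Solves (Φ ε) (γ ε).base) → Φ 0 = φ →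
      (∀ x, V x = velocity n k (fun ε => Φ ε x)) →
      T.IsSolutionFamily Ψ → (∀ ε, T.Solves (Ψ ε) (γ' ε).base) → Ψ 0 = φ →
      (∀ x, W x = velocity n k (fun ε => Ψ ε x)) →
      T.symplectic γ γ' = T.msIntegral φ V W) ∧
    -- `ℳ` is isotropic if and only if the multisymplectic form formula holds
    (T.IsIsotropicImage ↔ T.MultisymplecticFormFormula) := by
  refine ⟨fun b hb => FieldTheory.existsUnique_differential hb,
    fun c hc => FieldTheory.exists_imageCurve hc, ?_,
    -- Each side of the equivalence is a theorem, both resting on the conservation of the same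
    -- current.
    fun _ => FieldTheory.multisymplecticFormFormula, fun _ => FieldTheory.isIsotropicImage⟩
  intro γ γ' φ V W Φ Ψ hγ hγ' h0 hΦ hs hΦ0 hV hΨ hs' hΨ0 hW
  subst hΦ0
  -- Both sides of the pullback identity are the flux of the symplectic current; its vanishing is
  -- not used here.
  rw [FieldTheory.symplectic_eq (fun ε => (hγ.2.1 ε).2) (fun ε => (hγ'.2.1 ε).2) h0 hΦ.1 hs
    hΨ.1 hs', FieldTheory.msIntegral_eq hΦ.1 hΨ.1 hΨ0 hV hW]
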